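/- **Setting.** Let $U$ be a ribbon Hopf algebra over $\mathbb C$, with coproduct $\Delta$, counit $\epsilon$, antipode $S$, universal $R$-matrix $\mathcal R=\sum r^+\otimes r^-\in U\otimes U$ (so $\mathcal R\Delta=\Delta^{op}\mathcal R$, $(\Delta\otimes \mathrm{id})\mathcal R=\mathcal R_{13}\mathcal R_{23}$, $(\mathrm{id}\otimes\Delta)\mathcal R=\mathcal R_{13}\mathcal R_{12}$) and ribbon element $\nu$ (central, $\nu^2=uS(u)$ with $u=\sum S(r^-)r^+$, $S(\nu)=\nu$, $\epsilon(\nu)=1$, $\Delta(\nu)=(\mathcal R_{21}\mathcal R)^{-1}(\nu\otimes\nu)$). The braiding of $U$-modules is $\sigma=\tau\circ\mathcal R$, $\tau$ the flip. *The algebras $A$ and $D_U$.* $U\otimes U$ acts on $U^*$ by $((x\otimes y)\phi)(h)=\phi(S(x)hy)$. Let $F\subseteq U^*$ be the sum of all finite-dimensional $U\otimes U$-submodules of $U^*$ (spanned by the matrix coefficients $c_{f,v}(x)=f(xv)$ of finite-dimensional $U$-modules), with the product $\mu$ dual to $\Delta$. Let $U^{[2]}$ be the algebra $U\otimes U$ with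 coproduct $x\otimes y\mapsto \mathcal R_{23}^{-1}\tau_{23}(\Delta(x)\otimes\Delta(y))\mathcal R_{23}$. The reflection equation algebra $A$ is the vector space $F$ with product $a\otimes b\mapsto\mu(\mathcal R_{13}\mathcal R_{23}\cdot(a\otimes b))$; it is a $U^{[2]}$-module algebra. $D_U$ is the subalgebra $A\otimes U\otimes 1$ of the smash product $A\rtimes U^{[2]}$ (in which $ha=(h_1\rhd a)h_2$). Put $\partial_\lhd:U\to D_U$, $x\mapsto x\otimes 1$. *The adjoint action.* Let $U'$ be the set of $y\in U$ for which $\mathrm{ad}(U)y$ is finite-dimensional, where $\mathrm{ad}(h)y=h_1yS(h_2)$; then $\Delta(U')\subseteq U\otimes U'$. For $y\in U'$ write $\mathrm{ad}(h)y=\sum_i a_i(h)y_i$ for all $h\in U$, with $\sum_i a_i\otimes y_i\in F\otimes U$, and put $$\partial_\rhd(y)=\sum_i\sum \big((s^+_1\otimes s^+_2)\rhd a_i\big)\,\partial_\lhd\big(s^-\,S^{-1}(y_i)\big)\in D_U,\qquad \mathcal R^{-1}=\sum s^+\otimes s^- .$$ It acts on $A\subseteq U^*$ as $\phi\mapsto\phi(\,\cdot\,y)$.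 On a $D_U$-module, $x\in U'$ acts by $\mathrm{ad}(x)=\partial_\lhd(x_1)\partial_\rhd(x_2)$. For a finite-dimensional $U$-module $V$ and a $D_U$-module $M$, $U'$ acts on $V^{\otimes n}\otimes M$ through the iterated coproduct, by the $U$-action on the factors $V$ and by the adjoint action on $M$; put $$W=(V^{\otimes n}\otimes M)^{inv}=\{w : x\cdot w=\epsilon(x)w\ \text{ for all } x\in U'\}.$$ *The group.* $B_n^{Ell}$ is the group generated by $X_1,\dots,X_n,Y_1,\dots,Y_n,T_1,\dots,T_{n-1}$ with relations: the $X_i$ commute; the $Y_i$ commute; $T_iT_{i+1}T_i=T_{i+1}T_iT_{i+1}$; $T_iT_j=T_jT_i$ for $|i-j|\ge 2$; $T_iX_iT_i=X_{i+1}$ and $T_iY_iT_i=Y_{i+1}$; $T_iX_j=X_jT_i$ and $T_iY_j=Y_jT_i$ for $j\neq i,i+1$; $X_1Y_2=Y_2X_1T_1^2$ (if $n\ge2$); $\tilde YX_i=X_i\tilde Y$ with $\tilde Y=\prod_jY_j$. **Theorem.** Let $U$ be a ribbon Hopf algebra over $\mathbb C$, $n\ge 0$ an integer and $V$ a finite-dimensional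 $U$-module. There is a functor $$F_{n,V}:D_U\text{-mod}\to \mathrm{Rep}(B_n^{Ell})$$ whose value on a $D_U$-module $M$ is the vector space $W=(V^{\otimes n}\otimes M)^{inv}$ and whose value on a morphism $f$ is the restriction of $\mathrm{id}\otimes f$. Writing $V^{\otimes n}\otimes M=V_n\otimes\cdots\otimes V_1\otimes M$, the generators act on $W$ as the restrictions of the following operators: $T_i$ is the braiding $\sigma_{V,V}$ of the adjacent factors $V_{i+1}\otimes V_i$; $Y_1$ is the double braiding $\sigma_{M,V}\sigma_{V,M}$ of $V_1$ and $M$, i.e. the action of $\mathcal R_{21}\mathcal R$ on $V_1\otimes M$, where $U$ acts on $M$ through $\partial_\lhd$; and $X_1=L_{01}$ is the coaction of $A$ on $V_1$ followed by the action of $A$ on $M$, i.e. $v\otimes m\mapsto\sum_ie_i\otimes c_{e_i^*,v}\,m$ on $V_1\otimes M$, for a basis $(e_i)$ of $V$ with dual basis $(e_i^*)$. -/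

import Mathlib

open scoped TensorProduct ModuleCat
open CategoryTheory

universe u v w x

namespace QuantumD

noncomputable section

/-! ## The elliptic braid group -/

section EllipticBraid

/-- Generators of the elliptic braid group. Indices start at `0`, so `X i`, `Y i` and `T i` are the
generators usually called `X_{i+1}`, `Y_{i+1}` and `T_{i+1}`. -/
inductive EllGen (n : ℕ) : Type
  | X (i : Fin n)
  | Y (i : Fin n)
  | T (i : Fin (n - 1))

/-- The `i`-th of the two strands that `T i` exchanges. -/
def lo {n : ℕ} (i : Fin (n - 1)) : Fin n := ⟨i, by omega⟩

/-- The `(i+1)`-st strand, the second of the two strands that `T i` exchanges. -/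
def hi {n : ℕ} (i : Fin (n - 1)) : Fin n := ⟨i + 1, by omega⟩

open FreeGroup in
/-- Defining relations of the elliptic braid group, as pairs of words. -/
inductive EllRel (n : ℕ) : FreeGroup (EllGen n) → FreeGroup (EllGen n) → Prop
  | X_comm (i j : Fin n) : EllRel n (of (.X i) * of (.X j)) (of (.X j) * of (.X i))
  | Y_comm (i j : Fin n) : EllRel n (of (.Y i) * of (.Y j)) (of (.Y j) * of (.Y i))
  | braid (i j : Fin (n - 1)) (h : (j : ℕ) = i + 1) :
      EllRel n (of (.T i) * of (.T j) * of (.T i)) (of (.T j) * of (.T i) * of (.T j))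
  | far (i j : Fin (n - 1)) (h : (i : ℕ) + 2 ≤ j) :
      EllRel n (of (.T i) * of (.T j)) (of (.T j) * of (.T i))
  | TXT (i : Fin (n - 1)) :
      EllRel n (of (.T i) * of (.X (lo i)) * of (.T i)) (of (.X (hi i)))
  | TYT (i : Fin (n - 1)) :
      EllRel n (of (.T i) * of (.Y (lo i)) * of (.T i)) (of (.Y (hi i)))
  | TX_far (i : Fin (n - 1)) (j : Fin n) (h : j ≠ lo i) (h₂ : j ≠ hi i) :
      EllRel n (of (.T i) * of (.X j)) (of (.X j) * of (.T i))
  | TY_far (i : Fin (n - 1)) (j : Fin n) (h : j ≠ lo i) (h₂ : j ≠ hi i) :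
      EllRel n (of (.T i) * of (.Y j)) (of (.Y j) * of (.T i))
  | XY (i : Fin (n - 1)) (h : (i : ℕ) = 0) :
      EllRel n (of (.X (lo i)) * of (.Y (hi i)))
        (of (.Y (hi i)) * of (.X (lo i)) * of (.T i) * of (.T i))
  | prodY (i : Fin n) :
      EllRel n ((List.ofFn fun j : Fin n => of (EllGen.Y j)).prod * of (.X i))
        (of (.X i) * (List.ofFn fun j : Fin n => of (EllGen.Y j)).prod)

/-- The elliptic braid group on `n` strands. -/
abbrev EllipticBraidGroup (n : ℕ) : Type :=
  PresentedGroup {r : FreeGroup (EllGen n) | ∃ a b, EllRel n a b ∧ r = a * b⁻¹}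

/-- The image of a generator in the elliptic braid group. -/
def EllipticBraidGroup.gen {n : ℕ} (g : EllGen n) : EllipticBraidGroup n := PresentedGroup.of g

end EllipticBraid

/-! ## Ribbon Hopf algebras -/

section Hopf

variable {k : Type w} [Field k] {U : Type u} [Ring U] [HopfAlgebra k U]

variable (k U) in
/-- A universal R-matrix `R` on a Hopf algebra, with `R₁₃ = ∑ r⁺ ⊗ 1 ⊗ r⁻` and so on. -/
structure QuasitriangularStructure where
  /-- the universal R-matrix `∑ r⁺ ⊗ r⁻` -/
  R : (U ⊗[k] U)ˣ
  /-- `R Δ(x) = Δᵒᵖ(x) R` -/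
  R_mul_comul : ∀ x : U, (R : U ⊗[k] U) * Coalgebra.comul x =
    TensorProduct.comm k U U (Coalgebra.comul x) * (R : U ⊗[k] U)
  /-- `(Δ ⊗ id)(R) = R₁₃ R₂₃` -/
  comul_left : TensorProduct.assoc k U U U
      (TensorProduct.map Coalgebra.comul LinearMap.id (R : U ⊗[k] U)) =
    Algebra.TensorProduct.map (AlgHom.id k U) Algebra.TensorProduct.includeRight (R : U ⊗[k] U) *
      (1 ⊗ₜ[k] (R : U ⊗[k] U))
  /-- `(id ⊗ Δ)(R) = R₁₃ R₁₂` -/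
  comul_right : TensorProduct.map LinearMap.id Coalgebra.comul (R : U ⊗[k] U) =
    Algebra.TensorProduct.map (AlgHom.id k U) Algebra.TensorProduct.includeRight (R : U ⊗[k] U) *
      Algebra.TensorProduct.map (AlgHom.id k U) Algebra.TensorProduct.includeLeft (R : U ⊗[k] U)

namespace QuasitriangularStructure

variable (Q : QuasitriangularStructure k U)

/-- `R₂₁ = ∑ r⁻ ⊗ r⁺`. -/
def R21 : U ⊗[k] U := TensorProduct.comm k U U (Q.R : U ⊗[k] U)

/-- The element `R⁻¹` of `U ⊗ U`. -/
def Rinv : U ⊗[k] U := ((Q.R⁻¹ : (U ⊗[k] U)ˣ) : U ⊗[k] U)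

/-- The Drinfeld element `u = ∑ S(r⁻) r⁺`. -/
def drinfeld : U :=
  LinearMap.mul' k U (TensorProduct.map (HopfAlgebra.antipode k) LinearMap.id Q.R21)

end QuasitriangularStructure

variable (k U) in
/-- A ribbon structure on a Hopf algebra: a universal R-matrix with a ribbon element `ν`. -/
structure RibbonStructure extends QuasitriangularStructure k U where
  /-- the ribbon element -/
  ν : U
  ν_central : ∀ x : U, ν * x = x * ν
  /-- `ν² = u S(u)` -/
  ν_sq : ν * ν = toQuasitriangularStructure.drinfeld *
    HopfAlgebra.antipode k toQuasitriangularStructure.drinfeld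
  antipode_ν : HopfAlgebra.antipode k ν = ν
  counit_ν : Coalgebra.counit (R := k) ν = 1
  /-- `Δ(ν) = (R₂₁ R)⁻¹ (ν ⊗ ν)` -/
  comul_ν : (toQuasitriangularStructure.R21 * (R : U ⊗[k] U)) * Coalgebra.comul ν = ν ⊗ₜ[k] ν

end Hopf

/-! ## The restricted dual -/

section Dual

variable {k : Type w} [Field k] {U : Type u} [Ring U] [HopfAlgebra k U]

/-- The action of `U ⊗ U` on `U^*`, `((x ⊗ y) φ)(h) = φ(S(x) h y)`. -/
def dualAct : U ⊗[k] U →ₗ[k] Module.End k (Module.Dual k U) :=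
  TensorProduct.lift <| LinearMap.mk₂ k
    (fun x y => (LinearMap.mulLeft k (HopfAlgebra.antipode k x) ∘ₗ LinearMap.mulRight k y).dualMap)
    (fun x x' y => by ext φ h; simp [add_mul])
    (fun c x y => by ext φ h; simp)
    (fun x y y' => by ext φ h; simp [mul_add])
    (fun c x y => by ext φ h; simp)

@[simp] theorem dualAct_tmul (x y : U) (φ : Module.Dual k U) (h : U) :
    dualAct (x ⊗ₜ[k] y) φ h = φ (HopfAlgebra.antipode k x * (h * y)) := rfl

/-- The product of `U^*`, dual to the coproduct of `U`: `(φ ψ)(h) = φ(h₁) ψ(h₂)`. -/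
def dualMul : Module.Dual k U →ₗ[k] Module.Dual k U →ₗ[k] Module.Dual k U :=
  LinearMap.mk₂ k
    (fun φ ψ => LinearMap.mul' k k ∘ₗ TensorProduct.map φ ψ ∘ₗ Coalgebra.comul)
    (fun a b c => by ext h; simp [TensorProduct.map_add_left])
    (fun r a b => by ext h; simp [TensorProduct.map_smul_left])
    (fun a b c => by ext h; simp [TensorProduct.map_add_right])
    (fun r a b => by ext h; simp [TensorProduct.map_smul_right])

theorem dualMul_apply (φ ψ : Module.Dual k U) (h : U) :
    dualMul φ ψ h = LinearMap.mul' k k (TensorProduct.map φ ψ (Coalgebra.comul h)) := rfl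

end Dual

section Dual2

variable {k : Type w} [Field k] {U : Type u} [Ring U] [HopfAlgebra k U]

open WithConv Coalgebra in
theorem antipode_mul_id_alg {B : Type*} [Ring B] [Algebra k B] (f : U →ₐ[k] B) :
    toConv (f.toLinearMap ∘ₗ HopfAlgebra.antipode k) * toConv f.toLinearMap = 1 := by
  ext x
  rw [(ℛ k x).convMul_apply]
  simpa [map_sum, map_mul] using congrArg f (HopfAlgebra.sum_antipode_mul_eq_algebraMap_counit (ℛ k x))

open WithConv Coalgebra in
theorem id_mul_antipode_alg {B : Type*} [Ring B] [Algebra k B] (f : U →ₐ[k] B) :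
    toConv f.toLinearMap * toConv (f.toLinearMap ∘ₗ HopfAlgebra.antipode k) = 1 := by
  ext x
  rw [(ℛ k x).convMul_apply]
  simpa [map_sum, map_mul] using congrArg f (HopfAlgebra.sum_mul_antipode_eq_algebraMap_counit (ℛ k x))

open WithConv Coalgebra in
theorem incl_mul_incl : toConv (Algebra.TensorProduct.includeLeft : U →ₐ[k] U ⊗[k] U).toLinearMap *
    toConv (Algebra.TensorProduct.includeRight : U →ₐ[k] U ⊗[k] U).toLinearMap =
    toConv (comul : U →ₗ[k] U ⊗[k] U) := by
  ext x
  rw [(ℛ k x).convMul_apply]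
  simpa using (ℛ k x).eq

open WithConv Coalgebra in
theorem comul_antipode (x : U) :
    comul (HopfAlgebra.antipode k x) = ∑ i ∈ (ℛ k x).index,
      HopfAlgebra.antipode k ((ℛ k x).right i) ⊗ₜ[k] HopfAlgebra.antipode k ((ℛ k x).left i) := by
  have h₁ := antipode_mul_id_alg (k := k) (Algebra.TensorProduct.includeLeft : U →ₐ[k] U ⊗[k] U)
  have h₂ := antipode_mul_id_alg (k := k) (Algebra.TensorProduct.includeRight : U →ₐ[k] U ⊗[k] U)
  have h₃ := LinearMap.comul_right_inv (R := k) (C := U)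
  have h₄ := incl_mul_incl (k := k) (U := U)
  set L := toConv (Algebra.TensorProduct.includeLeft : U →ₐ[k] U ⊗[k] U).toLinearMap
  set R := toConv (Algebra.TensorProduct.includeRight : U →ₐ[k] U ⊗[k] U).toLinearMap
  have h₅ := left_inv_eq_right_inv (a := toConv (comul : U →ₗ[k] U ⊗[k] U))
    (b := toConv ((Algebra.TensorProduct.includeRight : U →ₐ[k] U ⊗[k] U).toLinearMap ∘ₗ
      HopfAlgebra.antipode k) * toConv ((Algebra.TensorProduct.includeLeft :
      U →ₐ[k] U ⊗[k] U).toLinearMap ∘ₗ HopfAlgebra.antipode k))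
    (by rw [← h₄, mul_assoc, ← mul_assoc _ L, h₁, one_mul, h₂]) h₃
  have h₆ := congrArg (fun f => f x) h₅
  simp only [(ℛ k x).convMul_apply] at h₆
  simpa using h₆.symm

variable (k U) in
/-- The restricted dual `F` of `U`: the sum of all finite-dimensional `U ⊗ U`-submodules of `U^*`. -/
def restrictedDual : Submodule k (Module.Dual k U) :=
  sSup {E | FiniteDimensional k E ∧ ∀ t : U ⊗[k] U, ∀ φ ∈ E, dualAct t φ ∈ E}

theorem mem_restrictedDual_of {E : Submodule k (Module.Dual k U)} [FiniteDimensional k E]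
    (hE : ∀ x y : U, ∀ φ ∈ E, dualAct (x ⊗ₜ[k] y) φ ∈ E) {φ : Module.Dual k U} (hφ : φ ∈ E) :
    φ ∈ restrictedDual k U := by
  have hE' : ∀ t : U ⊗[k] U, ∀ φ ∈ E, dualAct t φ ∈ E := by
    intro t ψ hψ
    induction t with
    | zero => simp
    | tmul x y => exact hE x y ψ hψ
    | add a b ha hb => simpa using E.add_mem ha hb
  have hE₂ : E ≤ restrictedDual k U := le_sSup ⟨inferInstance, hE'⟩
  exact hE₂ hφ

/-- The matrix coefficient `c_{f,v}(x) = f(x v)` of a representation of `U`. -/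
def matrixCoeff {N : Type*} [AddCommGroup N] [Module k N] (π : U →ₗ[k] Module.End k N) :
    Module.Dual k N →ₗ[k] N →ₗ[k] Module.Dual k U :=
  LinearMap.mk₂ k (fun f v => f ∘ₗ π.flip v)
    (fun _ _ _ => rfl) (fun _ _ _ => rfl) (fun f v v' => by ext; simp) (fun c f v => by ext; simp)

@[simp] theorem matrixCoeff_apply {N : Type*} [AddCommGroup N] [Module k N]
    (π : U →ₗ[k] Module.End k N) (f : Module.Dual k N) (v : N) (x : U) :
    matrixCoeff π f v x = f (π x v) := rfl

theorem matrixCoeff_mem {N : Type*} [AddCommGroup N] [Module k N] [FiniteDimensional k N]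
    (π : U →ₗ[k] Module.End k N) (hπ : ∀ x y, π (x * y) = π x * π y)
    (f : Module.Dual k N) (v : N) : matrixCoeff π f v ∈ restrictedDual k U := by
  refine mem_restrictedDual_of (E := LinearMap.range (TensorProduct.lift (matrixCoeff π))) ?_
    ⟨f ⊗ₜ v, by simp⟩
  rintro x y _ ⟨t, rfl⟩
  induction t with
  | zero => simp
  | add a b ha hb => simpa using Submodule.add_mem _ ha hb
  | tmul g w =>
    refine ⟨(g ∘ₗ π (HopfAlgebra.antipode k x)) ⊗ₜ π y w, ?_⟩
    ext h
    simp [hπ]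

theorem counit_mem_restrictedDual : (Coalgebra.counit : Module.Dual k U) ∈ restrictedDual k U := by
  refine mem_restrictedDual_of (E := k ∙ (Coalgebra.counit : Module.Dual k U)) ?_
    (Submodule.mem_span_singleton_self _)
  intro x y φ hφ
  obtain ⟨c, rfl⟩ := Submodule.mem_span_singleton.1 hφ
  refine Submodule.mem_span_singleton.2
    ⟨c * (Coalgebra.counit (R := k) x * Coalgebra.counit (R := k) y), ?_⟩
  ext h
  simp
  ring

theorem dualAct_mem_restrictedDual (t : U ⊗[k] U) {φ : Module.Dual k U}
    (hφ : φ ∈ restrictedDual k U) : dualAct t φ ∈ restrictedDual k U := by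
  have : restrictedDual k U ≤ (restrictedDual k U).comap (dualAct t) := by
    refine sSup_le fun E hE φ h => ?_
    exact (le_sSup (a := E) hE) (hE.2 t φ h)
  exact this hφ

open Coalgebra in
theorem dualAct_dualMul (x y : U) (φ ψ : Module.Dual k U) :
    dualAct (x ⊗ₜ[k] y) (dualMul φ ψ) = ∑ i ∈ (ℛ k x).index, ∑ j ∈ (ℛ k y).index,
      dualMul (dualAct ((ℛ k x).right i ⊗ₜ[k] (ℛ k y).left j) φ)
        (dualAct ((ℛ k x).left i ⊗ₜ[k] (ℛ k y).right j) ψ) := by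
  ext h
  have hy := (ℛ k y).eq
  have hh := (ℛ k h).eq
  simp only [dualAct_tmul, dualMul_apply, Bialgebra.comul_mul, comul_antipode, LinearMap.sum_apply]
  rw [← hy, ← hh]
  simp only [Finset.sum_mul, Finset.mul_sum, Algebra.TensorProduct.tmul_mul_tmul, map_sum,
    TensorProduct.map_tmul, LinearMap.mul'_apply, dualAct_tmul]
  exact (Finset.sum_congr rfl fun _ _ => Finset.sum_comm).trans Finset.sum_comm

open Coalgebra in
theorem dualMul_mem_restrictedDual {φ ψ : Module.Dual k U} (hφ : φ ∈ restrictedDual k U)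
    (hψ : ψ ∈ restrictedDual k U) : dualMul φ ψ ∈ restrictedDual k U := by
  have key : ∀ E ∈ {E : Submodule k (Module.Dual k U) | FiniteDimensional k E ∧
      ∀ t : U ⊗[k] U, ∀ φ ∈ E, dualAct t φ ∈ E}, ∀ E' ∈ {E : Submodule k (Module.Dual k U) |
      FiniteDimensional k E ∧ ∀ t : U ⊗[k] U, ∀ φ ∈ E, dualAct t φ ∈ E},
      ∀ φ ∈ E, ∀ ψ ∈ E', dualMul φ ψ ∈ restrictedDual k U := by
    rintro E ⟨hE, hE₂⟩ E' ⟨hE', hE'₂⟩ φ hφ ψ hψ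
    have : FiniteDimensional k (Submodule.map₂ dualMul E E') :=
      Module.Finite.iff_fg.2 (Submodule.FG.map₂ _ (Module.Finite.iff_fg.1 hE) (Module.Finite.iff_fg.1 hE'))
    refine mem_restrictedDual_of (E := Submodule.map₂ dualMul E E') ?_
      (Submodule.apply_mem_map₂ _ hφ hψ)
    intro x y χ hχ
    have hle : Submodule.map₂ dualMul E E' ≤
        (Submodule.map₂ dualMul E E').comap (dualAct (x ⊗ₜ[k] y)) := by
      refine Submodule.map₂_le.2 fun α hα β hβ => ?_
      rw [Submodule.mem_comap, dualAct_dualMul]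
      exact Submodule.sum_mem _ fun i _ => Submodule.sum_mem _ fun j _ =>
        Submodule.apply_mem_map₂ _ (hE₂ _ _ hα) (hE'₂ _ _ hβ)
    exact hle hχ
  have h₁ : restrictedDual k U ≤ (restrictedDual k U).comap (dualMul φ) := by
    refine sSup_le fun E' hE' ψ hψ => ?_
    have h₂ : restrictedDual k U ≤ (restrictedDual k U).comap (dualMul.flip ψ) :=
      sSup_le fun E hE φ hφ => key E hE E' hE' φ hφ ψ hψ
    exact h₂ hφ
  exact h₁ hψ

end Dual2

/-! ## The reflection equation algebra and the algebra of differential operators -/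

section DiffOp

variable {k : Type w} [Field k] {U : Type u} [Ring U] [HopfAlgebra k U]

/-- The action of `U ⊗ U` on `F`. -/
def actF : U ⊗[k] U →ₗ[k] Module.End k (restrictedDual k U) where
  toFun t := (dualAct t).restrict fun _ => dualAct_mem_restrictedDual t
  map_add' s t := by ext; simp
  map_smul' c t := by ext; simp

@[simp] theorem coe_actF (t : U ⊗[k] U) (f : restrictedDual k U) :
    (actF t f : Module.Dual k U) = dualAct t (f : Module.Dual k U) := rfl

variable (k U) in
/-- The product `φ ⊗ ψ ↦ φ ψ` of `F`. -/
def mulF : restrictedDual k U ⊗[k] restrictedDual k U →ₗ[k] restrictedDual k U :=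
  TensorProduct.lift <| LinearMap.mk₂ k
    (fun f g => ⟨dualMul f.1 g.1, dualMul_mem_restrictedDual f.2 g.2⟩)
    (fun _ _ _ => Subtype.ext (by simp)) (fun _ _ _ => Subtype.ext (by simp))
    (fun _ _ _ => Subtype.ext (by simp)) (fun _ _ _ => Subtype.ext (by simp))

variable (k U) in
/-- The unit of `F` and of `A`, the counit of `U`. -/
def oneF : restrictedDual k U := ⟨Coalgebra.counit, counit_mem_restrictedDual⟩

variable (k U) in
/-- `x ⊗ y ↦ (x ⊗ 1) ⊗ (y ⊗ 1)`, so that `leg13 R = R₁₃`. -/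
def leg13 : U ⊗[k] U →ₐ[k] (U ⊗[k] U) ⊗[k] (U ⊗[k] U) :=
  Algebra.TensorProduct.map Algebra.TensorProduct.includeLeft Algebra.TensorProduct.includeLeft

variable (k U) in
/-- `x ⊗ y ↦ (1 ⊗ x) ⊗ (y ⊗ 1)`, so that `leg23 R = R₂₃`. -/
def leg23 : U ⊗[k] U →ₐ[k] (U ⊗[k] U) ⊗[k] (U ⊗[k] U) :=
  Algebra.TensorProduct.map Algebra.TensorProduct.includeRight Algebra.TensorProduct.includeLeft

variable (Q : QuasitriangularStructure k U)

/-- The 2-cocycle `c = R₁₃ R₂₃` on `Uᵒ ⊗ U`. -/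
def cocycle : (U ⊗[k] U) ⊗[k] (U ⊗[k] U) := leg13 k U Q.R * leg23 k U Q.R

/-- The product of the reflection equation algebra `A`, that is, of the vector space `F` with the
product `a ⊗ b ↦ μ(c · (a ⊗ b))`, where `μ` is the product of `F`. -/
def mulA : restrictedDual k U ⊗[k] restrictedDual k U →ₗ[k] restrictedDual k U :=
  mulF k U ∘ₗ TensorProduct.homTensorHomMap (RingHom.id k) _ _ _ _ (TensorProduct.map actF actF (cocycle Q))

/-- The coproduct of `U^[2]`: `x ⊗ y ↦ R₂₃⁻¹ τ₂₃(Δ(x) ⊗ Δ(y)) R₂₃`. -/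
def comul2 : U ⊗[k] U →ₗ[k] (U ⊗[k] U) ⊗[k] (U ⊗[k] U) :=
  LinearMap.mulLeft k (leg23 k U Q.Rinv) ∘ₗ LinearMap.mulRight k (leg23 k U Q.R) ∘ₗ
    (TensorProduct.tensorTensorTensorComm k U U U U).toLinearMap ∘ₗ
      TensorProduct.map Coalgebra.comul Coalgebra.comul

variable (k U) in
/-- Generator of the free algebra on `A ⊕ U^[2]` attached to an element of `A`. -/
def genA : restrictedDual k U →ₗ[k] TensorAlgebra k (restrictedDual k U × (U ⊗[k] U)) :=
  TensorAlgebra.ι k ∘ₗ LinearMap.inl k _ _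

variable (k U) in
/-- Generator of the free algebra on `A ⊕ U^[2]` attached to an element of `U^[2]`. -/
def genU2 : U ⊗[k] U →ₗ[k] TensorAlgebra k (restrictedDual k U × (U ⊗[k] U)) :=
  TensorAlgebra.ι k ∘ₗ LinearMap.inr k _ _

/-- Relations of the smash product `A ⋊ U^[2]`: those of `A`, those of `U^[2]` and
`h a = (h₁ ▷ a) h₂`. -/
inductive SmashRel : TensorAlgebra k (restrictedDual k U × (U ⊗[k] U)) →
    TensorAlgebra k (restrictedDual k U × (U ⊗[k] U)) → Prop
  | one_A : SmashRel (genA k U (oneF k U)) 1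
  | mul_A (a b) : SmashRel (genA k U a * genA k U b) (genA k U (mulA Q (a ⊗ₜ b)))
  | one_U : SmashRel (genU2 k U 1) 1
  | mul_U (g h) : SmashRel (genU2 k U g * genU2 k U h) (genU2 k U (g * h))
  | cross (h a) : SmashRel (genU2 k U h * genA k U a)
      (LinearMap.mul' k _ (TensorProduct.map (genA k U ∘ₗ actF.flip a) (genU2 k U) (comul2 Q h)))

/-- The smash product `A ⋊ U^[2]`: the algebra generated by the algebras `A` and `U^[2]` subject to
`h a = (h₁ ▷ a) h₂`. Its underlying vector space is `A ⊗ U^[2]`. -/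
abbrev SmashProduct : Type (max u w) := RingQuot (SmashRel Q)

/-- The map `A → A ⋊ U^[2]`. -/
def inclA : restrictedDual k U →ₗ[k] SmashProduct Q :=
  (RingQuot.mkAlgHom k (SmashRel Q)).toLinearMap ∘ₗ genA k U

/-- The map `U^[2] → A ⋊ U^[2]`. -/
def inclU2 : U ⊗[k] U →ₗ[k] SmashProduct Q :=
  (RingQuot.mkAlgHom k (SmashRel Q)).toLinearMap ∘ₗ genU2 k U

/-- The algebra `D_U = A ⊗ U ⊗ 1 ⊆ A ⋊ U^[2]` of quantum differential operators: the subalgebra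
generated by `A` and by `U ⊗ 1 ⊆ U^[2]`. -/
def DU : Subalgebra k (SmashProduct Q) :=
  Algebra.adjoin k (Set.range (inclA Q) ∪ Set.range fun x : U => inclU2 Q (x ⊗ₜ[k] (1 : U)))

/-- The map `A → D_U`. -/
def opA : restrictedDual k U →ₗ[k] DU Q :=
  (inclA Q).codRestrict (Subalgebra.toSubmodule (DU Q))
    fun a => Algebra.subset_adjoin (Or.inl ⟨a, rfl⟩)

/-- The homomorphism `∂_◁ : U → D_U`, `x ↦ x ⊗ 1`. -/
def dLeft : U →ₗ[k] DU Q :=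
  (inclU2 Q ∘ₗ (TensorProduct.mk k U U).flip 1).codRestrict (Subalgebra.toSubmodule (DU Q))
    fun x => Algebra.subset_adjoin (Or.inr ⟨x, rfl⟩)

end DiffOp

/-! ## The locally finite part and the vector fields -/

section Adjoint

variable {k : Type w} [Field k] {U : Type u} [Ring U] [HopfAlgebra k U]

/-- The adjoint action of `U` on itself, `ad(h) y = h₁ y S(h₂)`. -/
def adU : U →ₗ[k] Module.End k U :=
  LinearMap.mul' k (Module.End k U) ∘ₗ TensorProduct.map (LinearMap.mul k U)
    ((LinearMap.mul k U).flip ∘ₗ HopfAlgebra.antipode k) ∘ₗ Coalgebra.comul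

open Coalgebra in
theorem adU_apply (h y : U) : adU (k := k) h y =
    ∑ i ∈ (ℛ k h).index, (ℛ k h).left i * y * HopfAlgebra.antipode k ((ℛ k h).right i) := by
  simp only [adU, LinearMap.comp_apply]
  rw [← (ℛ k h).eq]
  simp [mul_assoc]

open Coalgebra in
theorem adU_mul (g h : U) : adU (k := k) (g * h) = adU g * adU h := by
  ext y
  simp only [adU, LinearMap.comp_apply, Bialgebra.comul_mul]
  rw [← (ℛ k g).eq, ← (ℛ k h).eq]
  simp [Finset.mul_sum, Finset.sum_mul, mul_assoc,
    HopfAlgebra.antipode_mul_antidistrib]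

variable (k U) in
/-- The locally finite part `U'`: the `y ∈ U` with `ad(U) y` finite-dimensional. -/
def locFin : Submodule k U where
  carrier := {y | FiniteDimensional k (LinearMap.range (adU (k := k) (U := U).flip y))}
  zero_mem' := by
    change FiniteDimensional k (LinearMap.range (adU.flip (0 : U)))
    rw [map_zero, LinearMap.range_zero]
    infer_instance
  add_mem' {a b} (ha : FiniteDimensional k _) (hb : FiniteDimensional k _) := by
    change FiniteDimensional k (LinearMap.range (adU.flip (a + b)))
    refine Submodule.finiteDimensional_of_le
      (S₂ := LinearMap.range (adU (k := k).flip a) ⊔ LinearMap.range (adU (k := k).flip b)) ?_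
    rintro _ ⟨h, rfl⟩
    rw [map_add, LinearMap.add_apply]
    exact Submodule.add_mem_sup ⟨h, rfl⟩ ⟨h, rfl⟩
  smul_mem' c a (ha : FiniteDimensional k _) := by
    change FiniteDimensional k (LinearMap.range (adU.flip (c • a)))
    refine Submodule.finiteDimensional_of_le (S₂ := LinearMap.range (adU (k := k).flip a)) ?_
    rintro _ ⟨h, rfl⟩
    rw [map_smul, LinearMap.smul_apply]
    exact Submodule.smul_mem _ _ ⟨h, rfl⟩

variable (k U) in
/-- The injection `F ⊗ U → Hom(U, U)`, `a ⊗ u ↦ (h ↦ a(h) u)`. -/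
def evalF : restrictedDual k U ⊗[k] U →ₗ[k] (U →ₗ[k] U) :=
  dualTensorHom k U U ∘ₗ (restrictedDual k U).subtype.rTensor U

@[simp] theorem evalF_tmul (a : restrictedDual k U) (u h : U) :
    evalF k U (a ⊗ₜ u) h = (a : Module.Dual k U) h • u := by
  simp [evalF]

theorem evalF_injective : Function.Injective (evalF k U) := by
  classical
  let b := Module.Basis.ofVectorSpace k U
  intro s t hst
  apply (TensorProduct.equivFinsuppOfBasisRight b (M := restrictedDual k U)).injective
  have key : ∀ (t : restrictedDual k U ⊗[k] U) (h : U) i,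
      ((TensorProduct.equivFinsuppOfBasisRight b t i : restrictedDual k U) : Module.Dual k U) h =
        b.repr (evalF k U t h) i := by
    intro t h i
    induction t with
    | zero => simp
    | add x y hx hy => simp [hx, hy]
    | tmul a u => simp [mul_comm]
  ext i h
  rw [key, key, hst]

theorem adU_mem_range_evalF (y : locFin k U) :
    adU.flip (y : U) ∈ LinearMap.range (evalF k U) := by
  let E := LinearMap.range (adU (k := k).flip (y : U))
  have : FiniteDimensional k E := y.2
  have hE : ∀ h : U, ∀ z ∈ E, adU (k := k) h z ∈ E := by
    rintro h _ ⟨g, rfl⟩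
    exact ⟨h * g, by simp [adU_mul]⟩
  let π : U →ₗ[k] Module.End k E :=
    { toFun := fun h => (adU h).restrict (hE h)
      map_add' := fun g h => by ext; simp
      map_smul' := fun c h => by ext; simp }
  have hπ : ∀ g h, π (g * h) = π g * π h := fun g h => by ext; simp [π, adU_mul]
  have hy : (y : U) ∈ E := ⟨1, by simp [adU, Algebra.TensorProduct.one_def]⟩
  let b := Module.finBasis k E
  refine ⟨∑ i, (⟨matrixCoeff π (b.coord i) ⟨y, hy⟩, matrixCoeff_mem π hπ _ _⟩ :
    restrictedDual k U) ⊗ₜ[k] (b i : U), ?_⟩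
  ext h
  have h₁ : ((∑ i, b.repr (π h ⟨y, hy⟩) i • b i : E) : U) = adU h (y : U) :=
    congrArg Subtype.val (b.sum_repr (π h ⟨y, hy⟩))
  rw [LinearMap.flip_apply]
  rw [← h₁, map_sum, LinearMap.sum_apply, AddSubmonoidClass.coe_finsetSum]
  exact Finset.sum_congr rfl fun i _ => by simp

variable (k U) in
/-- The coadjoint map `U' → F ⊗ U`, `y ↦ ∑ aᵢ ⊗ yᵢ` with `ad(h) y = ∑ aᵢ(h) yᵢ` for all `h`. -/
def coad : locFin k U →ₗ[k] restrictedDual k U ⊗[k] U :=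
  (LinearEquiv.ofInjective (evalF k U) evalF_injective).symm.toLinearMap ∘ₗ
    (adU.flip ∘ₗ (locFin k U).subtype).codRestrict _ adU_mem_range_evalF

theorem evalF_coad (y : locFin k U) (h : U) : evalF k U (coad k U y) h = adU (k := k) h (y : U) := by
  have : evalF k U (coad k U y) = (adU (k := k)).flip (y : U) := by
    rw [coad]
    exact congrArg Subtype.val ((LinearEquiv.ofInjective (evalF k U) evalF_injective).apply_symm_apply
      ⟨(adU (k := k)).flip (y : U), adU_mem_range_evalF y⟩)
  rw [this, LinearMap.flip_apply]

theorem lTensor_locFin_injective :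
    Function.Injective ((locFin k U).subtype.lTensor U) :=
  Module.Flat.lTensor_preserves_injective_linearMap _ (Submodule.injective_subtype _)

open WithConv Coalgebra in
theorem conv_mulRight {B : Type*} [Ring B] [Algebra k B] (f g : U →ₗ[k] B) (t : B) :
    toConv f * toConv (LinearMap.mulRight k t ∘ₗ g) =
      toConv (LinearMap.mulRight k t ∘ₗ (toConv f * toConv g).ofConv) := by
  ext x
  rw [(ℛ k x).convMul_apply]
  change _ = (toConv f * toConv g) x * t
  rw [(ℛ k x).convMul_apply]
  simp [Finset.sum_mul, mul_assoc]

open WithConv Coalgebra in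
theorem lTensor_adU_mem (y h : U) {N : Submodule k (U ⊗[k] U)}
    (hN₁ : ∀ x : U, ∀ t ∈ N, (x ⊗ₜ[k] (1 : U)) * t ∈ N)
    (hN₂ : ∀ x : U, ∀ t ∈ N, t * (x ⊗ₜ[k] (1 : U)) ∈ N)
    (hy : ∀ g : U, comul (adU (k := k) g y) ∈ N) :
    (adU (k := k) h).lTensor U (comul y) ∈ N := by
  have h₁ := antipode_mul_id_alg (k := k) (Algebra.TensorProduct.includeLeft : U →ₐ[k] U ⊗[k] U)
  have h₂ := id_mul_antipode_alg (k := k) (Algebra.TensorProduct.includeRight : U →ₐ[k] U ⊗[k] U)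
  have h₄ := incl_mul_incl (k := k) (U := U)
  set L := toConv (Algebra.TensorProduct.includeLeft : U →ₐ[k] U ⊗[k] U).toLinearMap with hL
  set R := toConv (Algebra.TensorProduct.includeRight : U →ₐ[k] U ⊗[k] U).toLinearMap with hR
  set SL := toConv ((Algebra.TensorProduct.includeLeft : U →ₐ[k] U ⊗[k] U).toLinearMap ∘ₗ
    HopfAlgebra.antipode k) with hSL
  set SR := toConv ((Algebra.TensorProduct.includeRight : U →ₐ[k] U ⊗[k] U).toLinearMap ∘ₗ
    HopfAlgebra.antipode k) with hSR
  let P : WithConv (U →ₗ[k] U ⊗[k] U) :=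
    toConv (LinearMap.mulRight k (comul y) ∘ₗ R.ofConv) * SR
  let q : WithConv (U →ₗ[k] U) := toConv (adU (k := k).flip y)
  let D : WithConv (U →ₗ[k] U ⊗[k] U) := toConv (comul ∘ₗ adU (k := k).flip y)
  have hq : q = toConv (LinearMap.mulRight k y) * toConv (HopfAlgebra.antipode k) := by
    ext x
    rw [(ℛ k x).convMul_apply]
    simp [q, adU_apply]
  have hq' : q * toConv LinearMap.id = toConv (LinearMap.mulRight k y) := by
    rw [hq, mul_assoc, LinearMap.antipode_mul_id, mul_one]
  have hD : D * toConv comul = toConv (LinearMap.mulRight k (comul y) ∘ₗ comul) := by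
    have h₅ := LinearMap.algHom_comp_convMul_distrib (Bialgebra.comulAlgHom k U) q
      (toConv LinearMap.id)
    rw [hq'] at h₅
    refine WithConv.ext ((?_ : _ = _).trans h₅.symm |>.trans ?_)
    · rfl
    · ext x; simp
  have hP : P = SL * D * L := by
    calc P = SL * (L * toConv (LinearMap.mulRight k (comul y) ∘ₗ R.ofConv)) * SR := by
          rw [← mul_assoc, h₁, one_mul]
      _ = SL * (D * (L * R)) * SR := by
          rw [h₄, hD, show L * toConv (LinearMap.mulRight k (comul y) ∘ₗ R.ofConv) =
            toConv (LinearMap.mulRight k (comul y) ∘ₗ (L * R).ofConv) from conv_mulRight _ _ _, h₄]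
      _ = SL * D * L := by
          rw [mul_assoc SL, mul_assoc D, mul_assoc L, h₂, mul_one, ← mul_assoc]
  have hPh : (adU (k := k) h).lTensor U (comul y) = P h := by
    have : ∀ t : U ⊗[k] U, (adU (k := k) h).lTensor U t =
        ∑ i ∈ (ℛ k h).index, (1 ⊗ₜ[k] (ℛ k h).left i) * t *
          (1 ⊗ₜ[k] HopfAlgebra.antipode k ((ℛ k h).right i)) := by
      intro t
      induction t with
      | zero => simp
      | add a b ha hb => simp [ha, hb, mul_add, add_mul, Finset.sum_add_distrib]
      | tmul a b => simp [adU_apply, TensorProduct.tmul_sum]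
    rw [this, (ℛ k h).convMul_apply]
    simp [hR, hSR]
  rw [hPh, hP, (ℛ k h).convMul_apply]
  refine Submodule.sum_mem _ fun i _ => hN₂ _ _ ?_
  rw [(ℛ k _).convMul_apply]
  exact Submodule.sum_mem _ fun j _ => hN₁ _ _ (hy _)

open Coalgebra in
/-- `Δ(U') ⊆ U ⊗ U'`. -/
theorem comul_mem_range_locFin (y : locFin k U) :
    comul (y : U) ∈ LinearMap.range ((locFin k U).subtype.lTensor U) := by
  classical
  have : FiniteDimensional k (LinearMap.range (adU (k := k).flip (y : U))) := y.2
  let b := Module.finBasis k (LinearMap.range (adU (k := k).flip (y : U)))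
  obtain ⟨E, hE, hbE⟩ := TensorProduct.exists_finite_submodule_right_of_setFinite
    (Set.range fun i => comul (R := k) (b i : U)) (Set.finite_range _)
  have hy : ∀ g : U, comul (adU (k := k) g (y : U)) ∈ LinearMap.range (E.subtype.lTensor U) := by
    intro g
    have h₁ : ((∑ i, b.repr ⟨_, g, rfl⟩ i • b i :
        LinearMap.range (adU (k := k).flip (y : U))) : U) = adU (k := k).flip (y : U) g :=
      congrArg Subtype.val (b.sum_repr ⟨_, g, rfl⟩)
    have h₂ : comul (R := k) (adU (k := k) g (y : U)) = comul _ := congrArg _ h₁.symm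
    rw [h₂]
    simp only [AddSubmonoidClass.coe_finsetSum, SetLike.val_smul, map_sum, map_smul]
    exact Submodule.sum_mem _ fun i _ => Submodule.smul_mem _ _ (hbE ⟨i, rfl⟩)
  have hmem : ∀ h : U, (adU (k := k) h).lTensor U (comul (y : U)) ∈
      LinearMap.range (E.subtype.lTensor U) := by
    intro h
    refine lTensor_adU_mem (y : U) h ?_ ?_ hy
    · rintro x _ ⟨t, rfl⟩
      refine ⟨(LinearMap.mulLeft k x).rTensor E t, ?_⟩
      induction t with
      | zero => simp
      | add a b ha hb => simp [ha, hb, mul_add]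
      | tmul a b => simp
    · rintro x _ ⟨t, rfl⟩
      refine ⟨(LinearMap.mulRight k x).rTensor E t, ?_⟩
      induction t with
      | zero => simp
      | add a b ha hb => simp [ha, hb, add_mul]
      | tmul a b => simp
  let c := Module.Basis.ofVectorSpace k U
  have hc : ∀ i, TensorProduct.equivFinsuppOfBasisLeft c (comul (R := k) (y : U)) i ∈
      locFin k U := by
    intro i
    have hn : ∀ (h : U) (t : U ⊗[k] U),
        TensorProduct.equivFinsuppOfBasisLeft c ((adU (k := k) h).lTensor U t) i =
          adU (k := k) h (TensorProduct.equivFinsuppOfBasisLeft c t i) := by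
      intro h t
      induction t with
      | zero => simp
      | add a b ha hb => simp [ha, hb]
      | tmul a b => simp
    refine Submodule.finiteDimensional_of_le (S₂ := E) ?_
    rintro _ ⟨h, rfl⟩
    rw [LinearMap.flip_apply, ← hn]
    obtain ⟨t, ht⟩ := hmem h
    rw [← ht]
    clear ht
    induction t with
    | zero => simp
    | add a b ha hb => simpa using E.add_mem ha hb
    | tmul a b => simpa using E.smul_mem _ b.2
  rw [← (TensorProduct.equivFinsuppOfBasisLeft c).symm_apply_apply (comul (R := k) (y : U)),
    TensorProduct.equivFinsuppOfBasisLeft_symm_apply]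
  exact Submodule.sum_mem _ fun i _ => ⟨c i ⊗ₜ ⟨_, hc i⟩, by simp⟩

variable (k U) in
/-- The coproduct of `U`, restricted to a map `U' → U ⊗ U'`. -/
def comulLocFin : locFin k U →ₗ[k] U ⊗[k] locFin k U :=
  (LinearEquiv.ofInjective ((locFin k U).subtype.lTensor U)
      lTensor_locFin_injective).symm.toLinearMap ∘ₗ
    (Coalgebra.comul ∘ₗ (locFin k U).subtype).codRestrict _ comul_mem_range_locFin

theorem lTensor_comulLocFin (y : locFin k U) :
    (locFin k U).subtype.lTensor U (comulLocFin k U y) = Coalgebra.comul (y : U) :=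
  congrArg Subtype.val ((LinearEquiv.ofInjective ((locFin k U).subtype.lTensor U)
    lTensor_locFin_injective).apply_symm_apply ⟨_, comul_mem_range_locFin y⟩)

end Adjoint

section VectorFields

variable {k : Type w} [Field k] {U : Type u} [Ring U] [HopfAlgebra k U]
variable (Q : QuasitriangularStructure k U)

variable (k U) in
/-- The inverse `S⁻¹` of the antipode, in the ring `End(U)`. -/
def antipodeInv : Module.End k U := Ring.inverse (HopfAlgebra.antipode k)

/-- The isomorphism `Ξ⁻¹` from the Heisenberg double `F ⋊ Uᵒ` (in which `x f = (x₂ ▷ f) x₁` with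
`(x ▷ f)(h) = f(S(x) h)`) to `D_U`. It is the identity on `U`, and sends `f ∈ F` to
`∑ (ad(s⁺) f) s⁻`, where `R⁻¹ = ∑ s⁺ ⊗ s⁻`. -/
def xiInv : restrictedDual k U ⊗[k] U →ₗ[k] DU Q :=
  TensorProduct.lift <| LinearMap.mk₂ k
    (fun f x => LinearMap.mul' k (DU Q) (TensorProduct.map
        (opA Q ∘ₗ actF.flip f ∘ₗ Coalgebra.comul) (dLeft Q) Q.Rinv) * dLeft Q x)
    (fun f f' x => by
      simp [LinearMap.add_comp, LinearMap.comp_add, TensorProduct.map_add_left, add_mul])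
    (fun c f x => by
      simp [LinearMap.smul_comp, LinearMap.comp_smul, TensorProduct.map_smul_left])
    (fun f x x' => by simp [mul_add])
    (fun c f x => by simp)

/-- The homomorphism `∂_▷ : U' → D_U`, through which `y` acts on `A` by `φ ↦ (h ↦ φ(h y))`. In
the Heisenberg double it is `y ↦ ∑ aᵢ ⊗ S⁻¹(yᵢ)`, where `∑ aᵢ ⊗ yᵢ` is the coadjoint image of `y`. -/
def dRight : locFin k U →ₗ[k] DU Q :=
  xiInv Q ∘ₗ (antipodeInv k U).lTensor (restrictedDual k U) ∘ₗ coad k U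

end VectorFields

/-! ## The operators and the invariants -/

section Operators

variable {k : Type w} [Field k] {U : Type u} [Ring U] [HopfAlgebra k U]
variable (Q : QuasitriangularStructure k U)
variable (n : ℕ)
variable (V : Type v) [AddCommGroup V] [Module k V] [Module U V] [IsScalarTower k U V]
variable (M : Type x) [AddCommGroup M] [Module k M] [Module (DU Q) M] [IsScalarTower k (DU Q) M]

variable (k) in
/-- The vector space `V^{⊗n} ⊗ M`, with factors `V_n ⊗ ⋯ ⊗ V_1 ⊗ M_0`. The factor `V_{i+1}` has
index `i : Fin n` in the tensor power. -/
abbrev TensorSpace : Type _ := (⨂[k] _ : Fin n, V) ⊗[k] M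

variable {n V M}

variable (M) in
/-- The operator `f` in the tensor factor `V` with index `i`. -/
def onV (i : Fin n) : Module.End k V →ₗ[k] Module.End k (TensorSpace k n V M) where
  toFun f := (PiTensorProduct.map (Function.update (fun _ => LinearMap.id) i f)).rTensor M
  map_add' f g := by
    rw [PiTensorProduct.map_update_add, LinearMap.rTensor_add]
  map_smul' c f := by
    rw [PiTensorProduct.map_update_smul, LinearMap.rTensor_smul, RingHom.id_apply]

variable (M) in
/-- The action of `U` in the tensor factor `V` with index `i`. -/
def piV (i : Fin n) : U →ₗ[k] Module.End k (TensorSpace k n V M) :=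
  onV M i ∘ₗ (Algebra.lsmul k k V).toLinearMap

variable (n V M) in
/-- The action of `D_U` in the tensor factor `M`. -/
def onM : DU Q →ₗ[k] Module.End k (TensorSpace k n V M) :=
  LinearMap.lTensorHom _ ∘ₗ (Algebra.lsmul k k M).toLinearMap

/-- `x ⊗ y ↦ f(x) g(y)`. -/
def pair {X Y E : Type*} [AddCommMonoid X] [Module k X] [AddCommMonoid Y] [Module k Y] [Ring E]
    [Algebra k E] (f : X →ₗ[k] E) (g : Y →ₗ[k] E) : X ⊗[k] Y →ₗ[k] E :=
  LinearMap.mul' k E ∘ₗ TensorProduct.map f g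

variable (M) in
/-- The flip of the tensor factors `V` with indices `i` and `j`. -/
def flipV (i j : Fin n) : Module.End k (TensorSpace k n V M) :=
  (PiTensorProduct.reindex k (fun _ : Fin n => V) (Equiv.swap i j)).toLinearMap.rTensor M

variable (V M) in
/-- The braiding `τ ∘ R` of the adjacent factors of index `i + 1` (on the left) and `i` of
`V_n ⊗ ⋯ ⊗ V_1 ⊗ M`. -/
def opT (i : Fin (n - 1)) : Module.End k (TensorSpace k n V M) :=
  flipV M (hi i) (lo i) * pair (piV M (hi i)) (piV M (lo i)) (Q.R : U ⊗[k] U)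

variable (V M) in
/-- The double braiding `Y_1 = σ_{M,V} ∘ σ_{V,M}`: the action of `R₂₁ R` on `V_1 ⊗ M`, where `U`
acts on `M` through `∂_◁`. -/
def opY1 (h : 0 < n) : Module.End k (TensorSpace k n V M) :=
  pair (piV M ⟨0, h⟩) (onM Q n V M ∘ₗ dLeft Q) (Q.R21 * (Q.R : U ⊗[k] U))

variable (k U V) in
/-- The canonical element `L = ∑ E_{ij} ⊗ c_{e^i,e_j}` of `End(V) ⊗ A`, describing the coaction
`v ↦ ∑ e_i ⊗ c_{e^i,v}` of `A` on `V`. -/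
def coactionL [FiniteDimensional k V] : Module.End k V ⊗[k] restrictedDual k U :=
  ∑ i, ∑ j, ((Module.finBasis k V).coord j).smulRight (Module.finBasis k V i) ⊗ₜ[k]
    (⟨matrixCoeff (Algebra.lsmul k k V).toLinearMap ((Module.finBasis k V).coord i)
      (Module.finBasis k V j), matrixCoeff_mem _ (fun x y => map_mul (Algebra.lsmul k k V) x y) _ _⟩ :
        restrictedDual k U)

variable (V M) in
/-- The operator `X_1 = L_{01}`: the coaction of `A` on `V_1`, followed by the action of `A` on
`M`, that is, `v ⊗ m ↦ ∑ e_i ⊗ c_{e^i,v} m`. -/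
def opX1 [FiniteDimensional k V] (h : 0 < n) : Module.End k (TensorSpace k n V M) :=
  pair (onV M ⟨0, h⟩) (onM Q n V M ∘ₗ opA Q) (coactionL k U V)

variable (n V M) in
/-- The action of `U` on `V^{⊗n} ⊗ M` through the coproduct, where `U` acts on `M` through
`∂_◁`: the convolution product `π_{V_n} * ⋯ * π_{V_1} * ∂_◁`. -/
def leftAct : U →ₗ[k] Module.End k (TensorSpace k n V M) :=
  ((List.ofFn fun i : Fin n => WithConv.toConv (piV (k := k) (U := U) (V := V) M i.rev)).prod *
    WithConv.toConv (onM Q n V M ∘ₗ dLeft Q)).ofConv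

variable (n V M) in
/-- The action of `U'` on `V^{⊗n} ⊗ M`, where `U'` acts on `M` by `ad(x) = ∂_◁(x₁) ∂_▷(x₂)`. -/
def adAct : locFin k U →ₗ[k] Module.End k (TensorSpace k n V M) :=
  (pair (E := Module.End k (TensorSpace k n V M)) (leftAct Q n V M) (onM Q n V M ∘ₗ dRight Q)).comp
    (comulLocFin k U)

variable (n V M) in
/-- The space `W = (V^{⊗n} ⊗ M)^{inv}` of invariants with respect to the adjoint action on `M`. -/
def invariants : Submodule k (TensorSpace k n V M) where
  carrier := {w | ∀ x : locFin k U, adAct Q n V M x w = Coalgebra.counit (R := k) (x : U) • w}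
  zero_mem' x := by rw [map_zero, smul_zero]
  add_mem' ha hb x := by rw [map_add, ha x, hb x, smul_add]
  smul_mem' c a ha x := by rw [map_smul, ha x, smul_comm]

end Operators

end

end QuantumD

open QuantumD

/-! All objects are read as operators on one space `H` (in the end `V^{⊗n} ⊗ M`) which carries
several commuting actions of `U`. Convolution `cv` is the tensor product of two actions, and `Rm` is
the R-matrix between them. The axioms for `Δ(R)` become `Rm_cv_left` and `Rm_cv_right`, and the
Yang-Baxter equation follows.

On a `D_U`-module the smash product gives a cross relation (`gam_actA`) and a twisted associativity
(`actA_actA`). Twisting the action of `A` by `R⁻¹` (`hatA`) passes to the Heisenberg double: the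
R-matrices disappear from the product (`hatA_hatA`) and from the cross relation (`gam_hatA`). There
it is elementary that `∂_◁` and `∂_▷` commute (`gam_rho`) and that `∂_▷` moves past `F` by right
translation (`rho_hatA`). Twisting back, the action map `A ⊗ M → M` is equivariant for the coadjoint
action on `A` and the adjoint action on `M` (`star_gam_rho_actA`).

The operator `X₁` is a coaction followed by the action of `A`. The coaction vector is invariant
under `π` convolved with left translation (`IsCoact.cv_aL`). From this come the commutation of `X₁`
with the adjoint action (`IsCoact.actA_star`), the reflection equation, which says that `X₁` and
`X₂` commute (`IsCoact.reflection`), and the relation of `X₁` with `Y₂` (`IsCoact.cross`). Up to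
R-matrices and `S(u)`, `X₁` is its analogue in the Heisenberg double (`IsCoact.actA_eq`), hence
invertible; the ribbon element makes `u` invertible and `S` bijective.

The other `X_i` and `Y_i` are Jucys-Murphy elements, so their relations follow from a few basic
ones; `Y_m` is the double braiding of one factor with all factors to its right (`jucysMurphy_dbl`).
Only the relation of `Y₁⋯Yₙ` with `X_i` needs invariant vectors. The formula for `Δ(ν)` shows that
`Y₁⋯Yₙ` times the diagonal action of `ν` is `ν ⊗ ⋯ ⊗ ν`. On invariants the diagonal action of `ν`
equals its action on `M` alone, so `Y₁⋯Yₙ` is `ν` on each factor `V` (`prodY_apply`), and this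
commutes with `X_i`. -/

namespace QuantumD

noncomputable section

/-! ### Calculus of commuting actions of `U`: convolution, R-matrices, Yang-Baxter. -/

section RepCalculus

variable {k : Type w} [Field k] {U : Type u} [Ring U] [HopfAlgebra k U]
variable {X Y : Type*} [Ring X] [Algebra k X] [Ring Y] [Algebra k Y]
variable {E : Type*} [Ring E] [Algebra k E]

/-- A linear map between algebras which is a homomorphism of algebras. -/
structure IsRep (f : X →ₗ[k] E) : Prop where
  map_one : f 1 = 1
  map_mul : ∀ x y, f (x * y) = f x * f y

/-- Linear maps to an algebra with commuting images. -/
def Comm {X Y : Type*} [AddCommMonoid X] [Module k X] [AddCommMonoid Y]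
    [Module k Y] (f : X →ₗ[k] E) (g : Y →ₗ[k] E) : Prop := ∀ x y, Commute (f x) (g y)

theorem Comm.symm {X Y : Type*} [AddCommMonoid X] [Module k X] [AddCommMonoid Y]
    [Module k Y] {f : X →ₗ[k] E} {g : Y →ₗ[k] E} (h : Comm f g) : Comm g f :=
  fun x y => (h y x).symm

@[simp] theorem pair_tmul {X Y : Type*} [AddCommMonoid X] [Module k X] [AddCommMonoid Y]
    [Module k Y] (f : X →ₗ[k] E) (g : Y →ₗ[k] E) (x : X) (y : Y) :
    pair f g (x ⊗ₜ y) = f x * g y := by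
  simp [pair]

theorem IsRep.pair_mul {f : X →ₗ[k] E} {g : Y →ₗ[k] E} (hf : IsRep f) (hg : IsRep g)
    (h : Comm f g) (s t : X ⊗[k] Y) : pair f g (s * t) = pair f g s * pair f g t := by
  induction s with
  | zero => simp
  | add a b ha hb => simp [add_mul, ha, hb]
  | tmul a b =>
    induction t with
    | zero => simp
    | add c d hc hd => simp [mul_add, hc, hd]
    | tmul c d =>
      simp only [Algebra.TensorProduct.tmul_mul_tmul, pair_tmul, hf.map_mul, hg.map_mul]
      rw [mul_assoc, mul_assoc, ← mul_assoc (f c), (h c b).eq, mul_assoc]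

theorem IsRep.pair {f : X →ₗ[k] E} {g : Y →ₗ[k] E} (hf : IsRep f) (hg : IsRep g)
    (h : Comm f g) : IsRep (pair f g) :=
  ⟨by simp [Algebra.TensorProduct.one_def, hf.map_one, hg.map_one], hf.pair_mul hg h⟩

theorem Comm.pair_left {X Y : Type*} [AddCommMonoid X] [Module k X] [AddCommMonoid Y]
    [Module k Y] {f : X →ₗ[k] E} {g : Y →ₗ[k] E} {e : E}
    (hf : ∀ x, Commute (f x) e) (hg : ∀ y, Commute (g y) e) (t : X ⊗[k] Y) :
    Commute (pair f g t) e := by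
  induction t with
  | zero => simp
  | add a b ha hb => simpa using ha.add_left hb
  | tmul a b => simpa using (hf a).mul_left (hg b)

theorem Comm.pair_swap {X Y : Type*} [AddCommMonoid X] [Module k X] [AddCommMonoid Y]
    [Module k Y] {f : X →ₗ[k] E} {g : Y →ₗ[k] E} (h : Comm f g) (t : X ⊗[k] Y) :
    pair f g t = pair g f (TensorProduct.comm k X Y t) := by
  induction t with
  | zero => simp
  | add a b ha hb => simp [ha, hb]
  | tmul a b => simpa using (h a b).eq

/-- A linear map that intertwines two pairs of actions intertwines `pair`. -/
theorem pair_apply_intertwine {X Y H₁ H₂ : Type*} [AddCommMonoid X] [Module k X] [AddCommMonoid Y]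
    [Module k Y] [AddCommGroup H₁] [Module k H₁] [AddCommGroup H₂] [Module k H₂]
    {f₁ : X →ₗ[k] Module.End k H₁} {g₁ : Y →ₗ[k] Module.End k H₁}
    {f₂ : X →ₗ[k] Module.End k H₂} {g₂ : Y →ₗ[k] Module.End k H₂} {m : H₁ →ₗ[k] H₂}
    (hf : ∀ x v, m (f₁ x v) = f₂ x (m v)) (hg : ∀ y v, m (g₁ y v) = g₂ y (m v))
    (t : X ⊗[k] Y) (v : H₁) : m (pair f₁ g₁ t v) = pair f₂ g₂ t (m v) := by
  induction t with
  | zero => simp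
  | add a b ha hb => simp [ha, hb]
  | tmul a b => simp [hf, hg]

/-- The convolution product `(f * g)(x) = f(x₁) g(x₂)`. -/
def cv (f g : U →ₗ[k] E) : U →ₗ[k] E := pair f g ∘ₗ Coalgebra.comul

theorem cv_eq (f g : U →ₗ[k] E) : cv f g = (WithConv.toConv f * WithConv.toConv g).ofConv := rfl

theorem cv_apply (f g : U →ₗ[k] E) (x : U) : cv f g x = pair f g (Coalgebra.comul x) := rfl

theorem cv_assoc (f g h : U →ₗ[k] E) : cv (cv f g) h = cv f (cv g h) := by
  simp only [cv_eq, WithConv.toConv_ofConv, mul_assoc]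

variable (k U E) in
/-- The trivial action of `U`. -/
def eps : U →ₗ[k] E := Algebra.linearMap k E ∘ₗ Coalgebra.counit

theorem eps_eq : eps k U E = (1 : WithConv (U →ₗ[k] E)).ofConv := rfl

@[simp] theorem eps_apply (x : U) : eps k U E x = algebraMap k E (Coalgebra.counit (R := k) x) := rfl

@[simp] theorem cv_eps (f : U →ₗ[k] E) : cv f (eps k U E) = f := by
  rw [cv_eq, eps_eq, WithConv.toConv_ofConv, mul_one]

@[simp] theorem eps_cv (f : U →ₗ[k] E) : cv (eps k U E) f = f := by
  rw [cv_eq, eps_eq, WithConv.toConv_ofConv, one_mul]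

theorem IsRep.cv {f g : U →ₗ[k] E} (hf : IsRep f) (hg : IsRep g) (h : Comm f g) :
    IsRep (cv f g) := by
  constructor
  · rw [cv_apply, Bialgebra.comul_one, (hf.pair hg h).map_one]
  · intro x y
    rw [cv_apply, Bialgebra.comul_mul, hf.pair_mul hg h, cv_apply, cv_apply]

theorem Comm.cv_left {Y : Type*} [AddCommMonoid Y] [Module k Y] {f g : U →ₗ[k] E} {h : Y →ₗ[k] E} (hf : Comm f h) (hg : Comm g h) :
    Comm (cv f g) h :=
  fun _ y => Comm.pair_left (fun x => hf x y) (fun x => hg x y) _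

theorem Comm.cv_right {Y : Type*} [AddCommMonoid Y] [Module k Y] {f g : U →ₗ[k] E} {h : Y →ₗ[k] E} (hf : Comm h f) (hg : Comm h g) :
    Comm h (cv f g) := (hf.symm.cv_left hg.symm).symm

theorem cv_antipode {f : U →ₗ[k] E} (hf : IsRep f) :
    cv f (f ∘ₗ HopfAlgebra.antipode k) = eps k U E := by
  have := id_mul_antipode_alg (AlgHom.ofLinearMap f hf.map_one hf.map_mul)
  exact congrArg WithConv.ofConv this

theorem antipode_cv {f : U →ₗ[k] E} (hf : IsRep f) :
    cv (f ∘ₗ HopfAlgebra.antipode k) f = eps k U E := by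
  have := antipode_mul_id_alg (AlgHom.ofLinearMap f hf.map_one hf.map_mul)
  exact congrArg WithConv.ofConv this

variable (Q : QuasitriangularStructure k U)

/-- The action of `R` by two actions of `U`. -/
def Rm (f g : U →ₗ[k] E) : E := pair f g (Q.R : U ⊗[k] U)

/-- The action of `R⁻¹` by two actions of `U`. -/
def Ri (f g : U →ₗ[k] E) : E := pair f g Q.Rinv

theorem Rm_mul_Ri {f g : U →ₗ[k] E} (hf : IsRep f) (hg : IsRep g) (h : Comm f g) :
    Rm Q f g * Ri Q f g = 1 := by
  rw [Rm, Ri, ← hf.pair_mul hg h, QuasitriangularStructure.Rinv, Units.mul_inv,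
    (hf.pair hg h).map_one]

theorem Ri_mul_Rm {f g : U →ₗ[k] E} (hf : IsRep f) (hg : IsRep g) (h : Comm f g) :
    Ri Q f g * Rm Q f g = 1 := by
  rw [Rm, Ri, ← hf.pair_mul hg h, QuasitriangularStructure.Rinv, Units.inv_mul,
    (hf.pair hg h).map_one]

theorem Rm_commute {f g : U →ₗ[k] E} {e : E} (hf : ∀ x, Commute (f x) e)
    (hg : ∀ x, Commute (g x) e) : Commute (Rm Q f g) e :=
  Comm.pair_left hf hg _

theorem Ri_commute {f g : U →ₗ[k] E} {e : E} (hf : ∀ x, Commute (f x) e)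
    (hg : ∀ x, Commute (g x) e) : Commute (Ri Q f g) e :=
  Comm.pair_left hf hg _

theorem Rm_mul_cv {f g : U →ₗ[k] E} (hf : IsRep f) (hg : IsRep g) (h : Comm f g) (x : U) :
    Rm Q f g * cv f g x = cv g f x * Rm Q f g := by
  rw [Rm, cv_apply, cv_apply, ← hf.pair_mul hg h, Q.R_mul_comul, hf.pair_mul hg h,
    h.symm.pair_swap (Coalgebra.comul x)]

theorem Ri_mul_cv {f g : U →ₗ[k] E} (hf : IsRep f) (hg : IsRep g) (h : Comm f g) (x : U) :
    Ri Q f g * cv g f x = cv f g x * Ri Q f g := by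
  calc _ = Ri Q f g * (cv g f x * Rm Q f g) * Ri Q f g := by
        rw [mul_assoc, mul_assoc, Rm_mul_Ri Q hf hg h, mul_one]
    _ = _ := by rw [← Rm_mul_cv Q hf hg h, ← mul_assoc, Ri_mul_Rm Q hf hg h, one_mul]

/-- The axiom `(Δ ⊗ id)R = R₁₃R₂₃` in operator form. Neither `f` nor `g` has to be multiplicative,
so that `g = f ∘ S` is allowed in `Rm_antipode_left`. -/
theorem Rm_cv_left {f g h : U →ₗ[k] E} (hh : IsRep h) (hgh : Comm g h) :
    Rm Q (cv f g) h = Rm Q f h * Rm Q g h := by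
  have h₁ : ∀ t : U ⊗[k] U, pair (cv f g) h t = pair f (pair g h) (TensorProduct.assoc k U U U
      (TensorProduct.map Coalgebra.comul LinearMap.id t)) := by
    intro t
    induction t with
    | zero => simp
    | add a b ha hb => simp only [map_add, ha, hb]
    | tmul a b =>
      rw [pair_tmul, TensorProduct.map_tmul, cv_apply]
      generalize (Coalgebra.comul a : U ⊗[k] U) = s
      induction s with
      | zero => simp
      | add a b ha hb => simp only [map_add, add_mul, ha, hb, TensorProduct.add_tmul]
      | tmul a b => simp [mul_assoc]
  have h₂ : ∀ s t : U ⊗[k] U, pair f (pair g h) (Algebra.TensorProduct.map (AlgHom.id k U)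
      Algebra.TensorProduct.includeRight s * (1 ⊗ₜ[k] t)) = pair f h s * pair g h t := by
    intro s t
    induction s with
    | zero => simp
    | add a b ha hb => simp only [map_add, add_mul, ha, hb]
    | tmul a b =>
      induction t with
      | zero => simp
      | add c d hc hd => simp only [map_add, mul_add, hc, hd, TensorProduct.tmul_add]
      | tmul c d =>
        simp [hh.map_mul, mul_assoc]
        rw [← mul_assoc (g c), (hgh c b).eq, mul_assoc]
  rw [Rm, h₁, Q.comul_left, h₂, Rm, Rm]

theorem Rm_cv_right {f g h : U →ₗ[k] E} (hf : IsRep f) (hfh : Comm f h) (hgh : Comm g h) :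
    Rm Q f (cv g h) = Rm Q f h * Rm Q f g := by
  have h₁ : ∀ t : U ⊗[k] U, pair f (cv g h) t = pair f (pair g h)
      (TensorProduct.map LinearMap.id Coalgebra.comul t) := by
    intro t
    induction t with
    | zero => simp
    | add a b ha hb => simp only [map_add, ha, hb]
    | tmul a b => simp [cv_apply]
  have h₂ : ∀ s t : U ⊗[k] U, pair f (pair g h) (Algebra.TensorProduct.map (AlgHom.id k U)
      Algebra.TensorProduct.includeRight s * Algebra.TensorProduct.map (AlgHom.id k U)
      Algebra.TensorProduct.includeLeft t) = pair f h s * pair f g t := by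
    intro s t
    induction s with
    | zero => simp
    | add a b ha hb => simp only [map_add, add_mul, ha, hb]
    | tmul a b =>
      induction t with
      | zero => simp
      | add c d hc hd => simp only [map_add, mul_add, hc, hd]
      | tmul c d =>
        simp [hf.map_mul, mul_assoc]
        rw [(hgh d b).eq, ← mul_assoc (f c), (hfh c b).eq, mul_assoc]
  rw [Rm, h₁, Q.comul_right, h₂, Rm, Rm]

/-- Inverses are unique, and the right-hand side inverts the factorisation of `Rm_cv_left`. -/
theorem Ri_cv_left {f g h : U →ₗ[k] E} (hf : IsRep f) (hg : IsRep g) (hh : IsRep h)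
    (hfg : Comm f g) (hfh : Comm f h) (hgh : Comm g h) :
    Ri Q (cv f g) h = Ri Q g h * Ri Q f h := by
  refine left_inv_eq_right_inv (a := Rm Q (cv f g) h)
    (Ri_mul_Rm Q (hf.cv hg hfg) hh (hfh.cv_left hgh)) ?_
  rw [Rm_cv_left Q hh hgh, mul_assoc, ← mul_assoc (Rm Q g h), Rm_mul_Ri Q hg hh hgh, one_mul,
    Rm_mul_Ri Q hf hh hfh]

theorem Ri_cv_right {f g h : U →ₗ[k] E} (hf : IsRep f) (hg : IsRep g) (hh : IsRep h)
    (hfg : Comm f g) (hfh : Comm f h) (hgh : Comm g h) :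
    Ri Q f (cv g h) = Ri Q f g * Ri Q f h := by
  refine left_inv_eq_right_inv (a := Rm Q f (cv g h))
    (Ri_mul_Rm Q hf (hg.cv hh hgh) (hfg.cv_right hfh)) ?_
  rw [Rm_cv_right Q hf hfh hgh, mul_assoc, ← mul_assoc (Rm Q f g), Rm_mul_Ri Q hf hg hfg, one_mul,
    Rm_mul_Ri Q hf hh hfh]

/-- The Yang-Baxter equation. -/
theorem Rm_yangBaxter {f g h : U →ₗ[k] E} (hf : IsRep f) (hg : IsRep g) (hh : IsRep h)
    (hfg : Comm f g) (hfh : Comm f h) (hgh : Comm g h) :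
    Rm Q f g * Rm Q f h * Rm Q g h = Rm Q g h * Rm Q f h * Rm Q f g := by
  -- The products of two R-matrices with `h` are those of `cv f g` and `cv g f`. What remains is
  -- that `Rm Q f g` exchanges these two convolutions.
  rw [mul_assoc, ← Rm_cv_left Q hh hgh, ← Rm_cv_left Q hh hfh]
  have : ∀ t : U ⊗[k] U, Rm Q f g * pair (cv f g) h t = pair (cv g f) h t * Rm Q f g := by
    intro t
    induction t with
    | zero => simp
    | add a b ha hb => simp [mul_add, add_mul, ha, hb]
    | tmul a b =>
      rw [pair_tmul, pair_tmul, ← mul_assoc, Rm_mul_cv Q hf hg hfg, mul_assoc, mul_assoc]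
      rw [(Rm_commute Q (fun x => hfh x b) (fun x => hgh x b)).eq]
  exact this _

variable (k U E) in
theorem isRep_eps : IsRep (eps k U E) :=
  ⟨by simp, fun x y => by simp⟩

theorem eps_comm {Y : Type*} [AddCommMonoid Y] [Module k Y] (g : Y →ₗ[k] E) : Comm (eps k U E) g :=
  fun _ _ => Algebra.commute_algebraMap_left _ _

/-- Since `ε * ε = ε`, this operator is idempotent by `Rm_cv_left`; being invertible, it is `1`. -/
theorem Rm_eps_left {g : U →ₗ[k] E} (hg : IsRep g) : Rm Q (eps k U E) g = 1 := by
  have h := Rm_cv_left Q (f := eps k U E) hg (eps_comm g)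
  rw [eps_cv] at h
  have h₂ := congrArg (Ri Q (eps k U E) g * ·) h
  simpa only [← mul_assoc, Ri_mul_Rm Q (isRep_eps k U E) hg (eps_comm g), one_mul] using h₂.symm

theorem Ri_eps_left {g : U →ₗ[k] E} (hg : IsRep g) : Ri Q (eps k U E) g = 1 := by
  simpa [Rm_eps_left Q hg] using Ri_mul_Rm Q (isRep_eps k U E) hg (eps_comm g)

theorem Rm_eps_right {f : U →ₗ[k] E} (hf : IsRep f) : Rm Q f (eps k U E) = 1 := by
  have h := Rm_cv_right Q (g := eps k U E) (h := eps k U E) hf (eps_comm f).symm (eps_comm _)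
  rw [eps_cv] at h
  have h₂ := congrArg (Ri Q f (eps k U E) * ·) h
  simpa only [← mul_assoc, Ri_mul_Rm Q hf (isRep_eps k U E) (eps_comm f).symm, one_mul]
    using h₂.symm

theorem Ri_eps_right {f : U →ₗ[k] E} (hf : IsRep f) : Ri Q f (eps k U E) = 1 := by
  simpa [Rm_eps_right Q hf] using Ri_mul_Rm Q hf (isRep_eps k U E) (eps_comm f).symm

/-- The convolution of `f` with `f ∘ S` is trivial, so `Rm_cv_left` exhibits the left-hand side as a
right inverse of `Rm Q f g`. -/
theorem Rm_antipode_left {f g : U →ₗ[k] E} (hf : IsRep f) (hg : IsRep g) (h : Comm f g) :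
    Rm Q (f ∘ₗ HopfAlgebra.antipode k) g = Ri Q f g := by
  have h₁ := Rm_cv_left Q (f := f) (g := f ∘ₗ HopfAlgebra.antipode k) hg (fun x y => h _ y)
  rw [cv_antipode hf, Rm_eps_left Q hg] at h₁
  exact (left_inv_eq_right_inv (Ri_mul_Rm Q hf hg h) h₁.symm).symm

theorem pair_comp_map {X Y X' Y' : Type*} [AddCommMonoid X] [Module k X] [AddCommMonoid Y]
    [Module k Y] [AddCommMonoid X'] [Module k X'] [AddCommMonoid Y'] [Module k Y']
    (f : X →ₗ[k] E) (g : Y →ₗ[k] E) (p : X' →ₗ[k] X) (q : Y' →ₗ[k] Y) (t : X' ⊗[k] Y') :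
    pair (f ∘ₗ p) (g ∘ₗ q) t = pair f g (TensorProduct.map p q t) := by
  simp [pair, TensorProduct.map_comp]

theorem pair_include (t : U ⊗[k] U) : pair
    (Algebra.TensorProduct.includeLeft : U →ₐ[k] U ⊗[k] U).toLinearMap
    (Algebra.TensorProduct.includeRight : U →ₐ[k] U ⊗[k] U).toLinearMap t = t := by
  induction t with
  | zero => simp
  | add a b ha hb => rw [map_add, ha, hb]
  | tmul a b => simp

theorem AlgHom.isRep (f : X →ₐ[k] E) : IsRep f.toLinearMap := ⟨map_one f, map_mul f⟩

theorem include_comm : Comm (Algebra.TensorProduct.includeLeft : U →ₐ[k] U ⊗[k] U).toLinearMap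
    (Algebra.TensorProduct.includeRight : U →ₐ[k] U ⊗[k] U).toLinearMap := by
  intro x y
  simp [Commute, SemiconjBy]

/-- The universal case of `Rm_antipode_left`: for the two inclusions into `U ⊗ U`, `pair` is the
identity. -/
theorem map_antipode_R :
    TensorProduct.map (HopfAlgebra.antipode k) LinearMap.id (Q.R : U ⊗[k] U) = Q.Rinv := by
  have h := Rm_antipode_left Q (AlgHom.isRep Algebra.TensorProduct.includeLeft)
    (AlgHom.isRep Algebra.TensorProduct.includeRight)
    include_comm
  rw [Ri, pair_include] at h
  have h₂ := pair_comp_map (Algebra.TensorProduct.includeLeft : U →ₐ[k] U ⊗[k] U).toLinearMap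
    (Algebra.TensorProduct.includeRight : U →ₐ[k] U ⊗[k] U).toLinearMap
    (HopfAlgebra.antipode k) LinearMap.id (Q.R : U ⊗[k] U)
  rw [pair_include] at h₂
  exact h₂.symm.trans h

theorem map_comul_Rinv : TensorProduct.map LinearMap.id Coalgebra.comul Q.Rinv =
    Algebra.TensorProduct.map (AlgHom.id k U) Algebra.TensorProduct.includeLeft Q.Rinv *
      Algebra.TensorProduct.map (AlgHom.id k U) Algebra.TensorProduct.includeRight Q.Rinv := by
  let Φ := Algebra.TensorProduct.map (AlgHom.id k U) (Bialgebra.comulAlgHom k U)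
  let A := Algebra.TensorProduct.map (AlgHom.id k U)
    (Algebra.TensorProduct.includeLeft : U →ₐ[k] U ⊗[k] U)
  let B := Algebra.TensorProduct.map (AlgHom.id k U)
    (Algebra.TensorProduct.includeRight : U →ₐ[k] U ⊗[k] U)
  change Φ Q.Rinv = A Q.Rinv * B Q.Rinv
  have h : Φ Q.R = B Q.R * A Q.R := Q.comul_right
  have hR : (Q.R : U ⊗[k] U) * Q.Rinv = 1 := Units.mul_inv _
  have hR' : Q.Rinv * (Q.R : U ⊗[k] U) = 1 := Units.inv_mul _
  refine left_inv_eq_right_inv (a := Φ Q.R) (by rw [← map_mul, hR', map_one]) ?_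
  rw [h, mul_assoc, ← mul_assoc (A Q.R), ← map_mul A, hR, map_one, one_mul, ← map_mul, hR, map_one]

/-- `Ri_cv_right` does not apply to `g ∘ S`, which reverses products. The argument therefore goes
back to `(id ⊗ Δ)R⁻¹ = R₁₂⁻¹R₁₃⁻¹`, where nothing is asked of the last leg. -/
theorem map_antipode_Rinv :
    TensorProduct.map LinearMap.id (HopfAlgebra.antipode k) Q.Rinv = (Q.R : U ⊗[k] U) := by
  let f := (Algebra.TensorProduct.includeLeft : U →ₐ[k] U ⊗[k] U).toLinearMap
  let g := (Algebra.TensorProduct.includeRight : U →ₐ[k] U ⊗[k] U).toLinearMap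
  have hf : IsRep f := AlgHom.isRep _
  have hg : IsRep g := AlgHom.isRep _
  have hfg : Comm f g := include_comm
  have h₁ : ∀ (g' : U →ₗ[k] U ⊗[k] U) (t : U ⊗[k] U), pair f (cv g g') t = pair f (pair g g')
      (TensorProduct.map LinearMap.id Coalgebra.comul t) := by
    intro g' t
    induction t with
    | zero => simp
    | add a b ha hb => simp only [map_add, ha, hb]
    | tmul a b => simp [cv_apply]
  have h₂ : ∀ (g' : U →ₗ[k] U ⊗[k] U) (s t : U ⊗[k] U), pair f (pair g g')
      (Algebra.TensorProduct.map (AlgHom.id k U) Algebra.TensorProduct.includeLeft s *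
      Algebra.TensorProduct.map (AlgHom.id k U) Algebra.TensorProduct.includeRight t) =
      pair f g s * pair f g' t := by
    intro g' s t
    induction s with
    | zero => simp
    | add a b ha hb => simp only [map_add, add_mul, ha, hb]
    | tmul a b =>
      induction t with
      | zero => simp
      | add c d hc hd => simp only [map_add, mul_add, hc, hd]
      | tmul c d =>
        simp only [Algebra.TensorProduct.map_tmul, Algebra.TensorProduct.includeLeft_apply,
          Algebra.TensorProduct.includeRight_apply, Algebra.TensorProduct.tmul_mul_tmul,
          pair_tmul, mul_one, one_mul, AlgHom.id_apply, hf.map_mul, mul_assoc]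
        rw [← mul_assoc (g b), ← (hfg c b).eq, mul_assoc]
  have h₃ : Ri Q f (cv g (g ∘ₗ HopfAlgebra.antipode k)) =
      Ri Q f g * Ri Q f (g ∘ₗ HopfAlgebra.antipode k) := by
    rw [Ri, h₁, map_comul_Rinv, h₂, Ri, Ri]
  rw [cv_antipode hg, Ri_eps_right Q hf] at h₃
  have h₅ : Rm Q f g = Ri Q f (g ∘ₗ HopfAlgebra.antipode k) :=
    left_inv_eq_right_inv (Rm_mul_Ri Q hf hg hfg) h₃.symm
  have h₆ := pair_comp_map f g LinearMap.id (HopfAlgebra.antipode k) Q.Rinv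
  rw [pair_include] at h₆
  rw [Rm, pair_include] at h₅
  exact h₆.symm.trans h₅.symm

/-! ### The Drinfeld element, the ribbon element and bijectivity of the antipode. -/

/-- The element `S(u) = ∑ r⁺ S(r⁻)`. -/
def drinfeldS : U :=
  LinearMap.mul' k U (TensorProduct.map LinearMap.id (HopfAlgebra.antipode k) (Q.R : U ⊗[k] U))

/-- `S(u) = ∑ S(r⁺) S²(r⁻)`, and `S ⊗ S` fixes `R` because `(S ⊗ id)R = R⁻¹` and `(id ⊗ S)R⁻¹ = R`.
-/
theorem antipode_drinfeld : HopfAlgebra.antipode k Q.drinfeld = drinfeldS Q := by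
  have h : ∀ t : U ⊗[k] U, HopfAlgebra.antipode k (LinearMap.mul' k U (TensorProduct.map
      (HopfAlgebra.antipode k) LinearMap.id (TensorProduct.comm k U U t))) =
      LinearMap.mul' k U (TensorProduct.map LinearMap.id (HopfAlgebra.antipode k)
        (TensorProduct.map LinearMap.id (HopfAlgebra.antipode k)
          (TensorProduct.map (HopfAlgebra.antipode k) LinearMap.id t))) := by
    intro t
    induction t with
    | zero => simp
    | add a b ha hb => simp only [map_add, ha, hb]
    | tmul a b => simp [HopfAlgebra.antipode_mul_antidistrib]
  rw [QuasitriangularStructure.drinfeld, QuasitriangularStructure.R21, h, map_antipode_R,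
    map_antipode_Rinv, drinfeldS]

-- Obtained by applying `a ⊗ b ↦ S(b) a` to both sides of `R Δ(x) = Δᵒᵖ(x) R`; on the right the
-- antipode axiom collapses the legs of `x`.
open Coalgebra in
theorem sum_antipode_drinfeld (x : U) : ∑ i ∈ (ℛ k x).index,
    HopfAlgebra.antipode k ((ℛ k x).right i) * Q.drinfeld * (ℛ k x).left i =
      counit (R := k) x • Q.drinfeld := by
  have h := Q.R_mul_comul x
  let T : U ⊗[k] U →ₗ[k] U := LinearMap.mul' k U ∘ₗ
    TensorProduct.map (HopfAlgebra.antipode k) LinearMap.id ∘ₗ (TensorProduct.comm k U U).toLinearMap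
  have hT : T (Q.R : U ⊗[k] U) = Q.drinfeld := rfl
  have h₁ : ∀ t : U ⊗[k] U, T (t * comul x) = ∑ i ∈ (ℛ k x).index,
      HopfAlgebra.antipode k ((ℛ k x).right i) * T t * (ℛ k x).left i := by
    intro t
    induction t with
    | zero => simp
    | add a b ha hb => simp [add_mul, mul_add, ha, hb, Finset.sum_add_distrib]
    | tmul a b =>
      conv_lhs => rw [← (ℛ k x).eq]
      simp [T, Finset.mul_sum, HopfAlgebra.antipode_mul_antidistrib, mul_assoc]
  have h₂ : ∀ t : U ⊗[k] U, T (TensorProduct.comm k U U (comul x) * t) =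
      counit (R := k) x • T t := by
    intro t
    induction t with
    | zero => simp
    | add a b ha hb => simp [mul_add, ha, hb]
    | tmul a b =>
      have h₃ := HopfAlgebra.sum_antipode_mul_eq_algebraMap_counit (ℛ k x)
      conv_lhs => rw [← (ℛ k x).eq]
      simp only [T, map_sum, TensorProduct.comm_tmul, Finset.sum_mul,
        Algebra.TensorProduct.tmul_mul_tmul, LinearMap.comp_apply, LinearEquiv.coe_coe,
        TensorProduct.map_tmul, LinearMap.mul'_apply, HopfAlgebra.antipode_mul_antidistrib,
        LinearMap.id_apply]
      calc _ = HopfAlgebra.antipode k b * (∑ i ∈ (ℛ k x).index,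
            HopfAlgebra.antipode k ((ℛ k x).left i) * (ℛ k x).right i) * a := by
            simp [Finset.mul_sum, Finset.sum_mul, mul_assoc]
        _ = _ := by rw [h₃, ← Algebra.commutes, mul_assoc, ← Algebra.smul_def]
  rw [← hT, ← h₁, ← h₂, h]

/-- `S²(x) u = u x`. -/
theorem antipode_antipode_mul_drinfeld (x : U) :
    HopfAlgebra.antipode k (HopfAlgebra.antipode k x) * Q.drinfeld = Q.drinfeld * x := by
  -- In the opposite algebra `∑ S(x₂) u x₁` is a convolution product, of `x ↦ u x` with `S`. The
  -- inverse of `S` there is `S²`, and associativity moves it to the other side.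
  let op : U →ₗ[k] Uᵐᵒᵖ := (MulOpposite.opLinearEquiv k).toLinearMap
  let S := HopfAlgebra.antipode k (A := U)
  let f : U →ₗ[k] Uᵐᵒᵖ := op ∘ₗ LinearMap.mulLeft k Q.drinfeld
  have h := cv_assoc f (op ∘ₗ S) (op ∘ₗ S ∘ₗ S)
  have h₁ : cv f (op ∘ₗ S) = LinearMap.mulLeft k (op Q.drinfeld) ∘ₗ eps k U Uᵐᵒᵖ := by
    ext x
    have := congrArg op (sum_antipode_drinfeld Q x)
    rw [cv_apply, ← (Coalgebra.Repr.arbitrary k x).eq]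
    simpa [f, op, S, mul_assoc, Algebra.smul_def] using this
  have h₂ : cv (op ∘ₗ S) (op ∘ₗ S ∘ₗ S) = eps k U Uᵐᵒᵖ := by
    ext x
    have := congrArg (fun y => op (S y)) (HopfAlgebra.sum_mul_antipode_eq_algebraMap_counit
      (Coalgebra.Repr.arbitrary k x))
    rw [cv_apply, ← (Coalgebra.Repr.arbitrary k x).eq]
    simpa [op, S, HopfAlgebra.antipode_mul_antidistrib, Algebra.algebraMap_eq_smul_one] using this
  have h₃ : ∀ g : U →ₗ[k] Uᵐᵒᵖ, cv (LinearMap.mulLeft k (op Q.drinfeld) ∘ₗ eps k U Uᵐᵒᵖ) g =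
      LinearMap.mulLeft k (op Q.drinfeld) ∘ₗ g := by
    intro g
    ext x
    conv_rhs => rw [← eps_cv g]
    simp only [cv_apply, LinearMap.comp_apply]
    generalize (Coalgebra.comul x : U ⊗[k] U) = t
    induction t with
    | zero => simp
    | add a b ha hb => simp only [map_add, ha, hb]
    | tmul a b => simp [mul_assoc]
  rw [h₂, cv_eps, h₁, h₃] at h
  exact MulOpposite.op_injective (congrArg (fun f => f x) h)

/-- `∑ r⁻ u r⁺ = 1`. -/
theorem sum_drinfeld_eq_one : LinearMap.mul' k U (TensorProduct.map
    (LinearMap.mulRight k Q.drinfeld) LinearMap.id Q.R21) = 1 := by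
  let T : U ⊗[k] U →ₗ[k] U := LinearMap.mul' k U ∘ₗ
    TensorProduct.map (HopfAlgebra.antipode k) LinearMap.id ∘ₗ (TensorProduct.comm k U U).toLinearMap
  have hT : T (Q.R : U ⊗[k] U) = Q.drinfeld := rfl
  have h : ∀ s t : U ⊗[k] U, LinearMap.mul' k U (TensorProduct.map (LinearMap.mulRight k (T s))
      LinearMap.id (TensorProduct.comm k U U
        (TensorProduct.map LinearMap.id (HopfAlgebra.antipode k) t))) = T (s * t) := by
    intro s t
    induction t with
    | zero => simp
    | add a b ha hb => simp only [map_add, mul_add, ha, hb]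
    | tmul a b =>
      induction s with
      | zero => simp
      | add c d hc hd =>
        simp only [map_add, add_mul, ← hc, ← hd]
        simp [mul_add, add_mul]
      | tmul c d => simp [T, HopfAlgebra.antipode_mul_antidistrib, mul_assoc]
  -- With `T(a ⊗ b) = S(b) a`, the case `s = R`, `t = R⁻¹` has `T(st) = T(1) = 1`, while `(id ⊗
  -- S)R⁻¹ = R` turns the other side into `∑ r⁻ u r⁺`.
  have h₂ := h Q.R Q.Rinv
  rw [map_antipode_Rinv, hT] at h₂
  refine h₂.trans ?_
  rw [QuasitriangularStructure.Rinv, Units.mul_inv]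
  simp [T, Algebra.TensorProduct.one_def]

/-- The left inverse is `∑ r⁻ S²(r⁺)`: the relation `S²(x) u = u x` turns its product with `u` into
`∑ r⁻ u r⁺ = 1`. -/
theorem exists_mul_drinfeld_eq_one : ∃ v : U, v * Q.drinfeld = 1 := by
  refine ⟨LinearMap.mul' k U (TensorProduct.map LinearMap.id
    (HopfAlgebra.antipode k ∘ₗ HopfAlgebra.antipode k) Q.R21), ?_⟩
  rw [← sum_drinfeld_eq_one Q]
  have : ∀ t : U ⊗[k] U, LinearMap.mul' k U (TensorProduct.map LinearMap.id
      (HopfAlgebra.antipode k ∘ₗ HopfAlgebra.antipode k) t) * Q.drinfeld =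
      LinearMap.mul' k U (TensorProduct.map (LinearMap.mulRight k Q.drinfeld) LinearMap.id t) := by
    intro t
    induction t with
    | zero => simp
    | add a b ha hb => simp only [map_add, add_mul, ha, hb]
    | tmul a b => simp [mul_assoc, antipode_antipode_mul_drinfeld]
  exact this _

variable (𝓡 : RibbonStructure k U)

/-- The map `a ⊗ b ↦ a S(b)` sends `Δ(ν)` to `ε(ν) = 1`. By the formula for `Δ(ν)` and `S(ν) = ν` it
also gives a multiple of `ν²`, so the central element `ν` has an inverse. -/
theorem isUnit_ν : IsUnit 𝓡.ν := by
  let T : U ⊗[k] U →ₗ[k] U := LinearMap.mul' k U ∘ₗ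
    TensorProduct.map LinearMap.id (HopfAlgebra.antipode k)
  have hT : ∀ t : U ⊗[k] U, T (t * (𝓡.ν ⊗ₜ 𝓡.ν)) = 𝓡.ν * 𝓡.ν * T t := by
    intro t
    induction t with
    | zero => simp
    | add a b ha hb => simp only [map_add, add_mul, mul_add, ha, hb]
    | tmul a b =>
      simp only [T, Algebra.TensorProduct.tmul_mul_tmul, LinearMap.comp_apply,
        TensorProduct.map_tmul, LinearMap.mul'_apply, HopfAlgebra.antipode_mul_antidistrib,
        𝓡.antipode_ν, LinearMap.id_apply]
      have h : a * (𝓡.ν * 𝓡.ν) = 𝓡.ν * 𝓡.ν * a := by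
        rw [← mul_assoc, ← 𝓡.ν_central, mul_assoc, ← 𝓡.ν_central, ← mul_assoc]
      rw [← mul_assoc, mul_assoc a, h, mul_assoc]
  let A := Algebra.TensorProduct.comm k U U
  have hRR : (𝓡.toQuasitriangularStructure.Rinv * A 𝓡.toQuasitriangularStructure.Rinv) *
      (A 𝓡.R * (𝓡.R : U ⊗[k] U)) = 1 := by
    rw [mul_assoc, ← mul_assoc (A _), ← map_mul, QuasitriangularStructure.Rinv, Units.inv_mul,
      map_one, one_mul, Units.inv_mul]
  have h : (A 𝓡.R * (𝓡.R : U ⊗[k] U)) * Coalgebra.comul 𝓡.ν = 𝓡.ν ⊗ₜ[k] 𝓡.ν := 𝓡.comul_ν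
  have h₂ : T (Coalgebra.comul 𝓡.ν) = 1 := by
    have := HopfAlgebra.mul_antipode_lTensor_comul_apply (R := k) 𝓡.ν
    rwa [𝓡.counit_ν, map_one] at this
  rw [← one_mul (Coalgebra.comul 𝓡.ν), ← hRR, mul_assoc, h, hT, mul_assoc] at h₂
  exact ⟨⟨𝓡.ν, _, h₂, by rw [← 𝓡.ν_central, h₂]⟩, rfl⟩

/-- A left inverse is known; `u S(u) = ν²` with `ν` invertible supplies a right inverse. -/
theorem isUnit_drinfeld : IsUnit 𝓡.drinfeld := by
  obtain ⟨v, hv⟩ := exists_mul_drinfeld_eq_one 𝓡.toQuasitriangularStructure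
  obtain ⟨n, hn⟩ := (isUnit_ν 𝓡).mul (isUnit_ν 𝓡)
  have h : 𝓡.drinfeld * (HopfAlgebra.antipode k 𝓡.drinfeld * ↑n⁻¹) = 1 := by
    rw [← mul_assoc, ← 𝓡.ν_sq, ← hn, Units.mul_inv]
  exact ⟨⟨_, _, h, by rw [← left_inv_eq_right_inv hv h, hv]⟩, rfl⟩

theorem isUnit_drinfeldS : IsUnit (drinfeldS 𝓡.toQuasitriangularStructure) := by
  obtain ⟨n, hn⟩ := isUnit_drinfeld 𝓡
  rw [← antipode_drinfeld, ← hn]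
  refine ⟨⟨_, HopfAlgebra.antipode k (↑n⁻¹ : U), ?_, ?_⟩, rfl⟩ <;>
    simp [← HopfAlgebra.antipode_mul_antidistrib]

/-- `S²` is conjugation by the unit `u`, hence bijective, and so is `S`. -/
theorem antipode_bijective (𝓡 : RibbonStructure k U) :
    Function.Bijective (HopfAlgebra.antipode k (A := U)) := by
  obtain ⟨n, hn⟩ := isUnit_drinfeld 𝓡
  have h := antipode_antipode_mul_drinfeld 𝓡.toQuasitriangularStructure
  rw [← hn] at h
  constructor
  · rw [injective_iff_map_eq_zero]
    intro x hx
    have := h x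
    rw [hx, map_zero, zero_mul] at this
    exact n.isUnit.mul_right_eq_zero.1 this.symm
  · intro y
    refine ⟨HopfAlgebra.antipode k (↑n⁻¹ * y * n), ?_⟩
    rw [← n.isUnit.mul_left_inj, h]
    simp [← mul_assoc]

end RepCalculus

/-! ### The space `F ⊗ H`, its translations, and the product of two factors `F`. -/

section CoeffSpace

variable {k : Type w} [Field k] {U : Type u} [Ring U] [HopfAlgebra k U]
variable {X : Type*} [Ring X] [Algebra k X]
variable (H : Type*) [AddCommGroup H] [Module k H]

variable (k U) in
/-- The space `F ⊗ H`. -/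
abbrev FT : Type _ := restrictedDual k U ⊗[k] H

instance : AddCommGroup (FT k U H) := Module.addCommMonoidToAddCommGroup k

variable (k U) in
/-- The action of `U ⊗ U` on the factor `F` of `F ⊗ H`. -/
def actL : U ⊗[k] U →ₗ[k] Module.End k (FT k U H) := LinearMap.rTensorHom H ∘ₗ actF

variable (k U) in
/-- The action of `U ⊗ 1` on the factor `F` of `F ⊗ H`. -/
def aL : U →ₗ[k] Module.End k (FT k U H) := actL k U H ∘ₗ (TensorProduct.mk k U U).flip 1

variable (k U) in
/-- The action of `1 ⊗ U` on the factor `F` of `F ⊗ H`. -/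
def aR : U →ₗ[k] Module.End k (FT k U H) := actL k U H ∘ₗ TensorProduct.mk k U U 1

variable {H}

variable (k U) in
/-- Operators on the factor `H` of `F ⊗ H`. -/
def lT {X : Type*} [AddCommMonoid X] [Module k X] (g : X →ₗ[k] Module.End k H) :
    X →ₗ[k] Module.End k (FT k U H) :=
  LinearMap.lTensorHom _ ∘ₗ g

@[simp] theorem actL_tmul (t : U ⊗[k] U) (f : restrictedDual k U) (h : H) :
    actL k U H t (f ⊗ₜ h) = actF t f ⊗ₜ h := rfl

theorem aL_apply (x : U) : aL k U H x = actL k U H (x ⊗ₜ 1) := rfl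

theorem aR_apply (x : U) : aR k U H x = actL k U H (1 ⊗ₜ x) := rfl

theorem lT_apply {X : Type*} [AddCommMonoid X] [Module k X] (g : X →ₗ[k] Module.End k H) (x : X) :
    lT k U g x = (g x).lTensor _ := rfl

@[simp] theorem lT_tmul {X : Type*} [AddCommMonoid X] [Module k X] (g : X →ₗ[k] Module.End k H)
    (x : X) (f : restrictedDual k U) (h : H) : lT k U g x (f ⊗ₜ h) = f ⊗ₜ g x h := rfl

theorem dualAct_mul (s t : U ⊗[k] U) : dualAct (k := k) (s * t) = dualAct s * dualAct t := by
  induction s using TensorProduct.induction_on with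
  | zero => simp
  | add a b ha hb => simp only [map_add, add_mul, ha, hb]
  | tmul a b =>
    induction t using TensorProduct.induction_on with
    | zero => simp
    | add c d hc hd => simp only [map_add, mul_add, hc, hd]
    | tmul c d =>
      ext φ h
      simp [HopfAlgebra.antipode_mul_antidistrib, mul_assoc]

theorem isRep_actL : IsRep (actL k U H) := by
  have h₁ : actF (k := k) (U := U) 1 = 1 := by
    ext f h
    simp [Algebra.TensorProduct.one_def]
  have h₂ : ∀ s t : U ⊗[k] U, actF (k := k) (s * t) = actF s * actF t := by
    intro s t
    ext f h
    simp [dualAct_mul]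
  constructor
  · simp [actL, h₁, Module.End.one_eq_id]
  · intro s t
    simp [actL, h₂, Module.End.mul_eq_comp, LinearMap.rTensor_comp]

theorem IsRep.lT {g : X →ₗ[k] Module.End k H} (hg : IsRep g) : IsRep (lT k U g) := by
  constructor
  · simp [lT_apply, hg.map_one, Module.End.one_eq_id]
  · intro s t
    simp [lT_apply, hg.map_mul, Module.End.mul_eq_comp, LinearMap.lTensor_comp]

theorem isRep_aL : IsRep (aL k U H) := by
  constructor
  · exact isRep_actL.map_one
  · intro x y
    rw [aL_apply, aL_apply, aL_apply, ← isRep_actL.map_mul]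
    simp

theorem isRep_aR : IsRep (aR k U H) := by
  constructor
  · exact isRep_actL.map_one
  · intro x y
    rw [aR_apply, aR_apply, aR_apply, ← isRep_actL.map_mul]
    simp

theorem comm_aL_aR : Comm (aL k U H) (aR k U H) := by
  intro x y
  rw [aR_apply, aL_apply, Commute, SemiconjBy, ← isRep_actL.map_mul, ← isRep_actL.map_mul]
  simp

theorem comm_actL_lT {X : Type*} [AddCommMonoid X] [Module k X] 
    (g : X →ₗ[k] Module.End k H) : Comm (actL k U H) (lT k U g) := by
  intro t y
  change (actF t).rTensor H ∘ₗ (g y).lTensor _ = (g y).lTensor _ ∘ₗ (actF t).rTensor H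
  rw [LinearMap.rTensor_comp_lTensor, LinearMap.lTensor_comp_rTensor]

theorem comm_aL_lT {X : Type*} [AddCommMonoid X] [Module k X] 
    (g : X →ₗ[k] Module.End k H) : Comm (aL k U H) (lT k U g) :=
  fun _ y => comm_actL_lT g _ y

theorem comm_aR_lT {X : Type*} [AddCommMonoid X] [Module k X] 
    (g : X →ₗ[k] Module.End k H) : Comm (aR k U H) (lT k U g) :=
  fun _ y => comm_actL_lT g _ y

theorem Comm.lT {X Y : Type*} [AddCommMonoid X] [Module k X] [AddCommMonoid Y]
    [Module k Y] {f : X →ₗ[k] Module.End k H}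
    {g : Y →ₗ[k] Module.End k H} (h : Comm f g) : Comm (lT k U f) (lT k U g) := by
  intro x y
  change (f x).lTensor _ ∘ₗ (g y).lTensor _ = (g y).lTensor _ ∘ₗ (f x).lTensor _
  rw [← LinearMap.lTensor_comp, ← LinearMap.lTensor_comp]
  exact congrArg _ (h x y)

theorem lT_pair {X Y : Type*} [AddCommMonoid X] [Module k X] [AddCommMonoid Y] [Module k Y]
    (f : X →ₗ[k] Module.End k H) (g : Y →ₗ[k] Module.End k H) (t : X ⊗[k] Y) :
    pair (lT k U f) (lT k U g) t = (pair f g t).lTensor _ := by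
  induction t using TensorProduct.induction_on with
  | zero => simp
  | add a b ha hb => simp only [map_add, ha, hb, LinearMap.lTensor_add]
  | tmul a b => simp [lT_apply, Module.End.mul_eq_comp, LinearMap.lTensor_comp]

theorem lT_cv (f g : U →ₗ[k] Module.End k H) : lT k U (cv f g) = cv (lT k U f) (lT k U g) :=
  LinearMap.ext fun _ => (lT_pair f g _).symm

/-! ### Evaluation of the factor `F` -/

/-- The evaluation `f ⊗ h ↦ f(g) h`. -/
def ev : U →ₗ[k] FT k U H →ₗ[k] H :=
  (dualTensorHom k U H ∘ₗ (restrictedDual k U).subtype.rTensor H).flip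

@[simp] theorem ev_tmul (g : U) (f : restrictedDual k U) (h : H) :
    ev g (f ⊗ₜ h) = (f : Module.Dual k U) g • h := by
  simp [ev]

/-- Expanding in a basis of `H` reduces this to the fact that elements of `F` are functions on `U`.
Identities in `F ⊗ H` are proved below by evaluating the factor `F`. -/
theorem ev_injective {s t : FT k U H} (hst : ∀ g : U, ev g s = ev g t) : s = t := by
  classical
  let b := Module.Basis.ofVectorSpace k H
  apply (TensorProduct.equivFinsuppOfBasisRight b (M := restrictedDual k U)).injective
  have key : ∀ (t : FT k U H) (g : U) i,
      ((TensorProduct.equivFinsuppOfBasisRight b t i : restrictedDual k U) : Module.Dual k U) g =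
        b.repr (ev g t) i := by
    intro t g i
    induction t using TensorProduct.induction_on with
    | zero => simp
    | add x y hx hy => simp [hx, hy]
    | tmul a u => simp [mul_comm]
  ext i g
  rw [key, key, hst]

theorem ev_lTensor {H' : Type*} [AddCommGroup H'] [Module k H'] (e : H →ₗ[k] H') (g : U)
    (t : FT k U H) : ev g (e.lTensor _ t) = e (ev g t) := by
  induction t using TensorProduct.induction_on with
  | zero => simp
  | add x y hx hy => simp [hx, hy]
  | tmul a u => simp

theorem ev_lT {X : Type*} [AddCommMonoid X] [Module k X] (e : X →ₗ[k] Module.End k H) (x : X)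
    (g : U) (t : FT k U H) : ev g (lT k U e x t) = e x (ev g t) :=
  ev_lTensor _ _ _

theorem ev_aL (x g : U) (t : FT k U H) :
    ev g (aL k U H x t) = ev (HopfAlgebra.antipode k x * g) t := by
  induction t using TensorProduct.induction_on with
  | zero => simp
  | add x y hx hy => simp [hx, hy]
  | tmul a u => simp [aL_apply]

theorem ev_aR (x g : U) (t : FT k U H) : ev g (aR k U H x t) = ev (g * x) t := by
  induction t using TensorProduct.induction_on with
  | zero => simp
  | add x y hx hy => simp [hx, hy]
  | tmul a u => simp [aR_apply]

/-- The evaluation of two factors `F`, `f ⊗ f' ⊗ h ↦ f(a) f'(b) h`. -/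
def ev2 : U ⊗[k] U →ₗ[k] FT k U (FT k U H) →ₗ[k] H :=
  TensorProduct.lift <| LinearMap.mk₂ k (fun a b => ev b ∘ₗ ev a)
    (fun _ _ _ => by simp [LinearMap.comp_add]) (fun _ _ _ => by simp [LinearMap.comp_smul])
    (fun _ _ _ => by simp [LinearMap.add_comp]) (fun _ _ _ => by simp [LinearMap.smul_comp])

@[simp] theorem ev2_tmul (a b : U) (t : FT k U (FT k U H)) :
    ev2 (a ⊗ₜ b) t = ev b (ev a t) := rfl

variable (k U H) in
/-- The product of the two factors `F` of `F ⊗ F ⊗ H`. -/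
def mulT : FT k U (FT k U H) →ₗ[k] FT k U H :=
  (mulF k U).rTensor H ∘ₗ (TensorProduct.assoc k _ _ H).symm.toLinearMap

theorem mulT_tmul (f g : restrictedDual k U) (h : H) :
    mulT k U H (f ⊗ₜ (g ⊗ₜ h)) = mulF k U (f ⊗ₜ g) ⊗ₜ h := rfl

/-- The product of `F` is dual to `Δ`, so a product is evaluated at `g` by evaluating its factors at
the legs of `Δ(g)`. -/
theorem ev_mulT (g : U) (t : FT k U (FT k U H)) :
    ev g (mulT k U H t) = ev2 (Coalgebra.comul g) t := by
  induction t using TensorProduct.induction_on with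
  | zero => simp
  | add x y hx hy => simp [hx, hy]
  | tmul a s =>
    induction s using TensorProduct.induction_on with
    | zero => simp
    | add x y hx hy => simp [TensorProduct.tmul_add, hx, hy]
    | tmul b h =>
      rw [mulT_tmul, ev_tmul]
      change LinearMap.mul' k k (TensorProduct.map _ _ (Coalgebra.comul g)) • h = _
      generalize (Coalgebra.comul g : U ⊗[k] U) = s
      induction s using TensorProduct.induction_on with
      | zero => simp
      | add x y hx hy => simp [add_smul, hx, hy]
      | tmul x y => simp [smul_smul]

theorem mulT_lTensor {H' : Type*} [AddCommGroup H'] [Module k H'] (e : H →ₗ[k] H')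
    (t : FT k U (FT k U H)) :
    mulT k U H' ((e.lTensor _).lTensor _ t) = e.lTensor _ (mulT k U H t) := by
  refine ev_injective fun g => ?_
  rw [ev_lTensor, ev_mulT, ev_mulT]
  generalize (Coalgebra.comul g : U ⊗[k] U) = s
  induction s using TensorProduct.induction_on with
  | zero => simp
  | add x y hx hy => simp [hx, hy]
  | tmul x y => simp [ev_lTensor]

theorem mulT_lT {X : Type*} [AddCommMonoid X] [Module k X] (e : X →ₗ[k] Module.End k H) (x : X)
    (t : FT k U (FT k U H)) :
    mulT k U H (lT k U (lT k U e) x t) = lT k U e x (mulT k U H t) :=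
  mulT_lTensor _ _

-- The second factor receives `x₁`: left translation goes through `S`, which reverses the coproduct.
-- For right translation (`mulT_aR`) the order is the usual one.
open Coalgebra in
theorem mulT_aL (x : U) (t : FT k U (FT k U H)) :
    aL k U H x (mulT k U H t) = mulT k U H (cv (lT k U (aL k U H)) (aL k U (FT k U H)) x t) := by
  refine ev_injective fun g => ?_
  rw [ev_aL, ev_mulT, ev_mulT, Bialgebra.comul_mul, comul_antipode, cv_apply, ← (ℛ k x).eq]
  generalize (comul g : U ⊗[k] U) = s
  induction s using TensorProduct.induction_on with
  | zero => simp
  | add x y hx hy => simp only [map_add, mul_add, LinearMap.add_apply, hx, hy]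
  | tmul y z => simp [Finset.sum_mul, ev_lT, ev_aL]

theorem mulT_aR (x : U) (t : FT k U (FT k U H)) :
    aR k U H x (mulT k U H t) = mulT k U H (cv (aR k U (FT k U H)) (lT k U (aR k U H)) x t) := by
  refine ev_injective fun g => ?_
  rw [ev_aR, ev_mulT, ev_mulT, Bialgebra.comul_mul, cv_apply]
  generalize (Coalgebra.comul g : U ⊗[k] U) = s
  generalize (Coalgebra.comul x : U ⊗[k] U) = r
  induction s using TensorProduct.induction_on with
  | zero => simp
  | add x y hx hy => simp only [map_add, add_mul, LinearMap.add_apply, hx, hy]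
  | tmul y z =>
    induction r using TensorProduct.induction_on with
    | zero => simp
    | add x y hx hy => simp only [map_add, mul_add, LinearMap.add_apply, hx, hy]
    | tmul a b => simp [ev_lT, ev_aR]

end CoeffSpace

/-! ### Relations satisfied by `A` and `U` on a `D_U`-module. -/

section DUModule

variable {k : Type w} [Field k] {U : Type u} [Ring U] [HopfAlgebra k U]
variable {H : Type*} [AddCommGroup H] [Module k H]
variable {Q : QuasitriangularStructure k U} (φ : DU Q →ₐ[k] Module.End k H)

/-- The action of `U` on a `D_U`-module through `∂_◁`. -/
def gam : U →ₗ[k] Module.End k H := φ.toLinearMap ∘ₗ dLeft Q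

/-- The action `F ⊗ H → H` of `A` on a `D_U`-module `H`. -/
def actA : FT k U H →ₗ[k] H := TensorProduct.lift (φ.toLinearMap ∘ₗ opA Q)

@[simp] theorem actA_tmul (f : restrictedDual k U) (h : H) :
    actA φ (f ⊗ₜ h) = φ (opA Q f) h := rfl

theorem opA_one : opA Q (oneF k U) = 1 :=
  Subtype.ext ((RingQuot.mkAlgHom_rel k SmashRel.one_A).trans (map_one _))

theorem opA_mul (a b : restrictedDual k U) : opA Q a * opA Q b = opA Q (mulA Q (a ⊗ₜ b)) :=
  Subtype.ext ((map_mul (RingQuot.mkAlgHom k (SmashRel Q)) _ _).symm.trans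
    (RingQuot.mkAlgHom_rel k (SmashRel.mul_A a b)))

theorem dLeft_one : dLeft Q 1 = 1 :=
  Subtype.ext ((RingQuot.mkAlgHom_rel k SmashRel.one_U).trans (map_one _))

theorem dLeft_mul (x y : U) : dLeft Q (x * y) = dLeft Q x * dLeft Q y := by
  refine Subtype.ext (Eq.trans ?_ ((RingQuot.mkAlgHom_rel k (SmashRel.mul_U _ _)).symm.trans
    (map_mul (RingQuot.mkAlgHom k (SmashRel Q)) _ _)))
  change inclU2 Q ((x * y) ⊗ₜ 1) = inclU2 Q ((x ⊗ₜ 1) * (y ⊗ₜ 1))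
  simp

theorem isRep_gam : IsRep (gam φ) := by
  constructor
  · simp [gam, dLeft_one]
  · intro x y
    simp [gam, dLeft_mul]

theorem actA_oneF (h : H) : actA φ (oneF k U ⊗ₜ h) = h := by
  simp [opA_one]

theorem map_pair {A B : Type*} [Ring A] [Algebra k A] [Ring B] [Algebra k B] (p : A →ₐ[k] B)
    {X Y : Type*} [AddCommMonoid X] [Module k X] [AddCommMonoid Y] [Module k Y] (f : X →ₗ[k] A)
    (g : Y →ₗ[k] A) (t : X ⊗[k] Y) :
    p (pair f g t) = pair (p.toLinearMap ∘ₗ f) (p.toLinearMap ∘ₗ g) t := by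
  induction t using TensorProduct.induction_on with
  | zero => simp
  | add a b ha hb => simp [ha, hb]
  | tmul a b => simp

theorem inclU2_mul_inclA (g : U ⊗[k] U) (a : restrictedDual k U) : inclU2 Q g * inclA Q a =
    pair (inclA Q ∘ₗ actF.flip a) (inclU2 Q) (comul2 Q g) :=
  ((map_mul (RingQuot.mkAlgHom k (SmashRel Q)) _ _).symm.trans
    (RingQuot.mkAlgHom_rel k (SmashRel.cross g a))).trans
    (map_pair (RingQuot.mkAlgHom k (SmashRel Q)) (genA k U ∘ₗ actF.flip a) (genU2 k U) _)

variable (k U) in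
/-- `x ⊗ y ↦ (x ⊗ 1) ⊗ y`. -/
def mapLeft : U ⊗[k] U →ₐ[k] (U ⊗[k] U) ⊗[k] U :=
  Algebra.TensorProduct.map Algebra.TensorProduct.includeLeft (AlgHom.id k U)

variable (k U) in
/-- `x ⊗ y ↦ (1 ⊗ x) ⊗ y`. -/
def mapRight : U ⊗[k] U →ₐ[k] (U ⊗[k] U) ⊗[k] U :=
  Algebra.TensorProduct.map Algebra.TensorProduct.includeRight (AlgHom.id k U)

variable (k U) in
/-- `x ⊗ y ⊗ z ↦ (x ⊗ y) ⊗ (z ⊗ 1)`. -/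
def mapJ : (U ⊗[k] U) ⊗[k] U →ₐ[k] (U ⊗[k] U) ⊗[k] (U ⊗[k] U) :=
  Algebra.TensorProduct.map (AlgHom.id k _) Algebra.TensorProduct.includeLeft

theorem leg23_eq (t : U ⊗[k] U) : leg23 k U t = mapJ k U (mapRight k U t) := by
  induction t using TensorProduct.induction_on with
  | zero => simp
  | add a b ha hb => simp only [map_add, ha, hb]
  | tmul a b => simp [leg23, mapJ, mapRight]

/-- The second leg lies in `U ⊗ 1`, which is why the cross relation of the smash product stays
inside `D_U` and can be written with `∂_◁` only. -/
theorem comul2_tmul_one (x : U) : comul2 Q (x ⊗ₜ 1) =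
    mapJ k U (mapRight k U Q.Rinv * (mapLeft k U (Coalgebra.comul x) * mapRight k U Q.R)) := by
  have h₂ : ∀ t : U ⊗[k] U, TensorProduct.tensorTensorTensorComm k U U U U (t ⊗ₜ (1 ⊗ₜ 1)) =
      mapJ k U (mapLeft k U t) := by
    intro t
    induction t using TensorProduct.induction_on with
    | zero => simp
    | add a b ha hb => simp only [map_add, TensorProduct.add_tmul, ha, hb]
    | tmul a b => simp [mapJ, mapLeft]
  rw [map_mul, map_mul, ← leg23_eq, ← leg23_eq, ← h₂]
  simp [comul2, Algebra.TensorProduct.one_def]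

theorem coe_pair {A : Type*} [Ring A] [Algebra k A] {D : Subalgebra k A} {X Y : Type*}
    [AddCommMonoid X] [Module k X] [AddCommMonoid Y] [Module k Y] {f : X →ₗ[k] D} {g : Y →ₗ[k] D}
    {f' : X →ₗ[k] A} {g' : Y →ₗ[k] A} (hf : ∀ x, (f x : A) = f' x) (hg : ∀ x, (g x : A) = g' x)
    (t : X ⊗[k] Y) : (pair f g t : A) = pair f' g' t := by
  induction t using TensorProduct.induction_on with
  | zero => simp
  | add a b ha hb => simp [ha, hb]
  | tmul a b => simp [hf, hg]

theorem coe_opA (a : restrictedDual k U) : (opA Q a : SmashProduct Q) = inclA Q a := rfl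

theorem coe_dLeft (x : U) : (dLeft Q x : SmashProduct Q) = inclU2 Q (x ⊗ₜ 1) := rfl

theorem coe_pair_opA (a : restrictedDual k U) (t : (U ⊗[k] U) ⊗[k] U) :
    ((pair (opA Q ∘ₗ actF.flip a) (dLeft Q) t : DU Q) : SmashProduct Q) =
      pair (inclA Q ∘ₗ actF.flip a) (inclU2 Q) (mapJ k U t) := by
  rw [coe_pair (f' := inclA Q ∘ₗ actF.flip a) (g' := inclU2 Q ∘ₗ (TensorProduct.mk k U U).flip 1)
    (fun _ => rfl) (fun _ => rfl)]
  exact pair_comp_map (inclA Q ∘ₗ actF.flip a) (inclU2 Q) LinearMap.id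
    ((TensorProduct.mk k U U).flip 1) t

theorem dLeft_mul_opA (x : U) (a : restrictedDual k U) :
    dLeft Q x * opA Q a = pair (opA Q ∘ₗ actF.flip a) (dLeft Q)
      (mapRight k U Q.Rinv * (mapLeft k U (Coalgebra.comul x) * mapRight k U Q.R)) := by
  apply Subtype.ext
  rw [coe_pair_opA, ← comul2_tmul_one, ← inclU2_mul_inclA, Subalgebra.coe_mul, coe_opA, coe_dLeft]

/-- The cross relation of the smash product. -/
theorem gam_actA (x : U) (t : FT k U H) : gam φ x (actA φ t) =
    actA φ (Ri Q (aR k U H) (lT k U (gam φ)) (cv (aL k U H) (lT k U (gam φ)) x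
      (Rm Q (aR k U H) (lT k U (gam φ)) t))) := by
  induction t using TensorProduct.induction_on with
  | zero => simp
  | add a b ha hb => simp only [map_add, ha, hb]
  | tmul a h =>
    have h₁ : gam φ x (actA φ (a ⊗ₜ h)) = φ (dLeft Q x * opA Q a) h := by
      simp [gam]
    have h₂ : ∀ t, φ (pair (opA Q ∘ₗ actF.flip a) (dLeft Q) t) h =
        actA φ (pair (actL k U H) (lT k U (gam φ)) t (a ⊗ₜ h)) := by
      intro t
      induction t using TensorProduct.induction_on with
      | zero => simp
      | add a b ha hb => simp only [map_add, LinearMap.add_apply, ha, hb]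
      | tmul a b => simp [gam]
    have hP := (isRep_actL (k := k) (U := U) (H := H)).pair_mul (isRep_gam φ).lT (comm_actL_lT _)
    have h₃ : ∀ t : U ⊗[k] U, pair (actL k U H) (lT k U (gam φ)) (mapRight k U t) =
          pair (aR k U H) (lT k U (gam φ)) t := by
      intro t
      induction t using TensorProduct.induction_on with
      | zero => simp
      | add a b ha hb => simp only [map_add, ha, hb]
      | tmul a b => simp [aR_apply, mapRight]
    have h₄ : ∀ t : U ⊗[k] U, pair (actL k U H) (lT k U (gam φ)) (mapLeft k U t) =
          pair (aL k U H) (lT k U (gam φ)) t := by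
      intro t
      induction t using TensorProduct.induction_on with
      | zero => simp
      | add a b ha hb => simp only [map_add, ha, hb]
      | tmul a b => simp [aL_apply, mapLeft]
    rw [h₁, dLeft_mul_opA, h₂, hP, hP, h₃, h₃, h₄]
    rfl

/-- Associativity of the action of the reflection equation algebra. -/
theorem actA_actA (t : FT k U (FT k U H)) : actA φ ((actA φ).lTensor _ t) =
    actA φ (mulT k U H (Rm Q (cv (aL k U (FT k U H)) (aR k U (FT k U H))) (lT k U (aL k U H)) t)) := by
  -- The cocycle `R₁₃R₂₃` is `(Δ ⊗ id)R`. It acts as the R-matrix between the coadjoint action on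
  -- the first factor `F` and left translation on the second.
  have h₁ : Rm Q (cv (aL k U (FT k U H)) (aR k U (FT k U H))) (lT k U (aL k U H)) =
      pair (actL k U (FT k U H)) (lT k U (actL k U H)) (cocycle Q) := by
    have h₃ : ∀ t : U ⊗[k] U, pair (actL k U (FT k U H)) (lT k U (actL k U H)) (leg13 k U t) =
        pair (aL k U (FT k U H)) (lT k U (aL k U H)) t := by
      intro t
      induction t using TensorProduct.induction_on with
      | zero => simp
      | add a b ha hb => simp only [map_add, ha, hb]
      | tmul a b => simp [aL_apply, leg13, lT_apply]
    have h₄ : ∀ t : U ⊗[k] U, pair (actL k U (FT k U H)) (lT k U (actL k U H)) (leg23 k U t) =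
        pair (aR k U (FT k U H)) (lT k U (aL k U H)) t := by
      intro t
      induction t using TensorProduct.induction_on with
      | zero => simp
      | add a b ha hb => simp only [map_add, ha, hb]
      | tmul a b => simp [aL_apply, aR_apply, leg23, lT_apply]
    rw [cocycle, isRep_actL.pair_mul isRep_actL.lT (comm_actL_lT _), h₃, h₄,
      Rm_cv_left Q isRep_aL.lT (comm_aR_lT _)]
    rfl
  rw [h₁]
  induction t using TensorProduct.induction_on with
  | zero => simp
  | add a b ha hb => simp only [map_add, ha, hb]
  | tmul a s =>
    induction s using TensorProduct.induction_on with
    | zero => simp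
    | add x y hx hy => simp only [TensorProduct.tmul_add, map_add, hx, hy]
    | tmul b h =>
      have h₂ : actA φ ((actA φ).lTensor _ (a ⊗ₜ (b ⊗ₜ h))) = φ (opA Q a * opA Q b) h := by
        simp
      rw [h₂, opA_mul, mulA, LinearMap.comp_apply]
      generalize cocycle Q = c
      induction c using TensorProduct.induction_on with
      | zero => simp
      | add x y hx hy => simp only [map_add, LinearMap.add_apply, hx, hy]
      | tmul x y =>
        simp [mulT_tmul]

end DUModule

/-! ### Inverse R-matrices, the comodule `U'` and the adjoint action of `U`. -/

section MoreRepCalculus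

variable {k : Type w} [Field k] {U : Type u} [Ring U] [HopfAlgebra k U]
variable {E : Type*} [Ring E] [Algebra k E] (Q : QuasitriangularStructure k U)

theorem Ri_yangBaxter {f g h : U →ₗ[k] E} (hf : IsRep f) (hg : IsRep g) (hh : IsRep h)
    (hfg : Comm f g) (hfh : Comm f h) (hgh : Comm g h) :
    Rm Q f g * Ri Q g h * Ri Q f h = Ri Q f h * Ri Q g h * Rm Q f g := by
  have h₁ := Rm_yangBaxter Q hf hg hh hfg hfh hgh
  have h₂ : Ri Q f h * Ri Q g h * (Rm Q g h * Rm Q f h) = 1 := by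
    rw [mul_assoc, ← mul_assoc (Ri Q g h), Ri_mul_Rm Q hg hh hgh, one_mul, Ri_mul_Rm Q hf hh hfh]
  have h₃ : (Rm Q f h * Rm Q g h) * (Ri Q g h * Ri Q f h) = 1 := by
    rw [mul_assoc, ← mul_assoc (Rm Q g h), Rm_mul_Ri Q hg hh hgh, one_mul, Rm_mul_Ri Q hf hh hfh]
  calc _ = Ri Q f h * Ri Q g h * (Rm Q g h * Rm Q f h * Rm Q f g) * (Ri Q g h * Ri Q f h) := by
        rw [← mul_assoc _ _ (Rm Q f g), h₂, one_mul, mul_assoc]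
    _ = Ri Q f h * Ri Q g h * Rm Q f g * ((Rm Q f h * Rm Q g h) * (Ri Q g h * Ri Q f h)) := by
        rw [← h₁]
        simp only [mul_assoc]
    _ = _ := by rw [h₃, mul_one]

theorem cv_apply_intertwine {H₁ H₂ : Type*} [AddCommGroup H₁] [Module k H₁] [AddCommGroup H₂]
    [Module k H₂] {f₁ g₁ : U →ₗ[k] Module.End k H₁} {f₂ g₂ : U →ₗ[k] Module.End k H₂}
    {m : H₁ →ₗ[k] H₂} (hf : ∀ x v, m (f₁ x v) = f₂ x (m v)) (hg : ∀ y v, m (g₁ y v) = g₂ y (m v))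
    (x : U) (v : H₁) : m (cv f₁ g₁ x v) = cv f₂ g₂ x (m v) :=
  pair_apply_intertwine hf hg _ _

/-! ### The comodule `U'` -/

theorem assoc_comulLocFin (y : locFin k U) : TensorProduct.assoc k U U (locFin k U)
    ((Coalgebra.comul : U →ₗ[k] U ⊗[k] U).rTensor _ (comulLocFin k U y)) =
      (comulLocFin k U).lTensor U (comulLocFin k U y) := by
  -- Over a field the inclusion of `U'` stays injective after tensoring, so coassociativity can be
  -- tested in `U ⊗ U ⊗ U`.
  have hinj : Function.Injective (((locFin k U).subtype.lTensor U).lTensor U) :=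
    Module.Flat.lTensor_preserves_injective_linearMap _ lTensor_locFin_injective
  apply hinj
  have h₁ : ∀ t : U ⊗[k] locFin k U, ((locFin k U).subtype.lTensor U).lTensor U
      (TensorProduct.assoc k U U (locFin k U)
        ((Coalgebra.comul : U →ₗ[k] U ⊗[k] U).rTensor _ t)) = TensorProduct.assoc k U U U
        ((Coalgebra.comul : U →ₗ[k] U ⊗[k] U).rTensor _ ((locFin k U).subtype.lTensor U t)) := by
    intro t
    induction t with
    | zero => simp
    | add a b ha hb => simp only [map_add, ha, hb]
    | tmul a b =>
      simp only [LinearMap.rTensor_tmul, LinearMap.lTensor_tmul]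
      generalize (Coalgebra.comul a : U ⊗[k] U) = s
      induction s with
      | zero => simp
      | add a b ha hb => simp only [map_add, TensorProduct.add_tmul, ha, hb]
      | tmul a b => simp
  have h₂ : ∀ t : U ⊗[k] locFin k U, ((locFin k U).subtype.lTensor U).lTensor U
      ((comulLocFin k U).lTensor U t) =
        (Coalgebra.comul : U →ₗ[k] U ⊗[k] U).lTensor U ((locFin k U).subtype.lTensor U t) := by
    intro t
    induction t with
    | zero => simp
    | add a b ha hb => simp only [map_add, ha, hb]
    | tmul a b => simp [lTensor_comulLocFin]
  rw [h₁, h₂, lTensor_comulLocFin, Coalgebra.coassoc_apply]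

theorem lid_comulLocFin (y : locFin k U) : TensorProduct.lid k (locFin k U)
    ((Coalgebra.counit : U →ₗ[k] k).rTensor _ (comulLocFin k U y)) = y := by
  apply Subtype.val_injective
  have h₁ : ∀ t : U ⊗[k] locFin k U, ((TensorProduct.lid k (locFin k U)
      ((Coalgebra.counit : U →ₗ[k] k).rTensor _ t) : locFin k U) : U) = TensorProduct.lid k U
      ((Coalgebra.counit : U →ₗ[k] k).rTensor _ ((locFin k U).subtype.lTensor U t)) := by
    intro t
    induction t with
    | zero => simp
    | add a b ha hb => simp only [map_add, Submodule.coe_add, ha, hb]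
    | tmul a b => simp
  rw [h₁, lTensor_comulLocFin, Coalgebra.rTensor_counit_comul, TensorProduct.lid_tmul, one_smul]

/-- The convolution `y ↦ f(y₁) r(y₂)`. -/
def star (f : U →ₗ[k] E) (r : locFin k U →ₗ[k] E) : locFin k U →ₗ[k] E :=
  pair f r ∘ₗ comulLocFin k U

theorem star_apply (f : U →ₗ[k] E) (r : locFin k U →ₗ[k] E) (y : locFin k U) :
    star f r y = pair f r (comulLocFin k U y) := rfl

/-- Coassociativity of `U' → U ⊗ U'`. Together with `eps_star` it makes the linear maps out of `U'`
a module over the convolution algebra of maps out of `U`. -/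
theorem star_star (f g : U →ₗ[k] E) (r : locFin k U →ₗ[k] E) :
    star f (star g r) = star (cv f g) r := by
  ext1 y
  have h₁ : ∀ t : U ⊗[k] locFin k U, pair f (star g r) t =
      pair f (pair g r) ((comulLocFin k U).lTensor U t) := by
    intro t
    induction t with
    | zero => simp
    | add a b ha hb => simp only [map_add, ha, hb]
    | tmul a b => simp [star_apply]
  have h₂ : ∀ t : U ⊗[k] locFin k U, pair (cv f g) r t =
      pair f (pair g r) (TensorProduct.assoc k U U (locFin k U)
        ((Coalgebra.comul : U →ₗ[k] U ⊗[k] U).rTensor _ t)) := by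
    intro t
    induction t with
    | zero => simp
    | add a b ha hb => simp only [map_add, ha, hb]
    | tmul a b =>
      rw [pair_tmul, LinearMap.rTensor_tmul, cv_apply]
      generalize (Coalgebra.comul a : U ⊗[k] U) = s
      induction s with
      | zero => simp
      | add a b ha hb => simp only [map_add, TensorProduct.add_tmul, add_mul, ha, hb]
      | tmul a b => simp [mul_assoc]
  rw [star_apply, star_apply, h₁, h₂, assoc_comulLocFin]

theorem eps_star (r : locFin k U →ₗ[k] E) : star (eps k U E) r = r := by
  ext1 y
  have h₁ : ∀ t : U ⊗[k] locFin k U, pair (eps k U E) r t =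
      r (TensorProduct.lid k (locFin k U) ((Coalgebra.counit : U →ₗ[k] k).rTensor _ t)) := by
    intro t
    induction t with
    | zero => simp
    | add a b ha hb => simp only [map_add, ha, hb]
    | tmul a b => simp [Algebra.smul_def]
  rw [star_apply, h₁, lid_comulLocFin]

/-! ### Identities for the adjoint action -/

/-- In `∑ h₁ z S(h₂) h₃` the last two legs cancel. -/
theorem cv_adU_id (z : U) : cv ((adU (k := k)).flip z) LinearMap.id = LinearMap.mulRight k z := by
  have h : (adU (k := k)).flip z = cv (LinearMap.mulRight k z) (HopfAlgebra.antipode k) := by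
    ext x
    rw [LinearMap.flip_apply, adU_apply, cv_apply]
    conv_rhs => rw [← (Coalgebra.Repr.arbitrary k x).eq]
    simp
  have h₂ : cv (HopfAlgebra.antipode k) (LinearMap.id : U →ₗ[k] U) = eps k U U := by
    have := antipode_cv (k := k) (U := U) (f := LinearMap.id) ⟨rfl, fun _ _ => rfl⟩
    rwa [LinearMap.id_comp] at this
  rw [h, cv_assoc, h₂, cv_eps]

variable (k U) in
/-- The inclusion `x ↦ x ⊗ 1`. -/
def inL : U →ₗ[k] U ⊗[k] U := (Algebra.TensorProduct.includeLeft : U →ₐ[k] U ⊗[k] U).toLinearMap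

variable (k U) in
/-- The inclusion `x ↦ 1 ⊗ x`. -/
def inR : U →ₗ[k] U ⊗[k] U := (Algebra.TensorProduct.includeRight : U →ₐ[k] U ⊗[k] U).toLinearMap

theorem inL_apply (x : U) : inL k U x = x ⊗ₜ 1 := rfl

theorem inR_apply (x : U) : inR k U x = 1 ⊗ₜ x := rfl

theorem cv_inL_inR : cv (inL k U) (inR k U) = Coalgebra.comul :=
  congrArg WithConv.ofConv (incl_mul_incl (k := k) (U := U))

variable (k U) in
/-- The action `g ↦ g₁ ⊗ ad(g₂)` of `U` on `U ⊗ U`. -/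
def mulAd : U →ₗ[k] Module.End k (U ⊗[k] U) :=
  cv (LinearMap.rTensorHom U ∘ₗ LinearMap.mul k U) (LinearMap.lTensorHom U ∘ₗ adU)

theorem cv_comul_adU (y : U) :
    cv (cv (Coalgebra.comul ∘ₗ (adU (k := k)).flip y) (inL k U)) (inR k U) =
      LinearMap.mulRight k (Coalgebra.comul y) ∘ₗ Coalgebra.comul := by
  have h : cv (Coalgebra.comul ∘ₗ (adU (k := k)).flip y) (Coalgebra.comul ∘ₗ LinearMap.id) =
      (Coalgebra.comul ∘ₗ cv ((adU (k := k)).flip y) LinearMap.id : U →ₗ[k] U ⊗[k] U) := by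
    ext1 x
    exact (map_pair (Bialgebra.comulAlgHom k U) _ _ _).symm
  rw [cv_assoc, cv_inL_inR]
  rw [cv_adU_id] at h
  refine h.trans ?_
  ext1 x
  simp

theorem cv_mulAd_inR (t : U ⊗[k] U) : cv ((mulAd k U).flip t) (inR k U) =
    LinearMap.mulRight k t ∘ₗ Coalgebra.comul := by
  induction t with
  | zero =>
    ext1 x
    simp [cv_apply, pair]
  | add a b ha hb =>
    have : cv ((mulAd k U).flip a + (mulAd k U).flip b) (inR k U) =
        cv ((mulAd k U).flip a) (inR k U) + cv ((mulAd k U).flip b) (inR k U) := by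
      simp [cv, pair, TensorProduct.map_add_left, LinearMap.add_comp, LinearMap.comp_add]
    rw [map_add, this, ha, hb]
    ext1 x
    simp [mul_add]
  | tmul p q =>
    have h₁ : (mulAd k U).flip (p ⊗ₜ q) =
        cv (inL k U ∘ₗ LinearMap.mulRight k p) (inR k U ∘ₗ (adU (k := k)).flip q) := by
      ext1 x
      rw [LinearMap.flip_apply, mulAd, cv_apply, cv_apply]
      generalize (Coalgebra.comul x : U ⊗[k] U) = s
      induction s with
      | zero => simp
      | add a b ha hb => simp only [map_add, LinearMap.add_apply, ha, hb]
      | tmul a b => simp [inL_apply, inR_apply]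
    have h₂ : cv (inR k U ∘ₗ (adU (k := k)).flip q) (inR k U) =
        inR k U ∘ₗ LinearMap.mulRight k q := by
      rw [← cv_adU_id]
      ext1 x
      exact (map_pair (Algebra.TensorProduct.includeRight : U →ₐ[k] U ⊗[k] U) _
        LinearMap.id _).symm
    rw [h₁, cv_assoc, h₂]
    ext1 x
    rw [cv_apply, LinearMap.comp_apply, LinearMap.mulRight_apply]
    generalize (Coalgebra.comul x : U ⊗[k] U) = s
    induction s with
    | zero => simp
    | add a b ha hb => simp only [map_add, add_mul, ha, hb]
    | tmul a b => simp [inL_apply, inR_apply]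

/-- `∑ Δ(ad(g₁) y) (g₂ ⊗ 1) = ∑ (g₁ ⊗ ad(g₂)) Δ(y)`. -/
theorem comul_adU (y g : U) : cv (Coalgebra.comul ∘ₗ (adU (k := k)).flip y) (inL k U) g =
    mulAd k U g (Coalgebra.comul y) := by
  have hR : cv (inR k U) (inR k U ∘ₗ HopfAlgebra.antipode k) = eps k U _ :=
    cv_antipode (AlgHom.isRep _)
  -- Convolved with `g ↦ 1 ⊗ g`, both sides become `g ↦ Δ(g) Δ(y)`. That factor has the convolution
  -- inverse `g ↦ 1 ⊗ S(g)` and can be cancelled.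
  have h : cv (cv (Coalgebra.comul ∘ₗ (adU (k := k)).flip y) (inL k U)) (inR k U) =
      cv ((mulAd k U).flip (Coalgebra.comul y)) (inR k U) := by
    rw [cv_comul_adU, cv_mulAd_inR]
  have h₂ := congrArg (fun f => cv f (inR k U ∘ₗ HopfAlgebra.antipode k)) h
  simp only [cv_assoc (g := inR k U), hR, cv_eps] at h₂
  exact congrArg (fun f => f g) h₂

theorem antipode_antipodeInv (hS : Function.Bijective (HopfAlgebra.antipode k (A := U))) (x : U) :
    HopfAlgebra.antipode k (antipodeInv k U x) = x := by
  have h : IsUnit (HopfAlgebra.antipode k (A := U) : Module.End k U) :=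
    (Module.End.isUnit_iff _).2 hS
  exact LinearMap.congr_fun (Ring.mul_inverse_cancel _ h) x

theorem antipodeInv_antipode (hS : Function.Bijective (HopfAlgebra.antipode k (A := U))) (x : U) :
    antipodeInv k U (HopfAlgebra.antipode k x) = x :=
  hS.1 (antipode_antipodeInv hS _)

/-- `∑ x₁ S⁻¹(ad(S(x₂)) z) = S⁻¹(z) x`. -/
theorem cv_antipodeInv_adU (hS : Function.Bijective (HopfAlgebra.antipode k (A := U))) (x z : U) :
    cv LinearMap.id (antipodeInv k U ∘ₗ (adU (k := k)).flip z ∘ₗ HopfAlgebra.antipode k) x =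
      antipodeInv k U z * x := by
  -- After applying `S` the claim is `cv_adU_id` at the element `S(x)`, whose coproduct has its legs
  -- reversed.
  apply hS.1
  have h := LinearMap.congr_fun (cv_adU_id (k := k) z) (HopfAlgebra.antipode k x)
  rw [cv_apply, comul_antipode] at h
  rw [HopfAlgebra.antipode_mul_antidistrib, antipode_antipodeInv hS, cv_apply,
    ← (Coalgebra.Repr.arbitrary k x).eq]
  simp only [map_sum, pair_tmul, LinearMap.comp_apply, LinearMap.id_apply,
    HopfAlgebra.antipode_mul_antidistrib, antipode_antipodeInv hS]
  simpa using h

end MoreRepCalculus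

/-! ### The Heisenberg double form of a `D_U`-module, and the vector fields `∂_▷`. -/

section Heisenberg

variable {k : Type w} [Field k] {U : Type u} [Ring U] [HopfAlgebra k U]
variable {H : Type*} [AddCommGroup H] [Module k H]

variable (k U H) in
/-- The coadjoint action `x ↦ (x₁ ⊗ x₂)` of `U` on the factor `F` of `F ⊗ H`. -/
def aLR : U →ₗ[k] Module.End k (FT k U H) := cv (aL k U H) (aR k U H)

theorem isRep_aLR : IsRep (aLR k U H) := isRep_aL.cv isRep_aR comm_aL_aR

theorem comm_aLR_lT {X : Type*} [AddCommMonoid X] [Module k X] (g : X →ₗ[k] Module.End k H) :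
    Comm (aLR k U H) (lT k U g) := (comm_aL_lT g).cv_left (comm_aR_lT g)

theorem lTensor_actL {H' : Type*} [AddCommGroup H'] [Module k H'] (e : H →ₗ[k] H') (x : U ⊗[k] U)
    (t : FT k U H) : e.lTensor _ (actL k U H x t) = actL k U H' x (e.lTensor _ t) := by
  induction t using TensorProduct.induction_on with
  | zero => simp
  | add a b ha hb => simp only [map_add, ha, hb]
  | tmul a b => simp

theorem lTensor_aL {H' : Type*} [AddCommGroup H'] [Module k H'] (e : H →ₗ[k] H') (x : U)
    (t : FT k U H) : e.lTensor _ (aL k U H x t) = aL k U H' x (e.lTensor _ t) :=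
  lTensor_actL e _ t

theorem lTensor_aR {H' : Type*} [AddCommGroup H'] [Module k H'] (e : H →ₗ[k] H') (x : U)
    (t : FT k U H) : e.lTensor _ (aR k U H x t) = aR k U H' x (e.lTensor _ t) :=
  lTensor_actL e _ t

theorem lTensor_aLR {H' : Type*} [AddCommGroup H'] [Module k H'] (e : H →ₗ[k] H') (x : U)
    (t : FT k U H) : e.lTensor _ (aLR k U H x t) = aLR k U H' x (e.lTensor _ t) :=
  cv_apply_intertwine (lTensor_aL e) (lTensor_aR e) x t

theorem lT_apply_lTensor {X H' : Type*} [AddCommMonoid X] [Module k X] [AddCommGroup H']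
    [Module k H'] {e : H →ₗ[k] H'} {f : X →ₗ[k] Module.End k H} {f' : X →ₗ[k] Module.End k H'}
    (h : ∀ x v, e (f x v) = f' x (e v)) (x : X) (t : FT k U H) :
    e.lTensor _ (lT k U f x t) = lT k U f' x (e.lTensor _ t) := by
  induction t using TensorProduct.induction_on with
  | zero => simp
  | add a b ha hb => simp only [map_add, ha, hb]
  | tmul a b => simp [h]

/-- The coadjoint action on a product does not split into one leg for each factor: the first factor
sits between left and right translation of the second. -/
theorem mulT_aLR (x : U) (t : FT k U (FT k U H)) : aLR k U H x (mulT k U H t) =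
    mulT k U H (cv (lT k U (aL k U H)) (cv (aLR k U (FT k U H)) (lT k U (aR k U H))) x t) := by
  rw [aLR, aLR, cv_assoc (aL k U (FT k U H)), ← cv_assoc (lT k U (aL k U H))]
  exact (cv_apply_intertwine (fun x v => (mulT_aL x v).symm) (fun x v => (mulT_aR x v).symm) x t).symm

variable {Q : QuasitriangularStructure k U} (φ : DU Q →ₐ[k] Module.End k H)

/-- The action on a `D_U`-module of the copy of `F` in the Heisenberg double. -/
def hatA : FT k U H →ₗ[k] H := actA φ ∘ₗ Ri Q (aLR k U H) (lT k U (gam φ))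

theorem hatA_apply (t : FT k U H) :
    hatA φ t = actA φ (Ri Q (aLR k U H) (lT k U (gam φ)) t) := rfl

theorem Rm_Ri_apply {f g : U →ₗ[k] Module.End k H} (hf : IsRep f) (hg : IsRep g) (h : Comm f g)
    (v : H) : Rm Q f g (Ri Q f g v) = v := LinearMap.congr_fun (Rm_mul_Ri Q hf hg h) v

theorem Ri_Rm_apply {f g : U →ₗ[k] Module.End k H} (hf : IsRep f) (hg : IsRep g) (h : Comm f g)
    (v : H) : Ri Q f g (Rm Q f g v) = v := LinearMap.congr_fun (Ri_mul_Rm Q hf hg h) v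

theorem hatA_Rm (t : FT k U H) :
    hatA φ (Rm Q (aLR k U H) (lT k U (gam φ)) t) = actA φ t := by
  rw [hatA_apply, Ri_Rm_apply isRep_aLR (isRep_gam φ).lT (comm_aLR_lT _)]

/-- The twist factors as `Ri Q aR γ * Ri Q aL γ`. The first piece absorbs the R-matrices of
`gam_actA`, and the second reverses the order of the remaining convolution, which leaves the cross
relation of the Heisenberg double. -/
theorem gam_hatA (x : U) (t : FT k U H) :
    gam φ x (hatA φ t) = hatA φ (cv (lT k U (gam φ)) (aL k U H) x t) := by
  have hg := (isRep_gam φ).lT (U := U)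
  have h₁ : Ri Q (aLR k U H) (lT k U (gam φ)) =
      Ri Q (aR k U H) (lT k U (gam φ)) * Ri Q (aL k U H) (lT k U (gam φ)) :=
    Ri_cv_left Q isRep_aL isRep_aR hg comm_aL_aR (comm_aL_lT _) (comm_aR_lT _)
  have h₂ := LinearMap.congr_fun (Ri_mul_cv Q (isRep_aL (k := k) (U := U) (H := H)) hg
    (comm_aL_lT _) x) t
  rw [hatA_apply, gam_actA, h₁, Module.End.mul_apply, Rm_Ri_apply isRep_aR hg (comm_aR_lT _),
    hatA_apply, h₁, Module.End.mul_apply]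
  exact congrArg _ (congrArg _ h₂.symm)

/-- Both translations act on the counit through `ε`, so the twist by `R⁻¹` does nothing to it. -/
theorem hatA_oneF (h : H) : hatA φ (oneF k U ⊗ₜ h) = h := by
  have hL : ∀ (x : U) (h : H), TensorProduct.mk k _ H (oneF k U) (eps k U (Module.End k H) x h) =
      aL k U H x (TensorProduct.mk k _ H (oneF k U) h) := fun x h =>
    ev_injective fun g => by simp [ev_aL, oneF, smul_smul]
  have hR : ∀ (x : U) (h : H), TensorProduct.mk k _ H (oneF k U) (eps k U (Module.End k H) x h) =
      aR k U H x (TensorProduct.mk k _ H (oneF k U) h) := fun x h =>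
    ev_injective fun g => by simp [ev_aR, oneF, smul_smul, mul_comm]
  have h₁ : ∀ (x : U) (h : H), TensorProduct.mk k _ H (oneF k U) (eps k U (Module.End k H) x h) =
      aLR k U H x (TensorProduct.mk k _ H (oneF k U) h) := by
    intro x h
    rw [aLR, ← cv_apply_intertwine hL hR, eps_cv]
  have h₂ := pair_apply_intertwine (m := TensorProduct.mk k _ H (oneF k U))
    (f₁ := eps k U (Module.End k H)) (g₁ := gam φ) (f₂ := aLR k U H) (g₂ := lT k U (gam φ))
    h₁ (fun x v => by simp) Q.Rinv h
  have h₃ := LinearMap.congr_fun (Ri_eps_left Q (isRep_gam φ)) h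
  rw [hatA_apply]
  refine (congrArg (actA φ) h₂.symm).trans ?_
  refine (congrArg (fun h => actA φ (oneF k U ⊗ₜ h)) h₃).trans ?_
  exact actA_oneF φ h

/-- The purpose of the twist: for `hatA` the product on `F` is the undeformed one, dual to `Δ`.
Moving the outer R-matrix through the inner action by `gam_hatA` reduces this to an identity between
R-matrices. -/
theorem hatA_hatA (t : FT k U (FT k U H)) :
    hatA φ ((hatA φ).lTensor _ t) = hatA φ (mulT k U H t) := by
  let a := aLR k U (FT k U H)
  let b₁ := lT k U (aL k U H)
  let b₂ := lT k U (aR k U H)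
  let g := lT k U (lT k U (gam φ))
  have ha : IsRep a := isRep_aLR
  have hb₁ : IsRep b₁ := isRep_aL.lT
  have hb₂ : IsRep b₂ := isRep_aR.lT
  have hg : IsRep g := (isRep_gam φ).lT.lT
  have hab₁ : Comm a b₁ := comm_aLR_lT _
  have hab₂ : Comm a b₂ := comm_aLR_lT _
  have hag : Comm a g := comm_aLR_lT _
  have hb : Comm b₁ b₂ := comm_aL_aR.lT
  have hb₁g : Comm b₁ g := (comm_aL_lT _).lT
  have hb₂g : Comm b₂ g := (comm_aR_lT _).lT
  have h₁ : ∀ t, Ri Q (aLR k U H) (lT k U (gam φ)) ((hatA φ).lTensor _ t) =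
      (hatA φ).lTensor _ (Ri Q a (cv g b₁) t) := fun t =>
    (pair_apply_intertwine (lTensor_aLR (hatA φ)) (fun x v => by
      refine Eq.trans ?_ (lT_apply_lTensor (fun x v => (gam_hatA φ x v).symm) x v)
      rw [lT_cv]) _ t).symm
  have h₂ : ∀ t, (hatA φ).lTensor (restrictedDual k U) t =
      (actA φ).lTensor _ (Ri Q (cv b₁ b₂) g t) := fun t => by
    have : cv b₁ b₂ = lT k U (aLR k U H) := (lT_cv _ _).symm
    rw [hatA, LinearMap.lTensor_comp, LinearMap.comp_apply, this, Ri, Ri, lT_pair]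
  have h₃ : Ri Q (aLR k U H) (lT k U (gam φ)) (mulT k U H t) =
      mulT k U H (Ri Q (cv b₁ (cv a b₂)) g t) :=
    (pair_apply_intertwine (fun x v => (mulT_aLR x v).symm) (fun x v => mulT_lT _ x v) _ t).symm
  rw [hatA_apply, hatA_apply, h₁, h₂, actA_actA, h₃]
  -- An identity for the four actions `a`, `b₁`, `b₂`, `g`. Once all convolutions are split, it is
  -- the Yang-Baxter equation for `a`, `b₁`, `g` and a cancellation of `Rm Q a b₁` with its inverse.
  have h₄ : Rm Q a b₁ * (Ri Q (cv b₁ b₂) g * Ri Q a (cv g b₁)) = Ri Q (cv b₁ (cv a b₂)) g := by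
    rw [Ri_cv_right Q ha hg hb₁ hag hab₁ hb₁g.symm, Ri_cv_left Q hb₁ hb₂ hg hb hb₁g hb₂g,
      Ri_cv_left Q hb₁ (ha.cv hb₂ hab₂) hg (hab₁.symm.cv_right hb) hb₁g (hag.cv_left hb₂g),
      Ri_cv_left Q ha hb₂ hg hab₂ hag hb₂g]
    have hc : Commute (Rm Q a b₁) (Ri Q b₂ g) :=
      Rm_commute Q (fun x => ((Ri_commute Q (fun y => hab₂.symm y x) fun y => hag.symm y x).symm))
        (fun x => ((Ri_commute Q (fun y => hb.symm y x) fun y => hb₁g.symm y x).symm))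
    calc _ = (Rm Q a b₁ * Ri Q b₂ g) * (Ri Q b₁ g * Ri Q a g) * Ri Q a b₁ := by
          simp only [mul_assoc]
      _ = Ri Q b₂ g * (Rm Q a b₁ * Ri Q b₁ g * Ri Q a g) * Ri Q a b₁ := by
          rw [hc.eq]
          simp only [mul_assoc]
      _ = _ := by
          rw [Ri_yangBaxter Q ha hb₁ hg hab₁ hag hb₁g]
          simp only [mul_assoc, Rm_mul_Ri Q ha hb₁ hab₁, mul_one]
  exact congrArg (fun e => actA φ (mulT k U H (e t))) h₄

/-! ### The vector fields `∂_▷` -/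

/-- The map `f ⊗ x ↦ (h ↦ f ⊗ S⁻¹(x) h)`. -/
def kapAux (γ : U →ₗ[k] Module.End k H) : restrictedDual k U ⊗[k] U →ₗ[k] H →ₗ[k] FT k U H :=
  TensorProduct.lift <| LinearMap.mk₂ k
    (fun f x => TensorProduct.mk k _ H f ∘ₗ γ (antipodeInv k U x))
    (fun _ _ _ => by rw [map_add, LinearMap.add_comp]) (fun _ _ _ => by rw [map_smul, LinearMap.smul_comp])
    (fun _ _ _ => by rw [map_add, map_add, LinearMap.comp_add])
    (fun _ _ _ => by rw [map_smul, map_smul, LinearMap.comp_smul])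

@[simp] theorem kapAux_tmul (γ : U →ₗ[k] Module.End k H) (f : restrictedDual k U) (x : U) (h : H) :
    kapAux γ (f ⊗ₜ x) h = f ⊗ₜ γ (antipodeInv k U x) h := rfl

/-- The map `h ↦ ∑ aᵢ ⊗ S⁻¹(yᵢ) h` where `∑ aᵢ ⊗ yᵢ` is the coadjoint image of `y`. -/
def kap (γ : U →ₗ[k] Module.End k H) : locFin k U →ₗ[k] H →ₗ[k] FT k U H :=
  kapAux γ ∘ₗ coad k U

/-- The coadjoint expansion of `y` is characterised by its values `ad(g) y`, so no choice of `aᵢ`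
and `yᵢ` is needed from here on. -/
theorem ev_kap (γ : U →ₗ[k] Module.End k H) (y : locFin k U) (g : U) (h : H) :
    ev g (kap γ y h) = γ (antipodeInv k U (adU (k := k) g y)) h := by
  rw [← evalF_coad, kap, LinearMap.comp_apply]
  generalize coad k U y = t
  induction t with
  | zero => simp
  | add a b ha hb => simp only [map_add, LinearMap.add_apply, ha, hb]
  | tmul a b => simp

/-- The action of `U'` on a `D_U`-module through `∂_▷`. -/
def rho : locFin k U →ₗ[k] Module.End k H := φ.toLinearMap ∘ₗ dRight Q

/-- `∂_▷(y)` is the element `∑ aᵢ ⊗ S⁻¹(yᵢ)` of the Heisenberg double; its part in `F` acts through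
`hatA` and its part in `U` through `∂_◁`. -/
theorem rho_apply (y : locFin k U) (h : H) : rho φ y h = hatA φ (kap (gam φ) y h) := by
  have h₁ : ∀ (f : restrictedDual k U) (s : U ⊗[k] U) (h : H),
      φ (pair (opA Q ∘ₗ actF.flip f ∘ₗ Coalgebra.comul) (dLeft Q) s) h =
        actA φ (pair (aLR k U H) (lT k U (gam φ)) s (f ⊗ₜ h)) := by
    intro f s h
    induction s with
    | zero => simp
    | add a b ha hb => simp only [map_add, LinearMap.add_apply, ha, hb]
    | tmul a b =>
      have h₂ : ∀ t : U ⊗[k] U, pair (aL k U H) (aR k U H) t = actL k U H t := by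
        intro t
        induction t with
        | zero => simp
        | add a b ha hb => simp only [map_add, ha, hb]
        | tmul a b =>
          rw [pair_tmul, aL_apply, aR_apply, ← isRep_actL.map_mul]
          simp
      simp [aLR, cv_apply, h₂, gam]
  change φ (xiInv Q ((antipodeInv k U).lTensor (restrictedDual k U) (coad k U y))) h =
    hatA φ (kapAux (gam φ) (coad k U y) h)
  generalize coad k U y = t
  induction t with
  | zero => simp
  | add a b ha hb => simp only [map_add, LinearMap.add_apply, ha, hb]
  | tmul a b =>
    rw [kapAux_tmul, hatA_apply, Ri, ← h₁]
    change φ (pair (opA Q ∘ₗ actF.flip a ∘ₗ Coalgebra.comul) (dLeft Q) Q.Rinv *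
      dLeft Q (antipodeInv k U b)) h = _
    rw [map_mul, Module.End.mul_apply]
    rfl

/-- Evaluated at `g`, this is `∑ x₁ S⁻¹(ad(S(x₂)) z) = S⁻¹(z) x` for `z = ad(g) y`. With `gam_hatA`
it yields that `∂_◁` and `∂_▷` commute. -/
theorem cv_lT_aL_kap (hS : Function.Bijective (HopfAlgebra.antipode k (A := U)))
    {γ : U →ₗ[k] Module.End k H} (hγ : IsRep γ) (x : U) (y : locFin k U) (h : H) :
    cv (lT k U γ) (aL k U H) x (kap γ y h) = kap γ y (γ x h) := by
  refine ev_injective fun g => ?_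
  have h₁ := cv_antipodeInv_adU hS x (adU (k := k) g y)
  rw [ev_kap, ← Module.End.mul_apply, ← hγ.map_mul, ← h₁, cv_apply, cv_apply]
  generalize (Coalgebra.comul x : U ⊗[k] U) = s
  induction s with
  | zero => simp
  | add a b ha hb => simp only [map_add, LinearMap.add_apply, ha, hb]
  | tmul a b => simp [ev_lT, ev_aL, ev_kap, adU_mul, hγ.map_mul]

theorem gam_rho (hS : Function.Bijective (HopfAlgebra.antipode k (A := U)))
    (x : U) (y : locFin k U) (h : H) :
    gam φ x (rho φ y h) = rho φ y (gam φ x h) := by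
  rw [rho_apply, rho_apply, gam_hatA, cv_lT_aL_kap hS (isRep_gam φ)]

theorem comm_gam_rho (hS : Function.Bijective (HopfAlgebra.antipode k (A := U))) : Comm (gam φ) (rho φ) := fun x y => LinearMap.ext (gam_rho φ hS x y)

open Coalgebra in
theorem comul_antipodeInv (hS : Function.Bijective (HopfAlgebra.antipode k (A := U)))
    (x : U) : comul (antipodeInv k U x) =
    TensorProduct.map (antipodeInv k U) (antipodeInv k U) (TensorProduct.comm k U U (comul x)) := by
  obtain ⟨y, rfl⟩ := hS.2 x
  rw [antipodeInv_antipode hS, comul_antipode]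
  conv_lhs => rw [← (ℛ k y).eq]
  simp [antipodeInv_antipode hS]

/-- The multiplicative content of the coadjoint expansion, derived from `comul_adU`; it is what
moves `∂_▷(y)` past an element of `F`. The map `G` stands for the right-hand side as a linear
function of the legs of `Δ(y)`. -/
theorem mulT_kap (hS : Function.Bijective (HopfAlgebra.antipode k (A := U)))
    {γ : U →ₗ[k] Module.End k H} (y : locFin k U) (s : FT k U H) :
    ∀ G : U ⊗[k] locFin k U →ₗ[k] FT k U H,
    (∀ a v, G (a ⊗ₜ v) = mulT k U H ((kap γ v).lTensor _ (aR k U H a s))) →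
    mulT k U H (kap (cv (lT k U γ) (aL k U H)) y s) = G (comulLocFin k U y) := by
  intro G hG
  refine ev_injective fun g => ?_
  -- Both sides, evaluated at `g`, are values of `Ξ`: the left one at `∑ Δ(ad(g₁) y)(g₂ ⊗ 1)`, the
  -- right one at `∑ (g₁ ⊗ ad(g₂)) Δ(y)`.
  let Ξ : U ⊗[k] U →ₗ[k] H := TensorProduct.lift (LinearMap.mk₂ k
    (fun p q => γ (antipodeInv k U q) (ev p s)) (by simp) (by simp) (by simp) (by simp))
  have hΞ : ∀ p q, Ξ (p ⊗ₜ q) = γ (antipodeInv k U q) (ev p s) := fun _ _ => rfl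
  have h₁ : ev g (mulT k U H (kap (cv (lT k U γ) (aL k U H)) y s)) =
      Ξ (cv (Coalgebra.comul ∘ₗ (adU (k := k)).flip (y : U)) (inL k U) g) := by
    rw [ev_mulT, cv_apply]
    generalize (Coalgebra.comul g : U ⊗[k] U) = r
    induction r with
    | zero => simp
    | add a b ha hb => simp only [map_add, LinearMap.add_apply, ha, hb]
    | tmul a b =>
      rw [ev2_tmul, ev_kap, cv_apply, comul_antipodeInv hS, pair_tmul, LinearMap.comp_apply,
        LinearMap.flip_apply]
      generalize (Coalgebra.comul (adU (k := k) a (y : U)) : U ⊗[k] U) = r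
      induction r with
      | zero => simp
      | add a b ha hb => simp only [map_add, add_mul, LinearMap.add_apply, ha, hb]
      | tmul p q => simp [ev_lT, ev_aL, inL_apply, hΞ, antipode_antipodeInv hS]
  have h₂ : ∀ t, ev g (G t) = Ξ (mulAd k U g ((locFin k U).subtype.lTensor U t)) := by
    intro t
    induction t with
    | zero => simp
    | add a b ha hb => simp only [map_add, ha, hb]
    | tmul a v =>
      rw [hG, ev_mulT, mulAd, cv_apply]
      generalize (Coalgebra.comul g : U ⊗[k] U) = r
      induction r with
      | zero => simp
      | add a b ha hb => simp only [map_add, LinearMap.add_apply, ha, hb]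
      | tmul p q => simp [ev_lTensor, ev_kap, ev_aR, hΞ]
  rw [h₁, comul_adU, h₂, lTensor_comulLocFin]

theorem kap_hatA (y : locFin k U) (s : FT k U H) : kap (gam φ) y (hatA φ s) =
    (hatA φ).lTensor _ (kap (cv (lT k U (gam φ)) (aL k U H)) y s) := by
  refine ev_injective fun g => ?_
  rw [ev_kap, ev_lTensor, ev_kap, gam_hatA]

/-- Moving `∂_▷(y)` past `F` translates by `y₁` on the right and leaves `∂_▷(y₂)`. In the Heisenberg
double this is `mulT_kap` combined with multiplicativity of `hatA`. -/
theorem rho_hatA (hS : Function.Bijective (HopfAlgebra.antipode k (A := U)))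
    (y : locFin k U) (s : FT k U H) :
    rho φ y (hatA φ s) = hatA φ (star (aR k U H) (lT k U (rho φ)) y s) := by
  let G : U ⊗[k] locFin k U →ₗ[k] FT k U H := TensorProduct.lift (LinearMap.mk₂ k
    (fun a v => mulT k U H ((kap (gam φ) v).lTensor _ (aR k U H a s)))
    (by simp) (by simp) (by simp [LinearMap.lTensor_add]) (by simp [LinearMap.lTensor_smul]))
  have hG : ∀ a v, G (a ⊗ₜ v) = mulT k U H ((kap (gam φ) v).lTensor _ (aR k U H a s)) :=
    fun _ _ => rfl
  rw [rho_apply, kap_hatA φ, hatA_hatA, mulT_kap hS y s G hG, star_apply]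
  generalize comulLocFin k U y = t
  induction t with
  | zero => simp
  | add a b ha hb => simp only [map_add, LinearMap.add_apply, ha, hb]
  | tmul a v =>
    rw [hG, ← hatA_hatA, pair_tmul, ((comm_aR_lT (rho φ)) a v).eq, Module.End.mul_apply]
    congr 1
    refine ev_injective fun g => ?_
    simp only [ev_lTensor, ev_lT, rho_apply]

/-- The commutation of `A` with `∑ ∂_◁(x₁) ∂_▷(x₂)`. -/
theorem star_gam_rho_actA (hS : Function.Bijective (HopfAlgebra.antipode k (A := U)))
    (x : locFin k U) (t : FT k U H) :
    star (gam φ) (rho φ) x (actA φ t) =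
      actA φ (star (cv (aLR k U H) (lT k U (gam φ))) (lT k U (rho φ)) x t) := by
  have hg := (isRep_gam φ).lT (U := U)
  have h₁ : ∀ s, star (gam φ) (rho φ) x (hatA φ s) =
      hatA φ (star (cv (lT k U (gam φ)) (aLR k U H)) (lT k U (rho φ)) x s) := by
    intro s
    rw [aLR, ← cv_assoc, ← star_star]
    -- Left translation comes from `∂_◁` and right translation from `∂_▷`; they are adjacent and
    -- combine to the coadjoint action.
    exact (pair_apply_intertwine (fun x v => (gam_hatA φ x v).symm)
      (fun x v => (rho_hatA φ hS x v).symm) _ s).symm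
  rw [← hatA_Rm, ← hatA_Rm, h₁]
  congr 1
  -- Undoing the twist exchanges the order of the coadjoint action and `∂_◁`. The R-matrix does not
  -- affect `∂_▷`, which commutes with both.
  refine (pair_apply_intertwine (m := Rm Q (aLR k U H) (lT k U (gam φ))) ?_ ?_ _ t).symm
  · exact fun x v => LinearMap.congr_fun (Rm_mul_cv Q isRep_aLR hg (comm_aLR_lT _) x) v
  · exact fun y v => LinearMap.congr_fun (Rm_commute Q (fun x => comm_aLR_lT (rho φ) x y)
      (fun x => (comm_gam_rho φ hS).lT x y)).eq v

end Heisenberg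

/-! ### Coactions and the operator `L`: equivariance, reflection, cross relation, invertibility. -/

section Coaction

variable {k : Type w} [Field k] {U : Type u} [Ring U] [HopfAlgebra k U]
variable {H : Type*} [AddCommGroup H] [Module k H]

/-- A map `λ : H → F ⊗ H` which describes the operators `π(g)` as `(g ⊗ id) ∘ λ`. -/
def IsCoact (π : U →ₗ[k] Module.End k H) (lam : H →ₗ[k] FT k U H) : Prop :=
  ∀ g v, ev g (lam v) = π g v

theorem IsCoact.aR {π : U →ₗ[k] Module.End k H} {lam : H →ₗ[k] FT k U H} (hl : IsCoact π lam)
    (hπ : IsRep π) (y : U) (v : H) : lam (π y v) = aR k U H y (lam v) :=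
  ev_injective fun g => by rw [ev_aR, hl, hl, hπ.map_mul, Module.End.mul_apply]

/-- Evaluated at `g` this is `∑ π(x₁) π(S(x₂)) π(g) = ε(x) π(g)`. This invariance is the source of
all cancellations below. -/
theorem IsCoact.cv_aL {π : U →ₗ[k] Module.End k H} {lam : H →ₗ[k] FT k U H} (hl : IsCoact π lam)
    (hπ : IsRep π) (x : U) (v : H) :
    cv (lT k U π) (aL k U H) x (lam v) = Coalgebra.counit (R := k) x • lam v := by
  refine ev_injective fun g => ?_
  have h := LinearMap.congr_fun (LinearMap.congr_fun (cv_antipode hπ) x) (π g v)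
  have h₁ : ∀ s : U ⊗[k] U, ev g (pair (lT k U π) (QuantumD.aL k U H) s (lam v)) =
      pair π (π ∘ₗ HopfAlgebra.antipode k) s (π g v) := by
    intro s
    induction s with
    | zero => simp
    | add a b ha hb => simp only [map_add, LinearMap.add_apply, ha, hb]
    | tmul a b => simp [ev_lT, ev_aL, hl _ v, hπ.map_mul]
  rw [cv_apply, h₁, map_smul, hl]
  exact h.trans (by simp [Module.algebraMap_end_apply])

/-- A coaction is determined by its evaluations, hence is functorial for intertwining maps. -/
theorem IsCoact.natural {H' : Type*} [AddCommGroup H'] [Module k H']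
    {π : U →ₗ[k] Module.End k H} {lam : H →ₗ[k] FT k U H} (hl : IsCoact π lam)
    {π' : U →ₗ[k] Module.End k H'} {lam' : H' →ₗ[k] FT k U H'} (hl' : IsCoact π' lam')
    {n : H →ₗ[k] H'} (hn : ∀ x v, n (π x v) = π' x (n v)) (v : H) :
    lam' (n v) = n.lTensor _ (lam v) :=
  ev_injective fun g => by rw [hl', ev_lTensor, hl, hn]

theorem IsCoact.apply_comm {X : Type*} [AddCommMonoid X] [Module k X] {π : U →ₗ[k] Module.End k H}
    {lam : H →ₗ[k] FT k U H} (hl : IsCoact π lam) {f : X →ₗ[k] Module.End k H} (h : Comm f π)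
    (x : X) (v : H) : lam (f x v) = lT k U f x (lam v) :=
  hl.natural hl (fun y v => LinearMap.congr_fun (h x y).eq v) v

/-- The coaction of a tensor product of two actions multiplies the two coefficients in `F`, because
that product is dual to `Δ`. -/
theorem IsCoact.mulT_comp {π₁ π₂ : U →ₗ[k] Module.End k H} {lam : H →ₗ[k] FT k U H}
    {lam' : FT k U H →ₗ[k] FT k U (FT k U H)} (hl : IsCoact π₂ lam)
    (hl' : IsCoact (lT k U π₁) lam') : IsCoact (cv π₁ π₂) (mulT k U H ∘ₗ lam' ∘ₗ lam) := by
  intro g v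
  rw [LinearMap.comp_apply, ev_mulT, cv_apply]
  generalize (Coalgebra.comul g : U ⊗[k] U) = s
  induction s with
  | zero => simp
  | add a b ha hb => simp only [map_add, LinearMap.add_apply, ha, hb]
  | tmul a b => simp [hl' a, ev_lT, hl b]

variable (Q : QuasitriangularStructure k U)

theorem Rm_apply_of_right {f g : U →ₗ[k] Module.End k H} (hf : IsRep f) {w : H}
    (hg : ∀ x, g x w = Coalgebra.counit (R := k) x • w) : Rm Q f g w = w := by
  have h : ∀ t, pair f g t w = pair f (eps k U _) t w := by
    intro t
    induction t with
    | zero => simp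
    | add a b ha hb => simp only [map_add, LinearMap.add_apply, ha, hb]
    | tmul a b => simp [hg, Module.algebraMap_end_apply]
  rw [Rm, h]
  exact LinearMap.congr_fun (Rm_eps_right Q hf) w

theorem Rm_apply_of_left {f g : U →ₗ[k] Module.End k H} (hg : IsRep g) {w : H}
    (h : Comm f g) (hf : ∀ x, f x w = Coalgebra.counit (R := k) x • w) : Rm Q f g w = w := by
  have h : ∀ t, pair f g t w = pair (eps k U _) g t w := by
    intro t
    induction t with
    | zero => simp
    | add a b ha hb => simp only [map_add, LinearMap.add_apply, ha, hb]
    | tmul a b => rw [pair_tmul, (h a b).eq]; simp [hf, Module.algebraMap_end_apply]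
  rw [Rm, h]
  exact LinearMap.congr_fun (Rm_eps_left Q hg) w

variable {Q}

/-- On `lam v` the convolution of `π` with left translation is trivial, so left translation in an
R-matrix may be traded for `π` in the inverse R-matrix. -/
theorem IsCoact.Rm_aL {π : U →ₗ[k] Module.End k H} {lam : H →ₗ[k] FT k U H} (hl : IsCoact π lam)
    (hπ : IsRep π) {g : U →ₗ[k] Module.End k (FT k U H)} (hg : IsRep g)
    (hag : Comm (QuantumD.aL k U H) g) (hpg : Comm (QuantumD.lT k U π) g) (v : H) :
    Rm Q (QuantumD.aL k U H) g (lam v) = Ri Q (QuantumD.lT k U π) g (lam v) := by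
  have h : Rm Q (cv (QuantumD.lT k U π) (QuantumD.aL k U H)) g (lam v) = lam v :=
    Rm_apply_of_left Q hg (hpg.cv_left hag) fun x => hl.cv_aL hπ x v
  rw [Rm_cv_left Q hg hag, Module.End.mul_apply] at h
  rw [← Ri_Rm_apply (Q := Q) hπ.lT hg hpg (Rm Q (QuantumD.aL k U H) g (lam v)), h]

variable (φ : DU Q →ₐ[k] Module.End k H)

/-- An action of `U` commutes with the action of `D_U`. -/
def CommD {X : Type*} [AddCommMonoid X] [Module k X] (f : X →ₗ[k] Module.End k H) : Prop :=
  ∀ x d, Commute (f x) (φ d)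

variable {φ}

theorem CommD.gam {X : Type*} [AddCommMonoid X] [Module k X] {f : X →ₗ[k] Module.End k H}
    (h : CommD φ f) : Comm f (gam φ) := fun x _ => h x _

theorem CommD.rho {X : Type*} [AddCommMonoid X] [Module k X] {f : X →ₗ[k] Module.End k H}
    (h : CommD φ f) : Comm f (rho φ) := fun x _ => h x _

theorem CommD.actA {X : Type*} [AddCommMonoid X] [Module k X] {f : X →ₗ[k] Module.End k H}
    (h : CommD φ f) (x : X) (t : FT k U H) : actA φ (lT k U f x t) = f x (actA φ t) := by
  induction t using TensorProduct.induction_on with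
  | zero => simp
  | add a b ha hb => simp only [map_add, ha, hb]
  | tmul a b => exact (LinearMap.congr_fun (h x (opA Q a)).eq b).symm

theorem CommD.hatA {X : Type*} [AddCommMonoid X] [Module k X] {f : X →ₗ[k] Module.End k H}
    (h : CommD φ f) (x : X) (t : FT k U H) : hatA φ (lT k U f x t) = f x (hatA φ t) := by
  rw [hatA_apply, hatA_apply, ← h.actA]
  congr 1
  exact LinearMap.congr_fun (Ri_commute Q (fun y => comm_aLR_lT f y x)
    (fun y => h.gam.symm.lT y x)).eq t

/-- The operator `L = (A-action) ∘ (coaction)` commutes with the adjoint action. -/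
theorem IsCoact.actA_star (hS : Function.Bijective (HopfAlgebra.antipode k (A := U)))
    {π : U →ₗ[k] Module.End k H} {lam : H →ₗ[k] FT k U H}
    (hl : IsCoact π lam) (hπ : IsRep π) (hφ : CommD φ π) (x : locFin k U) (v : H) :
    star (cv π (gam φ)) (rho φ) x (actA φ (lam v)) =
      actA φ (lam (star (cv π (gam φ)) (rho φ) x v)) := by
  have h₁ : star (cv π (gam φ)) (rho φ) x (actA φ (lam v)) = actA φ (star (QuantumD.lT k U π)
      (star (cv (aLR k U H) (QuantumD.lT k U (gam φ))) (QuantumD.lT k U (rho φ))) x (lam v)) := by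
    rw [← star_star]
    exact (pair_apply_intertwine hφ.actA (fun x v => (star_gam_rho_actA φ hS x v).symm) _ _).symm
  have h₂ : ∀ x v, lam (star (cv π (gam φ)) (rho φ) x v) =
      star (cv (QuantumD.aR k U H) (QuantumD.lT k U (gam φ))) (QuantumD.lT k U (rho φ)) x (lam v) :=
    fun x v => pair_apply_intertwine (cv_apply_intertwine (hl.aR hπ) (hl.apply_comm hφ.gam.symm))
      (hl.apply_comm hφ.rho.symm) _ _
  -- The adjoint action reaches `lam v` as `π`, left translation, right translation, `∂_◁`, `∂_▷`,
  -- in this order. The first two cancel by `cv_aL`, and right translation becomes `π` inside `lam`.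
  rw [h₁, star_star, aLR, cv_assoc (QuantumD.aL k U H), ← cv_assoc, ← star_star]
  congr 1
  have h₃ : ∀ x v, lam (eps k U (Module.End k H) x v) =
      cv (QuantumD.lT k U π) (QuantumD.aL k U H) x (lam v) := fun x v => by
    rw [hl.cv_aL hπ, eps_apply, Module.algebraMap_end_apply, map_smul]
  refine (pair_apply_intertwine h₃ h₂ _ _).symm.trans ?_
  exact congrArg (fun f => lam (f x v)) (eps_star (star (cv π (gam φ)) (rho φ)))

/-- Fusion: `L₁ R₁₂ L₂` equals `R₁₂` times the operator `L` of the tensor product of `π₁` and `π₂`.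
The twist in the product of `A` supplies the R-matrices which make this exact. -/
theorem IsCoact.actA_Rm_actA {π₁ π₂ : U →ₗ[k] Module.End k H} {lam₁ lam₂ : H →ₗ[k] FT k U H}
    {lam₁' : FT k U H →ₗ[k] FT k U (FT k U H)} (hl₁ : IsCoact π₁ lam₁) (hl₂ : IsCoact π₂ lam₂)
    (hl' : IsCoact (QuantumD.lT k U π₁) lam₁') (hπ₁ : IsRep π₁) (hπ₂ : IsRep π₂) (h : Comm π₁ π₂)
    (hφ₁ : CommD φ π₁) (hφ₂ : CommD φ π₂) (v : H) :
    actA φ (lam₁ (Rm Q π₁ π₂ (actA φ (lam₂ v)))) =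
      Rm Q π₁ π₂ (actA φ (QuantumD.mulT k U H (lam₁' (lam₂ v)))) := by
  let p₁ := QuantumD.lT k U (QuantumD.lT k U π₁)
  let p₂ := QuantumD.lT k U (QuantumD.lT k U π₂)
  let b := QuantumD.lT k U (QuantumD.aL k U H)
  let a := QuantumD.aL k U (FT k U H)
  let a' := QuantumD.aR k U (FT k U H)
  have ha : IsRep a := isRep_aL
  have ha' : IsRep a' := isRep_aR
  have hb : IsRep b := isRep_aL.lT
  have hp₁ : IsRep p₁ := hπ₁.lT.lT
  have hp₂ : IsRep p₂ := hπ₂.lT.lT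
  have hp : Comm p₁ p₂ := h.lT.lT
  have hab : Comm a b := comm_aL_lT _
  have ha'b : Comm a' b := comm_aR_lT _
  have ha'p₂ : Comm a' p₂ := comm_aR_lT _
  have hp₁b : Comm p₁ b := (comm_aL_lT π₁).symm.lT
  have hp₂b : Comm p₂ b := (comm_aL_lT π₂).symm.lT
  have h₁ : Rm Q π₁ π₂ (actA φ (lam₂ v)) =
      actA φ (Rm Q (QuantumD.lT k U π₁) (QuantumD.lT k U π₂) (lam₂ v)) :=
    (pair_apply_intertwine hφ₁.actA hφ₂.actA _ _).symm
  have h₂ : ∀ t, lam₁ (actA φ t) = (actA φ).lTensor _ (lam₁' t) := hl'.natural hl₁ hφ₁.actA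
  have h₃ : ∀ t, lam₁' (Rm Q (QuantumD.lT k U π₁) (QuantumD.lT k U π₂) t) =
      Rm Q a' p₂ (lam₁' t) :=
    pair_apply_intertwine (hl'.aR hπ₁.lT) (hl'.apply_comm h.symm.lT) _
  set X := lam₁' (lam₂ v) with hX
  -- Invariance of `lam₂ v`, carried through `lam₁'`. It lets `b` be cancelled against `p₂` in
  -- R-matrices with `a'` (`h₄`) and with `p₁` (`h₅`).
  have hX₂ : ∀ x, cv p₂ b x X = Coalgebra.counit (R := k) x • X := fun x => by
    rw [hX, ← map_smul, ← hl₂.cv_aL hπ₂]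
    exact (cv_apply_intertwine (hl'.apply_comm h.symm.lT) (hl'.apply_comm (comm_aL_lT π₁)) x _).symm
  have h₄ : Rm Q a' b (Rm Q a' p₂ X) = X := by
    have := Rm_apply_of_right Q ha' hX₂
    rwa [Rm_cv_right Q ha' ha'b hp₂b] at this
  have h₅ : Rm Q p₁ b (Rm Q p₁ p₂ X) = X := by
    have := Rm_apply_of_right Q hp₁ hX₂
    rwa [Rm_cv_right Q hp₁ hp₁b hp₂b] at this
  have h₆ : Rm Q a b X = Rm Q p₁ p₂ X := by
    rw [hX, hl'.Rm_aL hπ₁.lT hb hab hp₁b, ← hX]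
    conv_lhs => rw [← h₅]
    exact Ri_Rm_apply hp₁ hb hp₁b _
  rw [h₁, h₂, h₃, actA_actA, Rm_cv_left Q hb ha'b, Module.End.mul_apply]
  refine (congrArg (fun t => actA φ (QuantumD.mulT k U H (Rm Q a b t))) h₄).trans ?_
  rw [h₆]
  refine (congrArg (actA φ) (pair_apply_intertwine (m := QuantumD.mulT k U H)
    (fun x v => mulT_lT π₁ x v) (fun x v => mulT_lT π₂ x v) _ _)).trans ?_
  exact pair_apply_intertwine hφ₁.actA hφ₂.actA _ _

/-- The reflection equation. -/
theorem IsCoact.reflection {π₁ π₂ : U →ₗ[k] Module.End k H} {lam₁ lam₂ : H →ₗ[k] FT k U H}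
    {lam₁' lam₂' : FT k U H →ₗ[k] FT k U (FT k U H)} (hl₁ : IsCoact π₁ lam₁)
    (hl₂ : IsCoact π₂ lam₂) (hl₁' : IsCoact (QuantumD.lT k U π₁) lam₁')
    (hl₂' : IsCoact (QuantumD.lT k U π₂) lam₂') (hπ₁ : IsRep π₁) (hπ₂ : IsRep π₂) (h : Comm π₁ π₂)
    (hφ₁ : CommD φ π₁) (hφ₂ : CommD φ π₂) (v : H) :
    actA φ (lam₁ (Rm Q π₁ π₂ (actA φ (lam₂ (Rm Q π₂ π₁ v))))) =
      Rm Q π₁ π₂ (actA φ (lam₂ (Rm Q π₂ π₁ (actA φ (lam₁ v))))) := by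
  rw [hl₁.actA_Rm_actA hl₂ hl₁' hπ₁ hπ₂ h hφ₁ hφ₂,
    hl₂.actA_Rm_actA hl₁ hl₂' hπ₂ hπ₁ h.symm hφ₂ hφ₁]
  have h₁ : ∀ t, Rm Q π₂ π₁ (actA φ t) = actA φ ((Rm Q π₂ π₁).lTensor _ t) := fun t => by
    rw [Rm, ← lT_pair]
    exact (pair_apply_intertwine hφ₂.actA hφ₁.actA _ _).symm
  rw [h₁]
  congr 2
  -- After fusion both sides involve the coactions of the tensor products in the two orders, which
  -- the R-matrix intertwines.
  exact (hl₁.mulT_comp hl₂').natural (hl₂.mulT_comp hl₁')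
    (fun x v => LinearMap.congr_fun (Rm_mul_cv Q hπ₂ hπ₁ h.symm x) v) v

variable (Q) in
/-- The double braiding of two actions of `U`. -/
def dbl {E : Type*} [Ring E] [Algebra k E] (f g : U →ₗ[k] E) : E := Rm Q g f * Rm Q f g

/-- With legs `1, 2, 3` for `f, g, h`: two applications of Yang-Baxter give `R₃₂R₂₃R₁₃R₁₂ =
R₁₃R₁₂R₃₂R₂₃`, and `R₁₃` is cancelled. -/
theorem dbl_yangBaxter {E : Type*} [Ring E] [Algebra k E] {f g h : U →ₗ[k] E} (hf : IsRep f)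
    (hg : IsRep g) (hh : IsRep h) (hfg : Comm f g) (hfh : Comm f h) (hgh : Comm g h) :
    Ri Q f h * dbl Q g h * Rm Q f h * Rm Q f g = Rm Q f g * dbl Q g h := by
  calc _ = Ri Q f h * Rm Q h g * (Rm Q g h * Rm Q f h * Rm Q f g) := by
        simp only [dbl, mul_assoc]
    _ = Ri Q f h * (Rm Q h g * Rm Q f g * Rm Q f h) * Rm Q g h := by
        rw [← Rm_yangBaxter Q hf hg hh hfg hfh hgh]
        simp only [mul_assoc]
    _ = (Ri Q f h * Rm Q f h) * Rm Q f g * Rm Q h g * Rm Q g h := by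
        rw [← Rm_yangBaxter Q hf hh hg hfh hfg hgh.symm]
        simp only [mul_assoc]
    _ = _ := by rw [Ri_mul_Rm Q hf hh hfh, one_mul, dbl, mul_assoc]

theorem dbl_apply_intertwine {H₁ H₂ : Type*} [AddCommGroup H₁] [Module k H₁] [AddCommGroup H₂]
    [Module k H₂] {f₁ g₁ : U →ₗ[k] Module.End k H₁} {f₂ g₂ : U →ₗ[k] Module.End k H₂}
    {m : H₁ →ₗ[k] H₂} (hf : ∀ x v, m (f₁ x v) = f₂ x (m v)) (hg : ∀ y v, m (g₁ y v) = g₂ y (m v))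
    (v : H₁) : m (dbl Q f₁ g₁ v) = dbl Q f₂ g₂ (m v) := by
  rw [dbl, dbl, Module.End.mul_apply, Module.End.mul_apply, Rm, Rm, Rm, Rm,
    pair_apply_intertwine hg hf, pair_apply_intertwine hf hg]

/-- Adding one more factor `g` on the left wraps the double braiding in two R-matrices. This is the
recursion for the `Y_i`. -/
theorem dbl_cv_right {E : Type*} [Ring E] [Algebra k E] {f g h : U →ₗ[k] E} (hf : IsRep f)
    (hfh : Comm f h) (hgh : Comm g h) :
    dbl Q f (cv g h) = Rm Q g f * dbl Q f h * Rm Q f g := by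
  rw [dbl, Rm_cv_left Q hf hfh.symm, Rm_cv_right Q hf hfh hgh, dbl]
  simp only [mul_assoc]

/-- Moves a double braiding with `M` past `L`. By the cross relation `∂_◁` picks up left and right
translation on `F`; on `lam v` these are expressed through `π₁`. -/
theorem IsCoact.dbl_Rm_actA {π₁ π₂ : U →ₗ[k] Module.End k H} {lam : H →ₗ[k] FT k U H}
    (hl : IsCoact π₁ lam) (hπ₁ : IsRep π₁) (hπ₂ : IsRep π₂) (h : Comm π₁ π₂)
    (hφ₁ : CommD φ π₁) (hφ₂ : CommD φ π₂) (v : H) :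
    dbl Q π₂ (QuantumD.gam φ) (Rm Q π₂ π₁ (actA φ (lam v))) = Ri Q π₁ π₂ (actA φ (lam
      (Ri Q π₁ (QuantumD.gam φ) (dbl Q π₂ (QuantumD.gam φ) (Rm Q π₁ (QuantumD.gam φ) v))))) := by
  let p₁ := QuantumD.lT k U π₁
  let p₂ := QuantumD.lT k U π₂
  let g := QuantumD.lT k U (QuantumD.gam φ)
  let a := QuantumD.aL k U H
  let a' := QuantumD.aR k U H
  have ha : IsRep a := isRep_aL
  have ha' : IsRep a' := isRep_aR
  have hg : IsRep g := (isRep_gam φ).lT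
  have hp₁ : IsRep p₁ := hπ₁.lT
  have hp₂ : IsRep p₂ := hπ₂.lT
  have hp : Comm p₁ p₂ := h.lT
  have haa' : Comm a a' := comm_aL_aR
  have hag : Comm a g := comm_aL_lT _
  have ha'g : Comm a' g := comm_aR_lT _
  have hap₁ : Comm a p₁ := comm_aL_lT _
  have hap₂ : Comm a p₂ := comm_aL_lT _
  have ha'p₁ : Comm a' p₁ := comm_aR_lT _
  have ha'p₂ : Comm a' p₂ := comm_aR_lT _
  have hp₁g : Comm p₁ g := hφ₁.gam.lT
  have hp₂g : Comm p₂ g := hφ₂.gam.lT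
  have h₁ : Rm Q π₂ π₁ (actA φ (lam v)) = actA φ (Rm Q p₂ p₁ (lam v)) :=
    (pair_apply_intertwine hφ₂.actA hφ₁.actA _ _).symm
  have h₂ : ∀ s, dbl Q π₂ (QuantumD.gam φ) (actA φ (Ri Q a' g s)) =
      actA φ (Ri Q a' g (dbl Q p₂ (cv a g) s)) := fun s => by
    refine (dbl_apply_intertwine (m := actA φ ∘ₗ Ri Q a' g) (fun x v => ?_) (fun x v => ?_) s).symm
    · rw [LinearMap.comp_apply, LinearMap.comp_apply, ← hφ₂.actA]
      congr 1
      exact LinearMap.congr_fun (Ri_commute Q (fun y => ha'p₂ y x) (fun y => hp₂g.symm y x)).eq v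
    · rw [LinearMap.comp_apply, LinearMap.comp_apply, gam_actA]
      exact congrArg (fun v => actA φ (Ri Q a' g (cv a g x v))) (Rm_Ri_apply ha' hg ha'g v).symm
  have hc : Commute (Rm Q a' g) (Rm Q p₂ a) :=
    Rm_commute Q (fun x => (Rm_commute Q (fun y => ha'p₂.symm y x) fun y => haa' y x).symm)
      (fun x => (Rm_commute Q (fun y => hp₂g y x) fun y => hag y x).symm)
  have hc₂ : Commute (Ri Q a' g) (Rm Q a p₂) :=
    Ri_commute Q (fun x => ((Rm_commute Q (fun y => haa' y x) fun y => ha'p₂.symm y x)).symm)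
      (fun x => ((Rm_commute Q (fun y => hag y x) fun y => hp₂g y x)).symm)
  -- These two R-matrices form the one between `p₂` and the convolution of `p₁` with `a`, which acts
  -- trivially on `lam v`.
  have h₃ : Rm Q p₂ a (Rm Q p₂ p₁ (lam v)) = lam v := by
    have := Rm_apply_of_right Q hp₂ (hl.cv_aL hπ₁ · v)
    rwa [Rm_cv_right Q hp₂ hap₂.symm hap₁.symm] at this
  have h₄ : ∀ v, lam (Rm Q π₁ (QuantumD.gam φ) v) = Rm Q a' g (lam v) :=
    pair_apply_intertwine (hl.aR hπ₁) (hl.apply_comm hφ₁.gam.symm) _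
  have h₅ : ∀ v, lam (Ri Q π₁ (QuantumD.gam φ) v) = Ri Q a' g (lam v) :=
    pair_apply_intertwine (hl.aR hπ₁) (hl.apply_comm hφ₁.gam.symm) _
  have h₆ : ∀ v, lam (dbl Q π₂ (QuantumD.gam φ) v) = dbl Q p₂ g (lam v) :=
    dbl_apply_intertwine (hl.apply_comm h.symm) (hl.apply_comm hφ₁.gam.symm)
  have h₇ : Ri Q π₁ π₂ (actA φ (lam (Ri Q π₁ (QuantumD.gam φ) (dbl Q π₂ (QuantumD.gam φ)
      (Rm Q π₁ (QuantumD.gam φ) v))))) = actA φ (Ri Q p₁ p₂ (lam (Ri Q π₁ (QuantumD.gam φ)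
        (dbl Q π₂ (QuantumD.gam φ) (Rm Q π₁ (QuantumD.gam φ) v))))) :=
    (pair_apply_intertwine hφ₁.actA hφ₂.actA _ _).symm
  rw [h₁, ← Ri_Rm_apply (Q := Q) ha' hg ha'g (Rm Q p₂ p₁ (lam v)), h₂, h₇,
    ← hl.Rm_aL hπ₁ hp₂ hap₂ hp, h₅, h₆, h₄, dbl_cv_right hp₂ hp₂g hag]
  congr 1
  have e₁ := LinearMap.congr_fun hc.eq (Rm Q p₂ p₁ (lam v))
  have e₂ := LinearMap.congr_fun hc₂.eq (dbl Q p₂ g (Rm Q a' g (lam v)))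
  simp only [Module.End.mul_apply] at e₁ e₂ ⊢
  rw [← e₁, h₃, e₂]

/-- The relation `X₁ Y₂ = Y₂ X₁ T₁²`, before the flips of the tensor factors. -/
theorem IsCoact.cross {π₁ π₂ : U →ₗ[k] Module.End k H} {lam : H →ₗ[k] FT k U H}
    (hl : IsCoact π₁ lam) (hπ₁ : IsRep π₁) (hπ₂ : IsRep π₂) (h : Comm π₁ π₂)
    (hφ₁ : CommD φ π₁) (hφ₂ : CommD φ π₂) (v : H) :
    Rm Q π₁ π₂ (dbl Q π₂ (QuantumD.gam φ) (Rm Q π₂ π₁ (actA φ (lam (Rm Q π₁ π₂ v))))) =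
      actA φ (lam (Rm Q π₁ π₂ (dbl Q π₂ (QuantumD.gam φ) v))) := by
  rw [hl.dbl_Rm_actA hπ₁ hπ₂ h hφ₁ hφ₂, Rm_Ri_apply hπ₁ hπ₂ h]
  congr 2
  exact LinearMap.congr_fun (dbl_yangBaxter hπ₁ hπ₂ (isRep_gam φ) h hφ₁.gam hφ₂.gam) v

/-- Evaluation at `g` produces `∑ π(r⁺) π(S(r⁻)) π(g)`, and `∑ r⁺ S(r⁻) = S(u)`. -/
theorem IsCoact.Rm_lT_aL {π : U →ₗ[k] Module.End k H} {lam : H →ₗ[k] FT k U H}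
    (hl : IsCoact π lam) (hπ : IsRep π) (v : H) :
    Rm Q (QuantumD.lT k U π) (QuantumD.aL k U H) (lam v) =
      QuantumD.lT k U π (drinfeldS Q) (lam v) := by
  refine ev_injective fun g => ?_
  rw [Rm, drinfeldS, ev_lT, hl]
  generalize (Q.R : U ⊗[k] U) = t
  induction t with
  | zero => simp
  | add a b ha hb => simp only [map_add, LinearMap.add_apply, ha, hb]
  | tmul a b => simp [ev_lT, ev_aL, hl _ v, hπ.map_mul]

/-- Compares `L` with its analogue for `hatA`, whose inverse is easy to write down. The difference
consists of R-matrices between `π` and `∂_◁` and of `S(u)` acting on the factor of `π`. -/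
theorem IsCoact.actA_eq {π : U →ₗ[k] Module.End k H} {lam : H →ₗ[k] FT k U H}
    (hl : IsCoact π lam) (hπ : IsRep π) (hφ : CommD φ π) :
    actA φ ∘ₗ lam = Ri Q π (QuantumD.gam φ) * π (drinfeldS Q) * (QuantumD.hatA φ ∘ₗ lam) *
      Rm Q π (QuantumD.gam φ) := by
  ext1 v
  let p := QuantumD.lT k U π
  let g := QuantumD.lT k U (QuantumD.gam φ)
  let a := QuantumD.aL k U H
  let a' := QuantumD.aR k U H
  have ha : IsRep a := isRep_aL
  have hg : IsRep g := (isRep_gam φ).lT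
  have hp : IsRep p := hπ.lT
  have hag : Comm a g := comm_aL_lT _
  have hap : Comm a p := comm_aL_lT _
  have ha'g : Comm a' g := comm_aR_lT _
  have hpg : Comm p g := hφ.gam.lT
  have h₄ : ∀ v, lam (Rm Q π (QuantumD.gam φ) v) = Rm Q a' g (lam v) :=
    pair_apply_intertwine (hl.aR hπ) (hl.apply_comm hφ.gam.symm) _
  have h₅ : ∀ t, QuantumD.hatA φ (Ri Q p (cv g a) t) = Ri Q π (QuantumD.gam φ) (QuantumD.hatA φ t) :=
    pair_apply_intertwine hφ.hatA (fun x v => (gam_hatA φ x v).symm) _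
  have h₆ : ∀ t, Ri Q p g t = Ri Q p (cv g a) (Rm Q p a t) := fun t => by
    rw [Ri_cv_right Q hp hg ha hpg hap.symm hag.symm, Module.End.mul_apply,
      Ri_Rm_apply hp ha hap.symm]
  simp only [LinearMap.comp_apply, Module.End.mul_apply]
  rw [← hatA_Rm, aLR, Rm_cv_left Q hg ha'g, Module.End.mul_apply, ← h₄,
    hl.Rm_aL hπ hg hag hpg, h₆, h₅, hl.Rm_lT_aL hπ, hφ.hatA]

/-- Since `hatA` is multiplicative for the undeformed product, convolution-inverse maps give inverse
operators. Multiplicativity of `π₁` and `π₂` is not needed, so one of them can be `π ∘ S`. -/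
theorem IsCoact.hatA_hatA {π₁ π₂ : U →ₗ[k] Module.End k H} {lam₁ lam₂ : H →ₗ[k] FT k U H}
    {lam₁' : FT k U H →ₗ[k] FT k U (FT k U H)} (hl₁ : IsCoact π₁ lam₁) (hl₂ : IsCoact π₂ lam₂)
    (hl' : IsCoact (QuantumD.lT k U π₁) lam₁') (hφ₁ : CommD φ π₁) (h : cv π₁ π₂ = eps k U _) :
    (QuantumD.hatA φ ∘ₗ lam₁) * (QuantumD.hatA φ ∘ₗ lam₂) = 1 := by
  ext1 v
  rw [Module.End.mul_apply, LinearMap.comp_apply, LinearMap.comp_apply,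
    hl'.natural hl₁ hφ₁.hatA, QuantumD.hatA_hatA, Module.End.one_apply]
  have : QuantumD.mulT k U H (lam₁' (lam₂ v)) = oneF k U ⊗ₜ v := ev_injective fun g => by
    have := hl₂.mulT_comp hl' g v
    rw [h] at this
    exact this.trans (by simp [oneF, Module.algebraMap_end_apply])
  rw [this, hatA_oneF]

theorem IsCoact.isUnit_actA {π : U →ₗ[k] Module.End k H} {lam lamS : H →ₗ[k] FT k U H}
    {lam' lamS' : FT k U H →ₗ[k] FT k U (FT k U H)}
    (hl : IsCoact π lam) (hl' : IsCoact (QuantumD.lT k U π) lam')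
    (hlS : IsCoact (π ∘ₗ HopfAlgebra.antipode k) lamS)
    (hlS' : IsCoact (QuantumD.lT k U (π ∘ₗ HopfAlgebra.antipode k)) lamS')
    (hπ : IsRep π) (hφ : CommD φ π) (hu : IsUnit (drinfeldS Q)) :
    IsUnit (actA φ ∘ₗ lam : Module.End k H) := by
  rw [hl.actA_eq hπ hφ]
  have h₁ := hl.hatA_hatA hlS hl' hφ (cv_antipode hπ)
  have h₂ := hlS.hatA_hatA hl hlS' (fun x => hφ _) (antipode_cv hπ)
  have hu' : IsUnit (π (drinfeldS Q)) := hu.map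
    ({ toFun := π, map_one' := hπ.map_one, map_mul' := hπ.map_mul } : U →* Module.End k H)
  have hR₁ := Rm_mul_Ri Q hπ (isRep_gam φ) hφ.gam
  have hR₂ := Ri_mul_Rm Q hπ (isRep_gam φ) hφ.gam
  exact (((IsUnit.mul ⟨⟨_, _, hR₂, hR₁⟩, rfl⟩ hu').mul ⟨⟨_, _, h₁, h₂⟩, rfl⟩)).mul
    ⟨⟨_, _, hR₁, hR₂⟩, rfl⟩

end Coaction

/-! ### Jucys-Murphy elements and the affine braid relations. -/

section AffineBraid

variable {G : Type*} [Monoid G] (T : ℕ → G) (x₀ : G)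

/-- The elements `X_{i+1} = T_i X_i T_i`. -/
def jucysMurphy : ℕ → G
  | 0 => x₀
  | i + 1 => T i * jucysMurphy i * T i

variable {T x₀} {m : ℕ}

/-- Here `m` counts the generators `T 0, …, T (m - 1)`, so the elements `X` have indices `0, …, m`.
For `n` strands, `m = n - 1`. -/
theorem commute_jucysMurphy_of_lt
    (far : ∀ i j, i + 2 ≤ j → j < m → Commute (T i) (T j))
    (h₀ : ∀ j, 0 < j → j < m → Commute (T j) x₀) {i j : ℕ} (hij : i < j) (hj : j < m) :
    Commute (T j) (jucysMurphy T x₀ i) := by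
  induction i with
  | zero => exact h₀ j hij hj
  | succ i ih =>
    have h := (far i j hij hj).symm
    exact (h.mul_right (ih (by omega))).mul_right h

/-- For `i = j + 2`, `T j` passes through `T (j + 1) * T j * X * T j * T (j + 1)` by one braid
relation on each side of `X`, where `X` has index `j` and commutes with `T (j + 1)`. Larger `i` only
adds far generators. -/
theorem commute_jucysMurphy_of_gt
    (braid : ∀ i, i + 1 < m → T i * T (i + 1) * T i = T (i + 1) * T i * T (i + 1))
    (far : ∀ i j, i + 2 ≤ j → j < m → Commute (T i) (T j))
    (h₀ : ∀ j, 0 < j → j < m → Commute (T j) x₀) {i j : ℕ} (hij : j + 2 ≤ i) (hi : i ≤ m) :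
    Commute (T j) (jucysMurphy T x₀ i) := by
  induction i, hij using Nat.le_induction with
  | base =>
    have h := commute_jucysMurphy_of_lt far h₀ (Nat.lt_succ_self j) (by omega : j + 1 < m)
    have b := braid j (by omega)
    change T j * (T (j + 1) * (T j * jucysMurphy T x₀ j * T j) * T (j + 1)) =
      (T (j + 1) * (T j * jucysMurphy T x₀ j * T j) * T (j + 1)) * T j
    calc _ = T j * T (j + 1) * T j * jucysMurphy T x₀ j * T j * T (j + 1) := by
          simp only [mul_assoc]
      _ = T (j + 1) * T j * (T (j + 1) * jucysMurphy T x₀ j) * T j * T (j + 1) := by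
          rw [b]; simp only [mul_assoc]
      _ = T (j + 1) * T j * jucysMurphy T x₀ j * (T (j + 1) * T j * T (j + 1)) := by
          rw [h.eq]; simp only [mul_assoc]
      _ = _ := by rw [← b]; simp only [mul_assoc]
  | succ i hi' ih =>
    have h := far j i hi' (by omega)
    exact (h.mul_right (ih (by omega))).mul_right h

/-- In the inductive step the element of index `j + 2` commutes with `T j` and with the element of
index `j`, hence with `T j * X * T j`. The base is the hypothesis `h₁`, later the reflection
equation or its analogue for `Y`. -/
theorem commute_jucysMurphy_succ
    (braid : ∀ i, i + 1 < m → T i * T (i + 1) * T i = T (i + 1) * T i * T (i + 1))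
    (far : ∀ i j, i + 2 ≤ j → j < m → Commute (T i) (T j))
    (h₀ : ∀ j, 0 < j → j < m → Commute (T j) x₀)
    (h₁ : 0 < m → Commute x₀ (T 0 * x₀ * T 0)) {j : ℕ} (hj : j < m) :
    Commute (jucysMurphy T x₀ j) (jucysMurphy T x₀ (j + 1)) := by
  induction j with
  | zero => exact h₁ hj
  | succ j ih =>
    have hT := commute_jucysMurphy_of_gt braid far h₀ (le_refl (j + 2)) hj
    have hX : Commute (jucysMurphy T x₀ j) (jucysMurphy T x₀ (j + 2)) := by
      have h := (commute_jucysMurphy_of_lt far h₀ (Nat.lt_succ_self j) hj).symm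
      exact (h.mul_right (ih (by omega))).mul_right h
    exact (hT.mul_left hX).mul_left hT

theorem commute_jucysMurphy_jucysMurphy
    (braid : ∀ i, i + 1 < m → T i * T (i + 1) * T i = T (i + 1) * T i * T (i + 1))
    (far : ∀ i j, i + 2 ≤ j → j < m → Commute (T i) (T j))
    (h₀ : ∀ j, 0 < j → j < m → Commute (T j) x₀)
    (h₁ : 0 < m → Commute x₀ (T 0 * x₀ * T 0)) {i j : ℕ} (hi : i ≤ m) (hj : j ≤ m) :
    Commute (jucysMurphy T x₀ i) (jucysMurphy T x₀ j) := by
  have key : ∀ j i, i < j → j ≤ m → Commute (jucysMurphy T x₀ i) (jucysMurphy T x₀ j) := by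
    intro j
    induction j with
    | zero => intro i hi; omega
    | succ j ih =>
      intro i hi hj
      obtain h | rfl := Nat.lt_succ_iff_lt_or_eq.1 hi
      · have h' := (commute_jucysMurphy_of_lt far h₀ h hj).symm
        exact (h'.mul_right (ih i h (by omega))).mul_right h'
      · exact commute_jucysMurphy_succ braid far h₀ h₁ hj
  obtain h | rfl | h := lt_trichotomy i j
  · exact key j i h hj
  · exact Commute.refl _
  · exact (key i j h hi).symm

end AffineBraid

/-! ### Braid generators and double braidings on a chain of commuting actions. -/

section Chain

variable {k : Type w} [Field k] {U : Type u} [Ring U] [HopfAlgebra k U]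

theorem semiconjBy_pair {X Y E : Type*} [AddCommMonoid X] [Module k X] [AddCommMonoid Y]
    [Module k Y] [Ring E] [Algebra k E] {f₁ f₂ : X →ₗ[k] E} {g₁ g₂ : Y →ₗ[k] E} {e : E}
    (hf : ∀ x, SemiconjBy e (f₁ x) (f₂ x)) (hg : ∀ y, SemiconjBy e (g₁ y) (g₂ y)) (t : X ⊗[k] Y) :
    SemiconjBy e (pair f₁ g₁ t) (pair f₂ g₂ t) := by
  induction t with
  | zero => simp
  | add a b ha hb => rw [map_add, map_add]; exact ha.add_right hb
  | tmul a b => rw [pair_tmul, pair_tmul]; exact (hf a).mul_right (hg b)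

section

variable {E : Type*} [Ring E] [Algebra k E] {f₁ f₂ g₁ g₂ : U →ₗ[k] E} {e : E}
variable {Q : QuasitriangularStructure k U}

theorem semiconjBy_cv (hf : ∀ x, SemiconjBy e (f₁ x) (f₂ x))
    (hg : ∀ y, SemiconjBy e (g₁ y) (g₂ y)) (x : U) : SemiconjBy e (cv f₁ g₁ x) (cv f₂ g₂ x) := by
  rw [cv_apply, cv_apply]
  exact semiconjBy_pair hf hg _

theorem semiconjBy_Rm (hf : ∀ x, SemiconjBy e (f₁ x) (f₂ x))
    (hg : ∀ y, SemiconjBy e (g₁ y) (g₂ y)) : SemiconjBy e (Rm Q f₁ g₁) (Rm Q f₂ g₂) :=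
  semiconjBy_pair hf hg _

theorem semiconjBy_dbl (hf : ∀ x, SemiconjBy e (f₁ x) (f₂ x))
    (hg : ∀ y, SemiconjBy e (g₁ y) (g₂ y)) : SemiconjBy e (dbl Q f₁ g₁) (dbl Q f₂ g₂) :=
  (semiconjBy_Rm hg hf).mul_right (semiconjBy_Rm hf hg)

theorem dbl_mul_cv (hf : IsRep f₁) (hg : IsRep g₁) (h : Comm f₁ g₁) (x : U) :
    Commute (dbl Q f₁ g₁) (cv f₁ g₁ x) := by
  rw [Commute, SemiconjBy, dbl, mul_assoc, Rm_mul_cv Q hf hg h, ← mul_assoc,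
    Rm_mul_cv Q hg hf h.symm, mul_assoc]

theorem pair_R21_mul_R (hf : IsRep f₁) (hg : IsRep g₁) (h : Comm f₁ g₁) :
    pair f₁ g₁ (Q.R21 * (Q.R : U ⊗[k] U)) = dbl Q f₁ g₁ := by
  rw [IsRep.pair_mul hf hg h, dbl, Rm, Rm, QuasitriangularStructure.R21, h.pair_swap,
    TensorProduct.comm_comm]

theorem dbl_mul_cv_ν (𝓡 : RibbonStructure k U) (hf : IsRep f₁) (hg : IsRep g₁) (h : Comm f₁ g₁) :
    dbl 𝓡.toQuasitriangularStructure f₁ g₁ * cv f₁ g₁ 𝓡.ν = f₁ 𝓡.ν * g₁ 𝓡.ν := by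
  rw [← pair_R21_mul_R hf hg h, cv_apply, ← IsRep.pair_mul hf hg h, 𝓡.comul_ν, pair_tmul]

end

variable {H : Type*} [AddCommGroup H] [Module k H]
variable {Q : QuasitriangularStructure k U} {φ : DU Q →ₐ[k] Module.End k H}

theorem IsCoact.semiconjBy {π₁ π₂ : U →ₗ[k] Module.End k H} {lam₁ lam₂ : H →ₗ[k] FT k U H} (hl₁ : IsCoact π₁ lam₁)
    (hl₂ : IsCoact π₂ lam₂) {e : Module.End k H} (he : ∀ x, SemiconjBy e (π₁ x) (π₂ x))
    (hφ : ∀ d, Commute e (φ d)) :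
    SemiconjBy e (QuantumD.actA φ ∘ₗ lam₁ : Module.End k H) (QuantumD.actA φ ∘ₗ lam₂) := by
  ext1 v
  -- `CommD` concerns linear families of operators, so `e` is viewed as the family `c ↦ c • e` and
  -- used at `c = 1`.
  have h : CommD φ (LinearMap.toSpanSingleton k (Module.End k H) e) := fun c d => by
    rw [LinearMap.toSpanSingleton_apply]
    exact (hφ d).smul_left c
  have h₁ := hl₁.natural hl₂ (fun x v => LinearMap.congr_fun (he x).eq v) v
  have h₂ := h.actA 1 (lam₁ v)
  rw [LinearMap.toSpanSingleton_apply, one_smul] at h₂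
  simp only [Module.End.mul_apply, LinearMap.comp_apply]
  rw [h₁, ← h₂]
  exact congrArg (fun e => QuantumD.actA φ (LinearMap.lTensor _ e (lam₁ v))) (one_smul k e)

/-- Commuting actions `p i` of `U`, which commute with an action of `D_U`, and flips `s i` which
exchange the actions `p i` and `p (i + 1)`. -/
structure IsChain (φ : DU Q →ₐ[k] Module.End k H) (n : ℕ) (p : ℕ → U →ₗ[k] Module.End k H)
    (s : ℕ → Module.End k H) : Prop where
  rep (i) : IsRep (p i)
  comm (i j) (h : i ≠ j) : Comm (p i) (p j)
  commD (i) : CommD φ (p i)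
  flip_commD (i) (h : i + 1 < n) (d) : Commute (s i) (φ d)
  flip (i) (h : i + 1 < n) (j x) : SemiconjBy (s i) (p j x) (p (Equiv.swap i (i + 1) j) x)
  flip_sq (i) (h : i + 1 < n) : s i * s i = 1
  flip_braid (i) (h : i + 2 < n) : s i * s (i + 1) * s i = s (i + 1) * s i * s (i + 1)
  flip_far (i j) (h : i + 2 ≤ j) (hj : j + 1 < n) : Commute (s i) (s j)

variable (φ) in
/-- The action of `U` on the factors `0, …, m` through the coproduct. -/
def lact (p : ℕ → U →ₗ[k] Module.End k H) : ℕ → U →ₗ[k] Module.End k H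
  | 0 => gam φ
  | m + 1 => cv (p m) (lact p m)

variable (Q) in
/-- The braiding of the factors `i + 1` and `i`. -/
def braidOp (p : ℕ → U →ₗ[k] Module.End k H) (s : ℕ → Module.End k H) (i : ℕ) : Module.End k H :=
  s i * Rm Q (p (i + 1)) (p i)

namespace IsChain

variable {n : ℕ} {p : ℕ → U →ₗ[k] Module.End k H} {s : ℕ → Module.End k H}

theorem flip_left (c : IsChain φ n p s) {i : ℕ} (h : i + 1 < n) (x) :
    SemiconjBy (s i) (p i x) (p (i + 1) x) := by
  simpa using c.flip i h i x

theorem flip_right (c : IsChain φ n p s) {i : ℕ} (h : i + 1 < n) (x) :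
    SemiconjBy (s i) (p (i + 1) x) (p i x) := by
  simpa using c.flip i h (i + 1) x

theorem flip_of_ne (c : IsChain φ n p s) {i j : ℕ} (h : i + 1 < n) (h₁ : j ≠ i) (h₂ : j ≠ i + 1)
    (x) : Commute (s i) (p j x) := by
  have h' := c.flip i h j x
  rwa [Equiv.swap_apply_of_ne_of_ne h₁ h₂] at h'

theorem comm_lact (c : IsChain φ n p s) {m j : ℕ} (h : m ≤ j) : Comm (p j) (lact φ p m) := by
  induction m with
  | zero => exact (c.commD j).gam
  | succ m ih => exact (c.comm j m (by omega)).cv_right (ih (by omega))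

theorem rep_lact (c : IsChain φ n p s) (m : ℕ) : IsRep (lact φ p m) := by
  induction m with
  | zero => exact isRep_gam φ
  | succ m ih => exact (c.rep m).cv ih (c.comm_lact le_rfl)

theorem commute_lact {e : Module.End k H} {i m : ℕ} (h₀ : ∀ x, Commute e (lact φ p i x))
    (h : ∀ j, i ≤ j → j < m → ∀ x, Commute e (p j x)) (him : i ≤ m) (x : U) :
    Commute e (lact φ p m x) := by
  induction m, him using Nat.le_induction generalizing x with
  | base => exact h₀ x
  | succ m hm ih =>
    exact semiconjBy_cv (h m hm (Nat.lt_succ_self m))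
      (ih fun j hj hjm => h j hj (by omega)) x

theorem braidOp_flip (c : IsChain φ n p s) {i : ℕ} (h : i + 1 < n) :
    braidOp Q p s i = Rm Q (p i) (p (i + 1)) * s i :=
  (semiconjBy_Rm (c.flip_right h) (c.flip_left h)).eq

theorem isUnit_flip (c : IsChain φ n p s) {i : ℕ} (h : i + 1 < n) : IsUnit (s i) :=
  ⟨⟨_, _, c.flip_sq i h, c.flip_sq i h⟩, rfl⟩

theorem isUnit_braidOp (c : IsChain φ n p s) {i : ℕ} (h : i + 1 < n) : IsUnit (braidOp Q p s i) := by
  have hc := c.comm (i + 1) i (by omega)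
  exact (c.isUnit_flip h).mul
    ⟨⟨_, _, Rm_mul_Ri Q (c.rep _) (c.rep _) hc, Ri_mul_Rm Q (c.rep _) (c.rep _) hc⟩, rfl⟩

theorem braidOp_commute {i : ℕ} {e : Module.End k H}
    (hs : Commute (s i) e) (h₁ : ∀ x, Commute (p i x) e) (h₂ : ∀ x, Commute (p (i + 1) x) e) :
    Commute (braidOp Q p s i) e :=
  hs.mul_left (Rm_commute Q h₂ h₁)

theorem braidOp_commD (c : IsChain φ n p s) {i : ℕ} (h : i + 1 < n) (d) :
    Commute (braidOp Q p s i) (φ d) :=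
  braidOp_commute (c.flip_commD i h d) (fun x => c.commD _ x d) (fun x => c.commD _ x d)

theorem braidOp_comm_p (c : IsChain φ n p s) {i j : ℕ} (h : i + 1 < n) (h₁ : j ≠ i)
    (h₂ : j ≠ i + 1) (x) : Commute (braidOp Q p s i) (p j x) :=
  braidOp_commute (c.flip_of_ne h h₁ h₂ x) (fun y => c.comm _ _ h₁.symm y x)
    (fun y => c.comm _ _ h₂.symm y x)

/-- All flips are moved to the left. What remains is the braid relation of the flips and the
Yang-Baxter equation for three adjacent factors. -/
theorem braidOp_braid (c : IsChain φ n p s) {i : ℕ} (h : i + 2 < n) :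
    braidOp Q p s i * braidOp Q p s (i + 1) * braidOp Q p s i =
      braidOp Q p s (i + 1) * braidOp Q p s i * braidOp Q p s (i + 1) := by
  have h' : i + 1 < n := by omega
  have y := Rm_yangBaxter Q (c.rep (i + 2)) (c.rep (i + 1)) (c.rep i) (c.comm _ _ (by omega))
    (c.comm _ _ (by omega)) (c.comm _ _ (by omega))
  have a₁ : s (i + 1) * Rm Q (p (i + 2)) (p i) = Rm Q (p (i + 1)) (p i) * s (i + 1) :=
    semiconjBy_Rm (c.flip_right (i := i + 1) h) (c.flip_of_ne (i := i + 1) h (by omega) (by omega))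
  have a₂ : s i * Rm Q (p (i + 2)) (p (i + 1)) = Rm Q (p (i + 2)) (p i) * s i :=
    semiconjBy_Rm (c.flip_of_ne h' (by omega) (by omega)) (c.flip_right h')
  have a₃ : s i * Rm Q (p (i + 2)) (p i) = Rm Q (p (i + 2)) (p (i + 1)) * s i :=
    semiconjBy_Rm (c.flip_of_ne h' (by omega) (by omega)) (c.flip_left h')
  have a₄ : s (i + 1) * Rm Q (p (i + 1)) (p i) = Rm Q (p (i + 2)) (p i) * s (i + 1) :=
    semiconjBy_Rm (c.flip_left (i := i + 1) h) (c.flip_of_ne (i := i + 1) h (by omega) (by omega))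
  change s i * Rm Q (p (i + 1)) (p i) * (s (i + 1) * Rm Q (p (i + 2)) (p (i + 1))) *
      (s i * Rm Q (p (i + 1)) (p i)) = s (i + 1) * Rm Q (p (i + 2)) (p (i + 1)) *
      (s i * Rm Q (p (i + 1)) (p i)) * (s (i + 1) * Rm Q (p (i + 2)) (p (i + 1)))
  calc _ = s i * (Rm Q (p (i + 1)) (p i) * s (i + 1)) * (Rm Q (p (i + 2)) (p (i + 1)) * s i) *
          Rm Q (p (i + 1)) (p i) := by simp only [mul_assoc]
    _ = s i * s (i + 1) * (Rm Q (p (i + 2)) (p i) * s i) * Rm Q (p (i + 2)) (p i) *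
          Rm Q (p (i + 1)) (p i) := by rw [← a₁, ← a₃]; simp only [mul_assoc]
    _ = s i * s (i + 1) * s i * (Rm Q (p (i + 2)) (p (i + 1)) * Rm Q (p (i + 2)) (p i) *
          Rm Q (p (i + 1)) (p i)) := by rw [← a₂]; simp only [mul_assoc]
    _ = s (i + 1) * s i * (s (i + 1) * Rm Q (p (i + 1)) (p i)) * Rm Q (p (i + 2)) (p i) *
          Rm Q (p (i + 2)) (p (i + 1)) := by
        rw [y, c.flip_braid i h]; simp only [mul_assoc]
    _ = s (i + 1) * (s i * Rm Q (p (i + 2)) (p i)) * (s (i + 1) * Rm Q (p (i + 2)) (p i)) *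
          Rm Q (p (i + 2)) (p (i + 1)) := by rw [a₄]; simp only [mul_assoc]
    _ = _ := by rw [a₁, a₃]; simp only [mul_assoc]

theorem braidOp_far (c : IsChain φ n p s) {i j : ℕ} (h : i + 2 ≤ j) (hj : j + 1 < n) :
    Commute (braidOp Q p s i) (braidOp Q p s j) :=
  braidOp_commute
    ((c.flip_far i j h hj).mul_right (Rm_commute Q
      (fun x => (c.flip_of_ne (by omega) (by omega) (by omega) x).symm)
      (fun x => (c.flip_of_ne (by omega) (by omega) (by omega) x).symm)).symm)
    (fun x => (c.braidOp_comm_p hj (by omega) (by omega) x).symm)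
    (fun x => (c.braidOp_comm_p hj (by omega) (by omega) x).symm)

/-- The R-matrix reverses the convolution of the two factors and the flip restores it; all other
factors are untouched. -/
theorem braidOp_comm_lact (c : IsChain φ n p s) {i m : ℕ} (h : i + 1 < n) (hm : i + 2 ≤ m) (x) :
    Commute (braidOp Q p s i) (lact φ p m x) := by
  refine commute_lact (i := i + 2) (fun x => ?_)
    (fun j hj _ => c.braidOp_comm_p h (by omega) (by omega)) hm x
  change Commute _ (cv (p (i + 1)) (cv (p i) (lact φ p i)) x)
  rw [← cv_assoc]
  refine semiconjBy_cv (fun x => ?_) (fun y => commute_lact (i := 0) (fun x => c.braidOp_commD h _)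
    (fun j _ hj => c.braidOp_comm_p h (by omega) (by omega)) (Nat.zero_le i) y) x
  rw [SemiconjBy, braidOp, mul_assoc,
    Rm_mul_cv Q (c.rep _) (c.rep _) (c.comm _ _ (by omega)), ← mul_assoc,
    (semiconjBy_cv (c.flip_left h) (c.flip_right h) x).eq, mul_assoc]

/-- The double braidings `Y_k`. -/
theorem jucysMurphy_dbl (c : IsChain φ n p s) {m : ℕ} (h : m < n) :
    jucysMurphy (braidOp Q p s) (dbl Q (p 0) (gam φ)) m = dbl Q (p m) (lact φ p m) := by
  induction m with
  | zero => rfl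
  | succ m ih =>
    rw [jucysMurphy, ih (by omega), lact, dbl_cv_right (c.rep _) (c.comm_lact (by omega))
      (c.comm_lact le_rfl)]
    -- The flip carries the double braiding of factor `m` to factor `m + 1`, after which `T Y T` has
    -- the shape given by `dbl_cv_right`.
    have h₁ : s m * dbl Q (p m) (lact φ p m) = dbl Q (p (m + 1)) (lact φ p m) * s m :=
      semiconjBy_dbl (c.flip_left h) (fun x => commute_lact (i := 0) (fun x => c.flip_commD m h _)
        (fun j _ hj => c.flip_of_ne h (by omega) (by omega)) (Nat.zero_le m) x)
    rw [c.braidOp_flip h]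
    calc _ = Rm Q (p m) (p (m + 1)) * (s m * dbl Q (p m) (lact φ p m)) *
          (Rm Q (p m) (p (m + 1)) * s m) := by simp only [mul_assoc]
      _ = _ := by
        rw [h₁, ← c.braidOp_flip h, braidOp, mul_assoc _ _ (s m * _), mul_assoc _ (s m) (s m * _),
          ← mul_assoc (s m) (s m), c.flip_sq m h, one_mul, mul_assoc]

theorem braidOp_comm_Y (c : IsChain φ n p s) {j : ℕ} (h₀ : 0 < j) (h : j + 1 < n) :
    Commute (braidOp Q p s j) (dbl Q (p 0) (gam φ)) :=
  semiconjBy_dbl (c.braidOp_comm_p h (by omega) (by omega)) fun x => c.braidOp_commD h _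

/-- `Y₂` is the double braiding of `V₂` with `V₁ ⊗ M`, and `Y₁` commutes with the action of `U` on
`V₁ ⊗ M`. -/
theorem commute_Y_Y (c : IsChain φ n p s) (h : 1 < n) :
    Commute (dbl Q (p 0) (gam φ)) (braidOp Q p s 0 * dbl Q (p 0) (gam φ) * braidOp Q p s 0) := by
  change Commute _ (jucysMurphy (braidOp Q p s) (dbl Q (p 0) (gam φ)) 1)
  rw [c.jucysMurphy_dbl h]
  refine semiconjBy_dbl (fun x => ?_)
    (dbl_mul_cv (c.rep 0) (isRep_gam φ) (c.commD 0).gam)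
  exact (semiconjBy_dbl (fun y => c.comm 1 0 (by omega) x y)
    (fun y => (c.commD 1).gam x y)).symm

theorem isUnit_Y (c : IsChain φ n p s) : IsUnit (dbl Q (p 0) (gam φ)) := by
  have h := (c.commD 0).gam
  have hp := c.rep 0
  have hg := isRep_gam φ
  exact IsUnit.mul ⟨⟨_, _, Rm_mul_Ri Q hg hp h.symm, Ri_mul_Rm Q hg hp h.symm⟩, rfl⟩
    ⟨⟨_, _, Rm_mul_Ri Q hp hg h, Ri_mul_Rm Q hp hg h⟩, rfl⟩

end IsChain

end Chain

/-! ### The relations involving `X`, the adjoint action and the ribbon element. -/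

section ChainRelations

variable {k : Type w} [Field k] {U : Type u} [Ring U] [HopfAlgebra k U]
variable {H : Type*} [AddCommGroup H] [Module k H]
variable {Q : QuasitriangularStructure k U} {φ : DU Q →ₐ[k] Module.End k H}

/-- An action of `U` which comes from coactions of `F`, also on `F ⊗ H`. -/
def HasCoact (π : U →ₗ[k] Module.End k H) : Prop :=
  (∃ lam, IsCoact π lam) ∧ ∃ lam', IsCoact (lT k U π) lam'

theorem IsCoact.isUnit_actA_of_hasCoact {π : U →ₗ[k] Module.End k H} {lam : H →ₗ[k] FT k U H}
    (hl : IsCoact π lam) (h : HasCoact π) (hS : HasCoact (π ∘ₗ HopfAlgebra.antipode k))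
    (hπ : IsRep π) (hφ : CommD φ π) (hu : IsUnit (drinfeldS Q)) :
    IsUnit (QuantumD.actA φ ∘ₗ lam : Module.End k H) := by
  obtain ⟨_, lam', hl'⟩ := h
  obtain ⟨⟨lamS, hlS⟩, lamS', hlS'⟩ := hS
  exact hl.isUnit_actA hl' hlS hlS' hπ hφ hu

namespace IsChain

variable {n : ℕ} {p : ℕ → U →ₗ[k] Module.End k H} {s : ℕ → Module.End k H}
variable {lam lam₁ : H →ₗ[k] FT k U H}

theorem braidOp_comm_X (c : IsChain φ n p s) (hl : IsCoact (p 0) lam) {j : ℕ} (h₀ : 0 < j)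
    (h : j + 1 < n) : Commute (braidOp Q p s j) (actA φ ∘ₗ lam : Module.End k H) :=
  hl.semiconjBy hl (c.braidOp_comm_p h (by omega) (by omega)) (c.braidOp_commD h)

/-- Cancelling the two flips turns `T X₁ T` into `R₁₂ L₂ R₂₁`, and the claim into the reflection
equation. -/
theorem commute_X_X (c : IsChain φ n p s) (hl : IsCoact (p 0) lam) (h₀ : HasCoact (p 0))
    (h₁ : HasCoact (p 1)) (h : 1 < n) :
    Commute (actA φ ∘ₗ lam : Module.End k H)
      (braidOp Q p s 0 * (actA φ ∘ₗ lam : Module.End k H) * braidOp Q p s 0) := by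
  obtain ⟨_, lam', hl'⟩ := h₀
  obtain ⟨⟨lam₁, hl₁⟩, lam₁', hl₁'⟩ := h₁
  have hr : (actA φ ∘ₗ lam : Module.End k H) * Rm Q (p 0) (p 1) *
      (actA φ ∘ₗ lam₁ : Module.End k H) * Rm Q (p 1) (p 0) =
      Rm Q (p 0) (p 1) * (actA φ ∘ₗ lam₁ : Module.End k H) * Rm Q (p 1) (p 0) *
        (actA φ ∘ₗ lam : Module.End k H) :=
    LinearMap.ext fun v => hl.reflection hl₁ hl' hl₁' (c.rep 0) (c.rep 1) (c.comm _ _ zero_ne_one)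
      (c.commD 0) (c.commD 1) v
  have hs : s 0 * (actA φ ∘ₗ lam : Module.End k H) = (actA φ ∘ₗ lam₁ : Module.End k H) * s 0 :=
    hl.semiconjBy hl₁ (c.flip_left h) (c.flip_commD 0 h)
  have hT : braidOp Q p s 0 * (actA φ ∘ₗ lam : Module.End k H) * braidOp Q p s 0 =
      Rm Q (p 0) (p 1) * (actA φ ∘ₗ lam₁ : Module.End k H) * Rm Q (p 1) (p 0) := by
    conv_lhs => enter [1]; rw [c.braidOp_flip h, mul_assoc, hs]
    rw [braidOp, mul_assoc, mul_assoc _ (s 0), ← mul_assoc (s 0) (s 0), c.flip_sq 0 h, one_mul, mul_assoc]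
  rw [hT, Commute, SemiconjBy, ← hr]
  simp only [mul_assoc]

theorem X_mul_Y (c : IsChain φ n p s) (hl : IsCoact (p 0) lam) (h : 1 < n) :
    (actA φ ∘ₗ lam : Module.End k H) * dbl Q (p 1) (lact φ p 1) =
      dbl Q (p 1) (lact φ p 1) * (actA φ ∘ₗ lam : Module.End k H) * braidOp Q p s 0 *
        braidOp Q p s 0 := by
  have hr : Rm Q (p 0) (p 1) * dbl Q (p 1) (gam φ) * Rm Q (p 1) (p 0) *
      (actA φ ∘ₗ lam : Module.End k H) * Rm Q (p 0) (p 1) =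
      (actA φ ∘ₗ lam : Module.End k H) * Rm Q (p 0) (p 1) * dbl Q (p 1) (gam φ) :=
    LinearMap.ext fun v => hl.cross (c.rep 0) (c.rep 1) (c.comm _ _ zero_ne_one)
      (c.commD 0) (c.commD 1) v
  have hT : braidOp Q p s 0 * braidOp Q p s 0 = Rm Q (p 0) (p 1) * Rm Q (p 1) (p 0) := by
    conv_lhs => enter [1]; rw [c.braidOp_flip h]
    rw [braidOp, mul_assoc, ← mul_assoc (s 0), c.flip_sq 0 h, one_mul]
  rw [mul_assoc _ (braidOp Q p s 0), hT, lact, lact, dbl_cv_right (c.rep _) (c.commD _).gam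
    (c.commD _).gam, ← mul_assoc, ← mul_assoc, ← mul_assoc, hr]

theorem isUnit_X (c : IsChain φ n p s) (hl : IsCoact (p 0) lam) (h : HasCoact (p 0))
    (hS : HasCoact (p 0 ∘ₗ HopfAlgebra.antipode k)) (hu : IsUnit (drinfeldS Q)) :
    IsUnit (actA φ ∘ₗ lam : Module.End k H) :=
  hl.isUnit_actA_of_hasCoact h hS (c.rep 0) (c.commD 0) hu

variable (φ p n) in
/-- The action of `U'` on the factors `0, …, n`, where `U'` acts on the first one by `ad`. -/
def _root_.QuantumD.adjAct : locFin k U →ₗ[k] Module.End k H := star (lact φ p n) (rho φ)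

theorem braidOp_comm_adjAct (c : IsChain φ n p s) {i : ℕ} (h : i + 1 < n) (x) :
    Commute (braidOp Q p s i) (adjAct φ n p x) :=
  semiconjBy_pair (c.braidOp_comm_lact h (by omega)) (g₁ := rho φ) (g₂ := rho φ)
    (fun _ => c.braidOp_commD h _) _

/-- A double braiding commutes with the action of `U` on the two modules it braids. The vector
fields are unaffected because `∂_▷` commutes with `∂_◁`, which is where bijectivity of `S` enters.
-/
theorem Y_comm_adjAct (hS : Function.Bijective (HopfAlgebra.antipode k (A := U)))
    (c : IsChain φ n p s) (h : 0 < n) (x) :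
    Commute (dbl Q (p 0) (gam φ)) (adjAct φ n p x) := by
  have h₀ := (c.commD 0).gam
  refine semiconjBy_pair (commute_lact (i := 1) (dbl_mul_cv (c.rep 0) (isRep_gam φ) h₀)
    (fun j hj _ x => ?_) h) (fun y => ?_) _
  · exact (semiconjBy_dbl (fun y => c.comm j 0 (by omega) x y)
      (fun y => (c.commD j).gam x y)).symm
  · exact (semiconjBy_dbl (fun x => ((c.commD 0).rho x y).symm)
      (fun x => (comm_gam_rho φ hS x y).symm)).symm

theorem X_comm_adjAct (hS : Function.Bijective (HopfAlgebra.antipode k (A := U)))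
    (c : IsChain φ n p s) (hl : IsCoact (p 0) lam) (h : 0 < n) (x) :
    Commute (actA φ ∘ₗ lam : Module.End k H) (adjAct φ n p x) := by
  -- For one factor this is `IsCoact.actA_star`. Further factors act by operators which commute with
  -- `X₁`.
  have key : ∀ m x, Commute (actA φ ∘ₗ lam : Module.End k H)
      (star (lact φ p (m + 1)) (rho φ) x) := by
    intro m
    induction m with
    | zero =>
      exact fun x => (LinearMap.ext fun v => hl.actA_star hS (c.rep 0) (c.commD 0) x v :
        Commute _ _).symm
    | succ m ih =>
      intro x
      rw [lact, ← star_star]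
      exact semiconjBy_pair (fun y => (hl.semiconjBy hl
        (fun x => c.comm (m + 1) 0 (by omega) y x) (fun d => c.commD _ _ d) :
          Commute _ _).symm) ih _
  obtain ⟨m, rfl⟩ : ∃ m, n = m + 1 := ⟨n - 1, by omega⟩
  exact key m x

theorem pair_apply_of_star {f : U →ₗ[k] Module.End k H} {r : locFin k U →ₗ[k] Module.End k H}
    {w : H} (hw : ∀ x : locFin k U, r x w = Coalgebra.counit (R := k) (x : U) • w)
    (x : locFin k U) : star f r x w = f x w := by
  have h : ∀ t : U ⊗[k] locFin k U, pair f r t w =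
      f (TensorProduct.rid k U ((Coalgebra.counit : U →ₗ[k] k).lTensor U
        ((locFin k U).subtype.lTensor U t))) w := by
    intro t
    induction t with
    | zero => simp
    | add a b ha hb => simp only [map_add, LinearMap.add_apply, ha, hb]
    | tmul a b => simp [hw]
  rw [star_apply, h, lTensor_comulLocFin, Coalgebra.lTensor_counit_comul]
  simp

/-- On an invariant vector `∂_▷(x)` is the diagonal action of `S(x)`: convolving the invariance
equation with the diagonal action of `S` cancels the diagonal action. -/
theorem rho_apply_of_invariant (c : IsChain φ n p s) {w : H}
    (hw : ∀ x : locFin k U, adjAct φ n p x w = Coalgebra.counit (R := k) (x : U) • w)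
    (x : locFin k U) : rho φ x w = lact φ p n (HopfAlgebra.antipode k (x : U)) w := by
  have h := pair_apply_of_star (f := lact φ p n ∘ₗ HopfAlgebra.antipode k) hw x
  rw [adjAct, star_star, antipode_cv (c.rep_lact n), eps_star] at h
  exact h

theorem adU_of_central {z : U} (hz : ∀ x, z * x = x * z) (h : U) :
    adU (k := k) h z = Coalgebra.counit (R := k) h • z := by
  rw [adU_apply]
  simp only [← hz, mul_assoc]
  rw [← Finset.mul_sum, HopfAlgebra.sum_mul_antipode_eq_algebraMap_counit, ← Algebra.commutes,
    Algebra.smul_def]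

theorem mem_locFin_of_central {z : U} (hz : ∀ x, z * x = x * z) : z ∈ locFin k U := by
  change FiniteDimensional k (LinearMap.range ((adU (k := k)).flip z))
  refine Submodule.finiteDimensional_of_le (S₂ := k ∙ z) ?_
  rintro _ ⟨h, rfl⟩
  rw [LinearMap.flip_apply, adU_of_central hz]
  exact Submodule.smul_mem _ _ (Submodule.mem_span_singleton_self z)

/-- For central `y` the adjoint orbit is `ε(g) y`, so the coadjoint expansion is the unit of `F`
tensored with `y`. -/
theorem rho_of_central (y : locFin k U) (hz : ∀ x, (y : U) * x = x * y) :
    rho φ y = gam φ (antipodeInv k U y) := by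
  ext1 h
  rw [rho_apply]
  have : kap (gam φ) y h = oneF k U ⊗ₜ gam φ (antipodeInv k U y) h := ev_injective fun g => by
    rw [ev_kap, adU_of_central hz]
    simp [oneF]
  rw [this, hatA_oneF]

variable (p) in
/-- The operators by which a central element acts on all the factors `0, …, m - 1`. -/
def _root_.QuantumD.centralAct (z : U) : ℕ → Module.End k H
  | 0 => 1
  | m + 1 => p m z * centralAct z m

theorem centralAct_commute {e : Module.End k H} {z : U} {i m : ℕ}
    (h₀ : Commute e (centralAct p z i)) (h : ∀ j, i ≤ j → j < m → Commute e (p j z))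
    (him : i ≤ m) : Commute e (centralAct p z m) := by
  induction m, him using Nat.le_induction with
  | base => exact h₀
  | succ m hm ih =>
    exact (h m hm (Nat.lt_succ_self m)).mul_right (ih fun j hj hjm => h j hj (by omega))

theorem _root_.QuantumD.IsRep.commute_of_central {E : Type*} [Ring E] [Algebra k E]
    {f : U →ₗ[k] E} (hf : IsRep f) {z : U} (hz : ∀ x, z * x = x * z) (x : U) :
    Commute (f z) (f x) := by
  rw [Commute, SemiconjBy, ← hf.map_mul, hz, hf.map_mul]

theorem p_central_commute (c : IsChain φ n p s) {z : U} (hz : ∀ x, z * x = x * z) (i j x) :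
    Commute (p i z) (p j x) := by
  obtain rfl | h := eq_or_ne i j
  · exact (c.rep i).commute_of_central hz x
  · exact c.comm i j h z x

theorem X_comm_centralAct (c : IsChain φ n p s) (hl : IsCoact (p 0) lam) {z : U}
    (hz : ∀ x, z * x = x * z) (m : ℕ) :
    Commute (actA φ ∘ₗ lam : Module.End k H) (centralAct p z m) :=
  centralAct_commute (Commute.one_right _) (fun j _ _ =>
    (hl.semiconjBy hl (c.p_central_commute hz j 0) (fun d => c.commD _ _ d) :
      Commute _ _).symm) (Nat.zero_le m)

theorem braidOp_comm_centralAct (c : IsChain φ n p s) {z : U} (hz : ∀ x, z * x = x * z) {i : ℕ}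
    (h : i + 1 < n) : Commute (braidOp Q p s i) (centralAct p z n) := by
  refine centralAct_commute (i := i + 2) ?_
    (fun j hj _ => c.braidOp_comm_p h (by omega) (by omega) z) h
  change Commute _ (p (i + 1) z * (p i z * centralAct p z i))
  have h₁ : Commute (s i) (p (i + 1) z * p i z) := by
    have := (c.flip_right h z).mul_right (c.flip_left h z)
    rwa [(c.comm i (i + 1) (by omega) z z).eq] at this
  have h₂ : Commute (Rm Q (p (i + 1)) (p i)) (p (i + 1) z * p i z) :=
    (Rm_commute Q (fun x => (c.p_central_commute hz _ _ x).symm)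
      (fun x => (c.p_central_commute hz _ _ x).symm)).mul_right
    (Rm_commute Q (fun x => (c.p_central_commute hz _ _ x).symm)
      (fun x => (c.p_central_commute hz _ _ x).symm))
  rw [← mul_assoc]
  exact (h₁.mul_left h₂).mul_right (centralAct_commute (i := 0) (Commute.one_right _)
    (fun j _ hj => c.braidOp_comm_p h (by omega) (by omega) z) (Nat.zero_le i))

variable (φ p) in
/-- The product `Y_1 ⋯ Y_m`. -/
def _root_.QuantumD.prodY : ℕ → Module.End k H
  | 0 => 1
  | m + 1 => prodY m * dbl Q (p m) (lact φ p m)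

/-- Iterates `R₂₁R Δ(ν) = ν ⊗ ν`: each `Y` splits off one factor from the diagonal action of `ν`. -/
theorem prodY_mul_lact (𝓡 : RibbonStructure k U)
    {φ : DU 𝓡.toQuasitriangularStructure →ₐ[k] Module.End k H} (c : IsChain φ n p s) (m : ℕ) :
    prodY φ p m * lact φ p m 𝓡.ν = centralAct p 𝓡.ν m * gam φ 𝓡.ν := by
  induction m with
  | zero => rfl
  | succ m ih =>
    have h : ∀ i ≤ m, Commute (p m 𝓡.ν) (prodY φ p i) := by
      intro i hi
      induction i with
      | zero => exact Commute.one_right _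
      | succ i ih' =>
        exact (ih' (by omega)).mul_right (semiconjBy_dbl
          (fun x => c.comm m i (by omega) 𝓡.ν x) (fun x => c.comm_lact (by omega) 𝓡.ν x))
    rw [prodY, lact, mul_assoc, dbl_mul_cv_ν 𝓡 (c.rep _) (c.rep_lact m) (c.comm_lact le_rfl),
      ← mul_assoc, ← (h m le_rfl).eq, mul_assoc, ih, centralAct, mul_assoc]

/-- For invariant `w` the diagonal action of `ν` equals `∂_◁(ν)`, by the two descriptions of
`∂_▷(ν)` and `S(ν) = ν`. In `prodY_mul_lact` the operator `∂_◁(ν)` then occurs on both sides and is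
cancelled, since `ν` is invertible. -/
theorem prodY_apply (𝓡 : RibbonStructure k U)
    {φ : DU 𝓡.toQuasitriangularStructure →ₐ[k] Module.End k H} (c : IsChain φ n p s) {w : H}
    (hw : ∀ x : locFin k U, adjAct φ n p x w = Coalgebra.counit (R := k) (x : U) • w) :
    prodY φ p n w = centralAct p 𝓡.ν n w := by
  have hz := 𝓡.ν_central
  have hS := antipode_bijective 𝓡
  have h₁ : lact φ p n 𝓡.ν w = gam φ 𝓡.ν w := by
    have h := c.rho_apply_of_invariant hw ⟨𝓡.ν, mem_locFin_of_central hz⟩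
    have hi : antipodeInv k U 𝓡.ν = 𝓡.ν := by
      conv_lhs => rw [← 𝓡.antipode_ν]
      exact antipodeInv_antipode hS _
    rw [rho_of_central _ hz] at h
    simp only [hi, 𝓡.antipode_ν] at h
    exact h.symm
  have h₂ : ∀ j x, Commute (gam φ 𝓡.ν) (p j x) := fun j x => ((c.commD j).gam x _).symm
  have h₃ : ∀ m x, Commute (gam φ 𝓡.ν) (lact φ p m x) := fun m x =>
    commute_lact (i := 0) ((isRep_gam φ).commute_of_central hz) (fun j _ _ => h₂ j)
      (Nat.zero_le m) x
  have h₄ : ∀ m, Commute (gam φ 𝓡.ν) (prodY φ p m) := by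
    intro m
    induction m with
    | zero => exact Commute.one_right _
    | succ m ih => exact ih.mul_right (semiconjBy_dbl (h₂ m) (h₃ m))
  have h₅ : Commute (gam φ 𝓡.ν) (centralAct p 𝓡.ν n) :=
    centralAct_commute (Commute.one_right _) (fun j _ _ => h₂ j _) (Nat.zero_le n)
  have h₆ := LinearMap.congr_fun (c.prodY_mul_lact 𝓡 n) w
  rw [Module.End.mul_apply, h₁, ← Module.End.mul_apply, ← (h₄ n).eq, ← h₅.eq] at h₆
  have hu : IsUnit (gam φ 𝓡.ν) := (isUnit_ν 𝓡).map
    ({ toFun := gam φ, map_one' := (isRep_gam φ).map_one, map_mul' := (isRep_gam φ).map_mul } :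
      U →* Module.End k H)
  exact ((Module.End.isUnit_iff _).1 hu).1 h₆

end IsChain

end ChainRelations

/-! ### Coactions from matrix coefficients. -/

section MatrixCoefficients

variable {k : Type w} [Field k] {U : Type u} [Ring U] [HopfAlgebra k U]
variable {V : Type v} [AddCommGroup V] [Module k V]
variable {H : Type*} [AddCommGroup H] [Module k H]

variable (k U V) in
/-- The map `e ⊗ f ↦ f(g) e`. -/
def contr (g : U) : Module.End k V ⊗[k] restrictedDual k U →ₗ[k] Module.End k V :=
  (TensorProduct.rid k (Module.End k V)).toLinearMap ∘ₗ (Module.Dual.eval k U g ∘ₗ (restrictedDual k U).subtype).lTensor _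

@[simp] theorem contr_tmul (g : U) (e : Module.End k V) (f : restrictedDual k U) :
    contr k U V g (e ⊗ₜ f) = (f : Module.Dual k U) g • e := by
  simp [contr]

/-- The canonical element of `End(V) ⊗ F` which describes a linear map `U → End(V)` with matrix
coefficients in `F`. -/
def canonicalElement [FiniteDimensional k V] (ψ : U →ₗ[k] Module.End k V)
    (hψ : ∀ f v, matrixCoeff ψ f v ∈ restrictedDual k U) :
    Module.End k V ⊗[k] restrictedDual k U :=
  ∑ i, ∑ j, ((Module.finBasis k V).coord j).smulRight (Module.finBasis k V i) ⊗ₜ[k]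
    (⟨matrixCoeff ψ ((Module.finBasis k V).coord i) (Module.finBasis k V j), hψ _ _⟩ :
        restrictedDual k U)

theorem contr_canonicalElement [FiniteDimensional k V] (ψ : U →ₗ[k] Module.End k V)
    (hψ : ∀ f v, matrixCoeff ψ f v ∈ restrictedDual k U) (g : U) :
    contr k U V g (canonicalElement ψ hψ) = ψ g := by
  let b := Module.finBasis k V
  refine b.ext fun l => ?_
  rw [← b.sum_repr (ψ g (b l))]
  simp only [canonicalElement, map_sum, contr_tmul, LinearMap.sum_apply]
  refine Finset.sum_congr rfl fun i _ => ?_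
  rw [Finset.sum_eq_single l]
  · simp [b]
  · intro j _ hj
    simp [b, Finsupp.single_eq_of_ne hj]
  · simp

variable (U) in
/-- The map `H → F ⊗ H` attached to an element of `End(V) ⊗ F` if `End(V)` acts on `H`. -/
def coactMap (ι : Module.End k V →ₗ[k] Module.End k H) :
    Module.End k V ⊗[k] restrictedDual k U →ₗ[k] H →ₗ[k] FT k U H :=
  TensorProduct.lift <| LinearMap.mk₂ k (fun e f => TensorProduct.mk k _ H f ∘ₗ ι e)
    (fun _ _ _ => by rw [map_add, LinearMap.comp_add])
    (fun _ _ _ => by rw [map_smul, LinearMap.comp_smul])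
    (fun _ _ _ => by rw [map_add, LinearMap.add_comp])
    (fun _ _ _ => by rw [map_smul, LinearMap.smul_comp])

@[simp] theorem coactMap_tmul (ι : Module.End k V →ₗ[k] Module.End k H) (e : Module.End k V)
    (f : restrictedDual k U) (v : H) : coactMap U ι (e ⊗ₜ f) v = f ⊗ₜ ι e v := rfl

theorem isCoact_coactMap [FiniteDimensional k V] (ι : Module.End k V →ₗ[k] Module.End k H)
    (ψ : U →ₗ[k] Module.End k V) (hψ : ∀ f v, matrixCoeff ψ f v ∈ restrictedDual k U) :
    IsCoact (ι ∘ₗ ψ) (coactMap U ι (canonicalElement ψ hψ)) := by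
  intro g v
  rw [LinearMap.comp_apply, ← contr_canonicalElement ψ hψ g]
  generalize canonicalElement ψ hψ = t
  induction t with
  | zero => simp
  | add a b ha hb => simp only [map_add, LinearMap.add_apply, ha, hb]
  | tmul e f => simp

/-- The coaction on `F ⊗ H` comes from the same element of `End(V) ⊗ F`, with `End(V)` acting on the
factor `H`. -/
theorem hasCoact_comp [FiniteDimensional k V] (ι : Module.End k V →ₗ[k] Module.End k H)
    (ψ : U →ₗ[k] Module.End k V) (hψ : ∀ f v, matrixCoeff ψ f v ∈ restrictedDual k U) :
    HasCoact (ι ∘ₗ ψ) :=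
  ⟨⟨_, isCoact_coactMap ι ψ hψ⟩, _, isCoact_coactMap (lT k U ι) ψ hψ⟩

/-- These are matrix coefficients of the dual representation, with `v` as a functional on `V*`; `S`
makes transposition multiplicative. -/
theorem matrixCoeff_antipode_mem [FiniteDimensional k V] {ψ : U →ₗ[k] Module.End k V}
    (hψ : IsRep ψ) (f : Module.Dual k V) (v : V) :
    matrixCoeff (ψ ∘ₗ HopfAlgebra.antipode k) f v ∈ restrictedDual k U := by
  have h := matrixCoeff_mem (N := Module.Dual k V)
    (Module.Dual.transpose ∘ₗ ψ ∘ₗ HopfAlgebra.antipode k) (fun x y => by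
      ext
      simp [HopfAlgebra.antipode_mul_antidistrib, hψ.map_mul, Module.Dual.transpose_apply])
    (Module.Dual.eval k V v) f
  exact h

variable (k U V) in
/-- The action of `U` on `V`. -/
def moduleRep [Module U V] [IsScalarTower k U V] : U →ₗ[k] Module.End k V :=
  (Algebra.lsmul k k V).toLinearMap

theorem isRep_moduleRep [Module U V] [IsScalarTower k U V] : IsRep (moduleRep k U V) :=
  ⟨map_one (Algebra.lsmul k k V), map_mul (Algebra.lsmul k k V)⟩

theorem matrixCoeff_moduleRep_mem [FiniteDimensional k V] [Module U V] [IsScalarTower k U V]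
    (f : Module.Dual k V) (v : V) : matrixCoeff (moduleRep k U V) f v ∈ restrictedDual k U :=
  matrixCoeff_mem _ isRep_moduleRep.map_mul f v

theorem coactionL_eq [FiniteDimensional k V] [Module U V] [IsScalarTower k U V] :
    coactionL k U V = canonicalElement (moduleRep k U V) matrixCoeff_moduleRep_mem := rfl

theorem eps_commute {E : Type*} [Ring E] [Algebra k E] (x : U) (e : E) :
    Commute (eps k U E x) e :=
  Algebra.commute_algebraMap_left _ _

variable {Q : QuasitriangularStructure k U} {φ : DU Q →ₐ[k] Module.End k H}

theorem pair_eq_actA_coactMap {ι : Module.End k V →ₗ[k] Module.End k H} (h : CommD φ ι)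
    (t : Module.End k V ⊗[k] restrictedDual k U) :
    pair ι (φ.toLinearMap ∘ₗ opA Q) t = actA φ ∘ₗ coactMap U ι t := by
  induction t with
  | zero => simp
  | add a b ha hb => rw [map_add, map_add, ha, hb, LinearMap.comp_add]
  | tmul e f =>
    rw [pair_tmul]
    exact h e _

end MatrixCoefficients

/-! ### The chain structure on `V^{⊗n} ⊗ M`. -/

section TensorPowers

theorem swap_braid {α : Type*} [DecidableEq α] {a b c : α} (h₁ : a ≠ b) (h₂ : b ≠ c) (h₃ : a ≠ c) :
    Equiv.swap b a * Equiv.swap c b * Equiv.swap b a =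
      Equiv.swap c b * Equiv.swap b a * Equiv.swap c b := by
  rw [Equiv.swap_mul_swap_mul_swap h₂.symm h₃.symm, Equiv.swap_comm c b, Equiv.swap_comm b a,
    Equiv.swap_mul_swap_mul_swap h₁ h₃, Equiv.swap_comm]


variable {k : Type w} [Field k] {U : Type u} [Ring U] [HopfAlgebra k U]
variable (Q : QuasitriangularStructure k U)
variable {n : ℕ}
variable {V : Type v} [AddCommGroup V] [Module k V]
variable {M : Type x} [AddCommGroup M] [Module k M]

theorem tensorSpace_ext {H : Type*} [AddCommMonoid H] [Module k H]
    {f g : TensorSpace k n V M →ₗ[k] H}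
    (h : ∀ (a : Fin n → V) (m : M), f (PiTensorProduct.tprod k a ⊗ₜ m) =
      g (PiTensorProduct.tprod k a ⊗ₜ m)) : f = g := by
  refine TensorProduct.ext (PiTensorProduct.ext (MultilinearMap.ext fun a => ?_))
  exact LinearMap.ext fun m => h a m

theorem onV_tprod (i : Fin n) (e : Module.End k V) (a : Fin n → V) (m : M) :
    onV M i e (PiTensorProduct.tprod k a ⊗ₜ m) =
      PiTensorProduct.tprod k (Function.update a i (e (a i))) ⊗ₜ m := by
  simp only [onV, LinearMap.coe_mk, AddHom.coe_mk, LinearMap.rTensor_tmul,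
    PiTensorProduct.map_tprod]
  congr 2
  ext j
  obtain rfl | h := eq_or_ne j i
  · simp
  · simp [h]

theorem onV_one (i : Fin n) : onV M i (1 : Module.End k V) = 1 :=
  tensorSpace_ext fun a m => by simp [onV_tprod]

theorem onV_mul (i : Fin n) (e f : Module.End k V) : onV M i (e * f) = onV M i e * onV M i f :=
  tensorSpace_ext fun a m => by simp [onV_tprod]

theorem onV_comm {i j : Fin n} (h : i ≠ j) :
    Comm (E := Module.End k (TensorSpace k n V M)) (onV M i) (onV M j) := fun e f =>
  tensorSpace_ext fun a m => by
    simp [onV_tprod, h, h.symm, Function.update_comm h]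

variable (k V M) in
/-- The permutation of the tensor factors `V`. -/
def permV (σ : Equiv.Perm (Fin n)) : Module.End k (TensorSpace k n V M) :=
  (PiTensorProduct.reindex k (fun _ : Fin n => V) σ).toLinearMap.rTensor M

theorem permV_tprod (σ : Equiv.Perm (Fin n)) (a : Fin n → V) (m : M) :
    permV k V M σ (PiTensorProduct.tprod k a ⊗ₜ m) =
      PiTensorProduct.tprod k (fun i => a (σ.symm i)) ⊗ₜ m := by
  simp [permV, PiTensorProduct.reindex_tprod]

theorem permV_mul (σ τ : Equiv.Perm (Fin n)) :
    permV k V M (σ * τ) = permV k V M σ * permV k V M τ :=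
  tensorSpace_ext fun a m => by
    rw [Module.End.mul_apply, permV_tprod, permV_tprod, permV_tprod]
    rfl

theorem permV_one : permV k V M (1 : Equiv.Perm (Fin n)) = 1 :=
  tensorSpace_ext fun a m => by
    rw [permV_tprod]
    rfl

theorem permV_onV (σ : Equiv.Perm (Fin n)) (i : Fin n) (e : Module.End k V) :
    SemiconjBy (permV k V M σ) (onV M i e) (onV M (σ i) e) :=
  tensorSpace_ext fun a m => by
    rw [Module.End.mul_apply, Module.End.mul_apply, onV_tprod, permV_tprod, permV_tprod, onV_tprod,
      Equiv.symm_apply_apply]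
    congr 2
    ext j
    obtain rfl | h := eq_or_ne j (σ i)
    · simp
    · have : σ.symm j ≠ i := fun h' => h (by rw [← h', Equiv.apply_symm_apply])
      simp [h, this]

section

variable [Module (DU Q) M] [IsScalarTower k (DU Q) M]

variable (n V M) in
/-- The action of `D_U` in the tensor factor `M`, as a homomorphism of algebras. -/
def onMHom : DU Q →ₐ[k] Module.End k (TensorSpace k n V M) :=
  AlgHom.ofLinearMap (onM Q n V M)
    (by refine TensorProduct.ext' fun a m => ?_; simp [onM])
    (fun x y => by refine TensorProduct.ext' fun a m => ?_; simp [onM])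

theorem onMHom_tmul (d : DU Q) (a : ⨂[k] _ : Fin n, V) (m : M) :
    onMHom Q n V M d (a ⊗ₜ m) = a ⊗ₜ (d • m) := rfl

theorem rTensor_commute_onMHom (e : Module.End k (⨂[k] _ : Fin n, V)) (d : DU Q) :
    Commute (e.rTensor M : Module.End k (TensorSpace k n V M)) (onMHom Q n V M d) := by
  refine TensorProduct.ext' fun a m => ?_
  rw [Module.End.mul_apply, Module.End.mul_apply, onMHom_tmul, LinearMap.rTensor_tmul,
    LinearMap.rTensor_tmul, onMHom_tmul]

theorem commD_onV (i : Fin n) : CommD (onMHom Q n V M) (onV M i : Module.End k V →ₗ[k] _) :=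
  fun _ d => rTensor_commute_onMHom Q _ d

end

variable [Module U V] [IsScalarTower k U V]

theorem isRep_piV (i : Fin n) : IsRep (E := Module.End k (TensorSpace k n V M)) (piV (U := U) M i) where
  map_one := (congrArg (onV M i) isRep_moduleRep.map_one).trans (onV_one i)
  map_mul x y := (congrArg (onV M i) (isRep_moduleRep.map_mul x y)).trans (onV_mul i _ _)

variable (k U n V M) in
/-- The action of `U` in the tensor factor `V` with index `i`, and the trivial action if there is
no such factor. -/
def factorAct (i : ℕ) : U →ₗ[k] Module.End k (TensorSpace k n V M) :=
  if h : i < n then piV M ⟨i, h⟩ else eps k U (Module.End k (TensorSpace k n V M))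

variable (k n V M) in
/-- The flip of the tensor factors with indices `i` and `i + 1`. -/
def factorFlip (i : ℕ) : Module.End k (TensorSpace k n V M) :=
  if h : i + 1 < n then permV k V M (Equiv.swap ⟨i + 1, h⟩ ⟨i, by omega⟩) else 1

theorem factorAct_of_lt {i : ℕ} (h : i < n) : factorAct k U n V M i = piV M ⟨i, h⟩ := dif_pos h

theorem factorFlip_of_lt {i : ℕ} (h : i + 1 < n) :
    factorFlip k n V M i = permV k V M (Equiv.swap ⟨i + 1, h⟩ ⟨i, by omega⟩) := dif_pos h

theorem opT_eq (i : Fin (n - 1)) :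
    opT Q V M i = braidOp Q (factorAct k U n V M) (factorFlip k n V M) i := by
  have := i.2
  rw [braidOp, factorAct_of_lt (by omega : (i : ℕ) + 1 < n), factorAct_of_lt (by omega : (i : ℕ) < n),
    factorFlip_of_lt (by omega)]
  rfl

variable [Module (DU Q) M] [IsScalarTower k (DU Q) M]

variable (n V M) in
theorem isChain_factorAct :
    IsChain (onMHom Q n V M) n (factorAct k U n V M) (factorFlip k n V M) where
  rep i := by
    unfold factorAct
    split_ifs
    · exact isRep_piV _
    · exact isRep_eps k U _
  comm i j h := by
    unfold factorAct
    split_ifs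
    · exact fun x y => onV_comm (by simpa using h) _ _
    · exact fun x y => (eps_commute _ _).symm
    · exact fun x y => eps_commute _ _
    · exact fun x y => eps_commute _ _
  commD i := by
    unfold factorAct
    split_ifs
    · exact fun x d => commD_onV Q _ _ d
    · exact fun x y => eps_commute _ _
  flip_commD i h d := by
    rw [factorFlip_of_lt h]
    exact rTensor_commute_onMHom Q _ d
  flip i h j x := by
    rw [factorFlip_of_lt h]
    -- From index `n` on the action is trivial, and the swap fixes those indices because `i + 1 <
    -- n`.
    by_cases hj : j < n
    · have hj' : Equiv.swap i (i + 1) j < n := by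
        rw [Equiv.swap_apply_def]
        split_ifs <;> omega
      rw [factorAct_of_lt hj, factorAct_of_lt hj']
      have : (⟨Equiv.swap i (i + 1) j, hj'⟩ : Fin n) =
          Equiv.swap (⟨i + 1, h⟩ : Fin n) ⟨i, by omega⟩ ⟨j, hj⟩ := by
        ext
        simp only [Equiv.swap_apply_def, Fin.mk.injEq]
        split_ifs <;> simp_all
      rw [this]
      exact permV_onV _ _ _
    · rw [Equiv.swap_apply_of_ne_of_ne (by omega) (by omega), factorAct, dif_neg hj]
      exact (eps_commute _ _).symm
  flip_sq i h := by
    rw [factorFlip_of_lt h, ← permV_mul, Equiv.swap_mul_self, permV_one]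
  flip_braid i h := by
    rw [factorFlip_of_lt h, factorFlip_of_lt (by omega : i + 1 < n)]
    simp only [← permV_mul]
    congr 1
    exact swap_braid (by simp) (by simp) (by rw [Ne, Fin.mk.injEq]; omega)
  flip_far i j h hj := by
    rw [factorFlip_of_lt hj, factorFlip_of_lt (by omega : i + 1 < n), Commute, SemiconjBy,
      ← permV_mul, ← permV_mul]
    congr 1
    refine (Equiv.Perm.disjoint_swap_swap ?_).commute
    simp
    omega

/-- Compares a list product over reversed indices with a recursion that multiplies by new factors on
the left, as in `leftAct` and `lact`. -/
theorem prod_ofFn_rev_mul {G : Type*} [Monoid G] {f g : ℕ → G} (h : ∀ i, g (i + 1) = f i * g i)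
    (m : ℕ) : (List.ofFn fun i : Fin m => f i.rev).prod * g 0 = g m := by
  induction m with
  | zero => simp
  | succ m ih =>
    rw [List.ofFn_succ, List.prod_cons, h m, ← ih, mul_assoc]
    simp [Fin.rev_succ]

theorem leftAct_eq : leftAct Q n V M = lact (onMHom Q n V M) (factorAct k U n V M) n := by
  rw [leftAct]
  have h := prod_ofFn_rev_mul (f := fun i => WithConv.toConv (factorAct k U n V M i))
    (g := fun i => WithConv.toConv (lact (onMHom Q n V M) (factorAct k U n V M) i))
    (fun i => rfl) n
  have h₁ : (fun i : Fin n => WithConv.toConv (piV (k := k) (U := U) (V := V) M i.rev)) =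
      fun i : Fin n => WithConv.toConv (factorAct k U n V M i.rev) :=
    funext fun i => by rw [factorAct_of_lt i.rev.2]
  rw [h₁]
  exact congrArg WithConv.ofConv h

theorem adAct_eq :
    adAct Q n V M = adjAct (onMHom Q n V M) n (factorAct k U n V M) := by
  rw [adAct, leftAct_eq]
  rfl

theorem opY1_eq (h : 0 < n) :
    opY1 Q V M h = dbl Q (factorAct k U n V M 0) (gam (onMHom Q n V M)) := by
  have hp := isRep_piV (k := k) (U := U) (V := V) (M := M) ⟨0, h⟩
  rw [factorAct_of_lt h, ← pair_R21_mul_R hp (isRep_gam _)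
    (fun x y => commD_onV Q ⟨0, h⟩ _ _)]
  rfl

variable (k U V M) in
/-- The coaction of `F` on the tensor factor `V` with index `i`. -/
def factorCoact [FiniteDimensional k V] (i : Fin n) :
    TensorSpace k n V M →ₗ[k] FT k U (TensorSpace k n V M) :=
  coactMap U (onV M i) (coactionL k U V)

theorem isCoact_factorCoact [FiniteDimensional k V] {i : ℕ} (h : i < n) :
    IsCoact (factorAct k U n V M i) (factorCoact k U V M ⟨i, h⟩) := by
  rw [factorAct_of_lt h]
  rw [factorCoact, coactionL_eq]
  exact isCoact_coactMap (H := TensorSpace k n V M) (onV M ⟨i, h⟩) (moduleRep k U V)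
    matrixCoeff_moduleRep_mem

theorem hasCoact_factorAct [FiniteDimensional k V] {i : ℕ} (h : i < n) :
    HasCoact (factorAct k U n V M i) := by
  rw [factorAct_of_lt h]
  exact hasCoact_comp (H := TensorSpace k n V M) (onV M ⟨i, h⟩) (moduleRep k U V)
    matrixCoeff_moduleRep_mem

theorem hasCoact_factorAct_antipode [FiniteDimensional k V] {i : ℕ} (h : i < n) :
    HasCoact (factorAct k U n V M i ∘ₗ HopfAlgebra.antipode k) := by
  rw [factorAct_of_lt h]
  exact hasCoact_comp (H := TensorSpace k n V M) (onV M ⟨i, h⟩) (moduleRep k U V ∘ₗ HopfAlgebra.antipode k)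
    (matrixCoeff_antipode_mem isRep_moduleRep)

theorem opX1_eq [FiniteDimensional k V] (h : 0 < n) :
    opX1 Q V M h = actA (onMHom Q n V M) ∘ₗ factorCoact k U V M ⟨0, h⟩ :=
  pair_eq_actA_coactMap (commD_onV Q ⟨0, h⟩) _

end TensorPowers

/-! ### Restricting commuting units to simultaneous eigenvectors. -/

section Restriction

variable {k : Type*} [Field k] {H Y : Type*} [AddCommGroup H] [Module k H]

/-- The units which commute with all operators `r y`. -/
def commUnits (r : Y → Module.End k H) : Subgroup (Module.End k H)ˣ where
  carrier := {u | ∀ y, Commute (u : Module.End k H) (r y)}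
  mul_mem' ha hb y := (ha y).mul_left (hb y)
  one_mem' _ := Commute.one_left _
  inv_mem' ha y := (ha y).units_inv_left

theorem mem_centralizer_singleton {G : Type*} [Monoid G] {a b : G} :
    a ∈ Submonoid.centralizer {b} ↔ Commute a b := by
  rw [Submonoid.mem_centralizer_iff]
  simp [Commute, SemiconjBy, eq_comm]

/-- The restriction of commuting operators to a space of simultaneous eigenvectors. -/
def commUnits.restrict {r : Y → Module.End k H} {χ : Y → k} {W : Submodule k H}
    (hW : ∀ w, w ∈ W ↔ ∀ y, r y w = χ y • w) : commUnits r →* Module.End k W where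
  toFun u := ((u : (Module.End k H)ˣ) : Module.End k H).restrict fun w hw => (hW _).2 fun y => by
    have := LinearMap.congr_fun (u.2 y).eq w
    rw [Module.End.mul_apply, Module.End.mul_apply, (hW w).1 hw y, map_smul] at this
    exact this.symm
  map_one' := rfl
  map_mul' _ _ := rfl

end Restriction

/-! ### The action of the elliptic braid group on invariants, and its naturality. -/

section EllipticAction

variable {k : Type w} [Field k] {U : Type u} [Ring U] [HopfAlgebra k U]
variable {H : Type*} [AddCommGroup H] [Module k H] {n : ℕ}

section

variable {Q : QuasitriangularStructure k U}

variable (n) in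
/-- The operators by which the generators of the elliptic braid group act. -/
def ellOp (φ : DU Q →ₐ[k] Module.End k H) (p : ℕ → U →ₗ[k] Module.End k H)
    (s : ℕ → Module.End k H) (lam : H →ₗ[k] FT k U H) : EllGen n → Module.End k H
  | .T i => braidOp Q p s i
  | .X j => jucysMurphy (braidOp Q p s) (actA φ ∘ₗ lam) j
  | .Y j => jucysMurphy (braidOp Q p s) (dbl Q (p 0) (gam φ)) j

theorem jucysMurphy_property {G : Type*} [Monoid G] (S : Submonoid G) {T : ℕ → G} {x₀ : G} {m : ℕ}
    (hT : ∀ i, i < m → T i ∈ S) (h₀ : x₀ ∈ S) {i : ℕ} (hi : i ≤ m) : jucysMurphy T x₀ i ∈ S := by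
  induction i with
  | zero => exact h₀
  | succ i ih => exact S.mul_mem (S.mul_mem (hT i hi) (ih (by omega))) (hT i hi)

/-- A chain whose actions come from coactions, the one of the factor `0` from `lam`. -/
structure IsCoactChain (φ : DU Q →ₐ[k] Module.End k H) (n : ℕ) (p : ℕ → U →ₗ[k] Module.End k H)
    (s : ℕ → Module.End k H) (lam : H →ₗ[k] FT k U H) : Prop extends IsChain φ n p s where
  isCoact (h : 0 < n) : IsCoact (p 0) lam
  hasCoact (i) (h : i < n) : HasCoact (p i)
  hasCoact_antipode (h : 0 < n) : HasCoact (p 0 ∘ₗ HopfAlgebra.antipode k)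

end

section Naturality

variable {Q : QuasitriangularStructure k U} {φ : DU Q →ₐ[k] Module.End k H}
variable {p : ℕ → U →ₗ[k] Module.End k H} {H' : Type*} [AddCommGroup H'] [Module k H']
variable {φ' : DU Q →ₐ[k] Module.End k H'} {p' : ℕ → U →ₗ[k] Module.End k H'}

theorem actA_natural {t : H →ₗ[k] H'} (hφ : ∀ d v, t (φ d v) = φ' d (t v)) (z : FT k U H) :
    actA φ' (t.lTensor _ z) = t (actA φ z) := by
  induction z using TensorProduct.induction_on with
  | zero => simp
  | add a b ha hb => simp only [map_add, ha, hb]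
  | tmul f v => exact (hφ _ v).symm

theorem lact_natural {t : H →ₗ[k] H'} (hφ : ∀ d v, t (φ d v) = φ' d (t v))
    (hp : ∀ i x v, t (p i x v) = p' i x (t v)) (m : ℕ) (x : U) (v : H) :
    t (lact φ p m x v) = lact φ' p' m x (t v) := by
  induction m generalizing x v with
  | zero => exact hφ _ v
  | succ m ih => exact cv_apply_intertwine (hp m) ih x v

theorem adjAct_natural {t : H →ₗ[k] H'} (hφ : ∀ d v, t (φ d v) = φ' d (t v))
    (hp : ∀ i x v, t (p i x v) = p' i x (t v)) (x : locFin k U) (v : H) :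
    t (adjAct φ n p x v) = adjAct φ' n p' x (t v) :=
  pair_apply_intertwine (f₁ := lact φ p n) (g₁ := rho φ) (lact_natural hφ hp n)
    (fun _ v => hφ _ v) _ v

end Naturality

variable {𝓡 : RibbonStructure k U}
variable {φ : DU 𝓡.toQuasitriangularStructure →ₐ[k] Module.End k H}
variable {p : ℕ → U →ₗ[k] Module.End k H} {s : ℕ → Module.End k H} {lam : H →ₗ[k] FT k U H}

namespace IsCoactChain

/-- All generators act by products of the `T i`, `X₁` and `Y₁`, so invertibility and commutation
with the adjoint action need only be checked on these. -/
theorem ellOp_mem (S : Submonoid (Module.End k H))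
    (hT : ∀ i, i + 1 < n → braidOp 𝓡.toQuasitriangularStructure p s i ∈ S)
    (hX : 0 < n → (actA φ ∘ₗ lam : Module.End k H) ∈ S)
    (hY : 0 < n → dbl 𝓡.toQuasitriangularStructure (p 0) (gam φ) ∈ S) (g : EllGen n) :
    ellOp n φ p s lam g ∈ S := by
  cases g with
  | T i => exact hT i (by omega)
  | X j =>
    exact jucysMurphy_property S (m := n - 1) (fun i hi => hT i (by omega)) (hX j.pos) (by omega)
  | Y j =>
    exact jucysMurphy_property S (m := n - 1) (fun i hi => hT i (by omega)) (hY j.pos) (by omega)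

theorem isUnit_ellOp (c : IsCoactChain φ n p s lam) (g : EllGen n) :
    IsUnit (ellOp n φ p s lam g) :=
  ellOp_mem (IsUnit.submonoid _) (fun _ h => c.isUnit_braidOp h)
    (fun h => c.isUnit_X (c.isCoact h) (c.hasCoact 0 h) (c.hasCoact_antipode h)
      (isUnit_drinfeldS 𝓡)) (fun _ => c.isUnit_Y) g

theorem ellOp_comm_adjAct (c : IsCoactChain φ n p s lam) (g : EllGen n) (x : locFin k U) :
    Commute (ellOp n φ p s lam g) (adjAct φ n p x) := by
  have hS := antipode_bijective 𝓡
  have h := ellOp_mem (Submonoid.centralizer {adjAct φ n p x})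
    (fun i h => mem_centralizer_singleton.2 (c.braidOp_comm_adjAct h x))
    (fun h => mem_centralizer_singleton.2
      (c.X_comm_adjAct hS (c.isCoact h) h x))
    (fun h => mem_centralizer_singleton.2 (c.Y_comm_adjAct hS h x)) g
  exact mem_centralizer_singleton.1 h

/-- The units by which the generators act. -/
def ellUnit (c : IsCoactChain φ n p s lam) (g : EllGen n) :
    commUnits (fun x : locFin k U => adjAct φ n p x) :=
  ⟨(c.isUnit_ellOp g).unit, c.ellOp_comm_adjAct g⟩

theorem coe_ellUnit (c : IsCoactChain φ n p s lam) (g : EllGen n) :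
    ((c.ellUnit g : (Module.End k H)ˣ) : Module.End k H) = ellOp n φ p s lam g := rfl

theorem prod_ofFn_Y (c : IsCoactChain φ n p s lam) :
    (List.ofFn fun j : Fin n => ellOp n φ p s lam (.Y j)).prod = prodY φ p n := by
  have h₁ : ∀ m, (List.ofFn fun j : Fin m =>
      dbl 𝓡.toQuasitriangularStructure (p j) (lact φ p j)).prod = prodY φ p m := by
    intro m
    induction m with
    | zero => rfl
    | succ m ih =>
      rw [List.ofFn_succ', List.concat_eq_append, List.prod_append, prodY, ← ih]
      simp
  rw [← h₁]
  congr 2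
  ext1 j
  exact c.jucysMurphy_dbl j.2

/-- Every relation except the last holds on all of `H`; invariance of `w` enters only through
`prodY_apply`. -/
theorem relation_apply (c : IsCoactChain φ n p s lam) {a b : FreeGroup (EllGen n)}
    (h : EllRel n a b) {w : H}
    (hw : ∀ x : locFin k U, adjAct φ n p x w = Coalgebra.counit (R := k) (x : U) • w) :
    ((FreeGroup.lift c.ellUnit a : (Module.End k H)ˣ) : Module.End k H) w =
      ((FreeGroup.lift c.ellUnit b : (Module.End k H)ˣ) : Module.End k H) w := by
  have braid : ∀ i, i + 1 < n - 1 → _ := fun i hi => c.braidOp_braid (i := i) (by omega)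
  have far : ∀ i j, i + 2 ≤ j → j < n - 1 → Commute (braidOp 𝓡.toQuasitriangularStructure p s i)
      (braidOp 𝓡.toQuasitriangularStructure p s j) :=
    fun i j hij hj => c.braidOp_far hij (by omega)
  have hX : 0 < n → ∀ j, 0 < j → j < n - 1 → Commute (braidOp 𝓡.toQuasitriangularStructure p s j)
      (actA φ ∘ₗ lam : Module.End k H) :=
    fun h j h₀ hj => c.braidOp_comm_X (c.isCoact h) h₀ (by omega)
  have hY : ∀ j, 0 < j → j < n - 1 → Commute (braidOp 𝓡.toQuasitriangularStructure p s j)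
      (dbl 𝓡.toQuasitriangularStructure (p 0) (gam φ)) :=
    fun j h₀ hj => c.braidOp_comm_Y h₀ (by omega)
  cases h with
  | X_comm i j =>
    simp only [map_mul, FreeGroup.lift_apply_of, Subgroup.coe_mul, Units.val_mul, coe_ellUnit]
    exact LinearMap.congr_fun (commute_jucysMurphy_jucysMurphy braid far (hX i.pos)
      (fun h => c.commute_X_X (c.isCoact i.pos) (c.hasCoact 0 i.pos) (c.hasCoact 1 (by omega))
        (by omega)) (by omega) (by omega)).eq w
  | Y_comm i j =>
    simp only [map_mul, FreeGroup.lift_apply_of, Subgroup.coe_mul, Units.val_mul, coe_ellUnit]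
    exact LinearMap.congr_fun (commute_jucysMurphy_jucysMurphy braid far hY
      (fun h => c.commute_Y_Y (by omega)) (by omega) (by omega)).eq w
  | braid i j h =>
    simp only [map_mul, FreeGroup.lift_apply_of, Subgroup.coe_mul, Units.val_mul, coe_ellUnit, ellOp, h]
    exact LinearMap.congr_fun (braid i (by omega)) w
  | far i j h =>
    simp only [map_mul, FreeGroup.lift_apply_of, Subgroup.coe_mul, Units.val_mul, coe_ellUnit, ellOp]
    exact LinearMap.congr_fun (far i j h (by omega)).eq w
  | TXT i =>
    simp only [map_mul, FreeGroup.lift_apply_of, Subgroup.coe_mul, Units.val_mul, coe_ellUnit]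
    rfl
  | TYT i =>
    simp only [map_mul, FreeGroup.lift_apply_of, Subgroup.coe_mul, Units.val_mul, coe_ellUnit]
    rfl
  | TX_far i j h h₂ =>
    simp only [map_mul, FreeGroup.lift_apply_of, Subgroup.coe_mul, Units.val_mul, coe_ellUnit]
    simp only [lo, hi, ne_eq, Fin.ext_iff] at h h₂
    obtain h' | h' : (j : ℕ) < i ∨ (i : ℕ) + 2 ≤ j := by omega
    · exact LinearMap.congr_fun (commute_jucysMurphy_of_lt far (hX j.pos) h' i.2).eq w
    · exact LinearMap.congr_fun
        (commute_jucysMurphy_of_gt braid far (hX j.pos) h' (by omega)).eq w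
  | TY_far i j h h₂ =>
    simp only [map_mul, FreeGroup.lift_apply_of, Subgroup.coe_mul, Units.val_mul, coe_ellUnit]
    simp only [lo, hi, ne_eq, Fin.ext_iff] at h h₂
    obtain h' | h' : (j : ℕ) < i ∨ (i : ℕ) + 2 ≤ j := by omega
    · exact LinearMap.congr_fun (commute_jucysMurphy_of_lt far hY h' i.2).eq w
    · exact LinearMap.congr_fun (commute_jucysMurphy_of_gt braid far hY h' (by omega)).eq w
  | XY i h =>
    simp only [map_mul, FreeGroup.lift_apply_of, Subgroup.coe_mul, Units.val_mul, coe_ellUnit]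
    have hn : 1 < n := by omega
    have := LinearMap.congr_fun (c.X_mul_Y (c.isCoact (by omega)) hn) w
    rw [← c.jucysMurphy_dbl hn] at this
    simp only [ellOp, lo, hi, h]
    exact this
  | prodY i =>
    simp only [map_mul, map_list_prod, List.map_ofFn, FreeGroup.lift_apply_of, Subgroup.coe_mul,
      Units.val_mul, coe_ellUnit, Function.comp_def]
    have hp : (((List.ofFn fun j : Fin n => c.ellUnit (.Y j)).prod : (Module.End k H)ˣ) :
        Module.End k H) = prodY φ p n := by
      rw [← c.prod_ofFn_Y]
      have := map_list_prod ((Units.coeHom (Module.End k H)).comp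
        (commUnits (fun x : locFin k U => adjAct φ n p x)).subtype)
        (List.ofFn fun j : Fin n => c.ellUnit (.Y j))
      rw [List.map_ofFn] at this
      exact this
    rw [hp, Module.End.mul_apply, Module.End.mul_apply, c.prodY_apply 𝓡 hw]
    -- `X_i w` is invariant again, so the product of the `Y_j` acts on it by the same central
    -- operator as on `w`.
    have hX' : ∀ x, adjAct φ n p x (ellOp n φ p s lam (.X i) w) =
        Coalgebra.counit (R := k) (x : U) • ellOp n φ p s lam (.X i) w := fun x => by
      have := LinearMap.congr_fun (c.ellOp_comm_adjAct (.X i) x).eq w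
      rw [Module.End.mul_apply, Module.End.mul_apply, hw, map_smul] at this
      exact this.symm
    rw [c.prodY_apply 𝓡 hX']
    have hz := 𝓡.ν_central
    have := jucysMurphy_property (Submonoid.centralizer {centralAct p 𝓡.ν n}) (m := n - 1)
      (fun i h => mem_centralizer_singleton.2
        (c.braidOp_comm_centralAct hz (i := i) (by omega)))
      (mem_centralizer_singleton.2
        (c.X_comm_centralAct (c.isCoact i.pos) hz n)) (i := i) (by omega)
    exact LinearMap.congr_fun (mem_centralizer_singleton.1 this).eq.symm w

/-- The action of the elliptic braid group on the invariants. -/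
def ellAction (c : IsCoactChain φ n p s lam) {W : Submodule k H}
    (hW : ∀ w, w ∈ W ↔ ∀ x : locFin k U, adjAct φ n p x w = Coalgebra.counit (R := k) (x : U) • w) :
    EllipticBraidGroup n →* Module.End k W :=
  (Units.coeHom _).comp (PresentedGroup.toGroup
    (f := fun g => (commUnits.restrict hW).toHomUnits (c.ellUnit g)) (by
      rintro _ ⟨a, b, hab, rfl⟩
      -- Words are evaluated first in the commuting units of `H` and then restricted, so a relation
      -- need only hold on vectors of `W`.
      have hl : FreeGroup.lift (fun g => (commUnits.restrict hW).toHomUnits (c.ellUnit g)) =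
          (commUnits.restrict hW).toHomUnits.comp (FreeGroup.lift c.ellUnit) := by
        ext1 g
        simp
      rw [hl, map_mul, map_inv, mul_inv_eq_one]
      refine Units.ext (LinearMap.ext fun w => Subtype.ext ?_)
      exact c.relation_apply hab ((hW w).1 w.2)))

theorem ellAction_gen (c : IsCoactChain φ n p s lam) {W : Submodule k H}
    (hW : ∀ w, w ∈ W ↔ ∀ x : locFin k U, adjAct φ n p x w = Coalgebra.counit (R := k) (x : U) • w)
    (g : EllGen n) (w : W) :
    (c.ellAction hW (EllipticBraidGroup.gen g) w : H) = ellOp n φ p s lam g w := by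
  have : c.ellAction hW (EllipticBraidGroup.gen g) = commUnits.restrict hW (c.ellUnit g) := by
    simp only [ellAction, EllipticBraidGroup.gen, MonoidHom.comp_apply, PresentedGroup.toGroup.of]
    rfl
  rw [this]
  rfl

end IsCoactChain

section Naturality

variable {H' : Type*} [AddCommGroup H'] [Module k H']
variable {φ' : DU 𝓡.toQuasitriangularStructure →ₐ[k] Module.End k H'}
variable {p' : ℕ → U →ₗ[k] Module.End k H'} {s' : ℕ → Module.End k H'} {lam' : H' →ₗ[k] FT k U H'}

theorem ellOp_natural (c : IsCoactChain φ n p s lam) (c' : IsCoactChain φ' n p' s' lam')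
    {t : H →ₗ[k] H'} (hφ : ∀ d v, t (φ d v) = φ' d (t v))
    (hp : ∀ i x v, t (p i x v) = p' i x (t v)) (hs : ∀ i v, t (s i v) = s' i (t v))
    (g : EllGen n) (v : H) : t (ellOp n φ p s lam g v) = ellOp n φ' p' s' lam' g (t v) := by
  have hT : ∀ i v, t (braidOp 𝓡.toQuasitriangularStructure p s i v) =
      braidOp 𝓡.toQuasitriangularStructure p' s' i (t v) := fun i v =>
    (hs i _).trans (congrArg (s' i) (pair_apply_intertwine (hp _) (hp _) _ v))
  have key : ∀ {x₀ : Module.End k H} {x₀' : Module.End k H'}, (∀ v, t (x₀ v) = x₀' (t v)) →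
      ∀ m v, t (jucysMurphy (braidOp 𝓡.toQuasitriangularStructure p s) x₀ m v) =
        jucysMurphy (braidOp 𝓡.toQuasitriangularStructure p' s') x₀' m (t v) := by
    intro x₀ x₀' h₀ m
    induction m with
    | zero => exact h₀
    | succ m ih =>
      intro v
      simp only [jucysMurphy, Module.End.mul_apply, hT, ih]
  cases g with
  | T i => exact hT i v
  | X j =>
    refine key (fun v => ?_) j v
    rw [LinearMap.comp_apply, LinearMap.comp_apply,
      (c.isCoact j.pos).natural (c'.isCoact j.pos) (hp 0), actA_natural hφ]
  | Y j => exact key (dbl_apply_intertwine (hp 0) fun _ v => hφ _ v) j v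

theorem ellAction_natural (c : IsCoactChain φ n p s lam) (c' : IsCoactChain φ' n p' s' lam')
    {t : H →ₗ[k] H'} (hφ : ∀ d v, t (φ d v) = φ' d (t v))
    (hp : ∀ i x v, t (p i x v) = p' i x (t v)) (hs : ∀ i v, t (s i v) = s' i (t v))
    {W : Submodule k H} {W' : Submodule k H'}
    (hW : ∀ w, w ∈ W ↔ ∀ x : locFin k U, adjAct φ n p x w = Coalgebra.counit (R := k) (x : U) • w)
    (hW' : ∀ w, w ∈ W' ↔
      ∀ x : locFin k U, adjAct φ' n p' x w = Coalgebra.counit (R := k) (x : U) • w)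
    {f : W →ₗ[k] W'} (hf : ∀ w, (f w : H') = t w) (g : EllipticBraidGroup n) (w : W) :
    f (c.ellAction hW g w) = c'.ellAction hW' g (f w) := by
  induction g using PresentedGroup.induction_on with
  | _ g =>
  induction g using FreeGroup.induction_on generalizing w with
  | C1 => simp
  | of g =>
    refine Subtype.ext ?_
    rw [hf]
    refine (congrArg t (c.ellAction_gen hW g w)).trans ?_
    refine Eq.trans ?_ (c'.ellAction_gen hW' g (f w)).symm
    rw [hf, ellOp_natural c c' hφ hp hs]
  | inv_of g ih =>
    -- The hypothesis for a generator, used at the vector moved by its inverse, gives the claim for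
    -- the inverse.
    have h := ih (c.ellAction hW (PresentedGroup.mk _ (FreeGroup.of g))⁻¹ w)
    rw [← Module.End.mul_apply, ← map_mul, mul_inv_cancel, map_one, Module.End.one_apply] at h
    rw [map_inv, h, ← Module.End.mul_apply, ← map_mul, inv_mul_cancel, map_one,
      Module.End.one_apply]
  | mul a b ha hb => simp only [map_mul, Module.End.mul_apply, ha, hb]

end Naturality

end EllipticAction

/-! ### Naturality in the `D_U`-module, and the coaction chain of `V^{⊗n} ⊗ M`. -/

section ConcreteAction

variable {k : Type w} [Field k] {U : Type u} [Ring U] [HopfAlgebra k U]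
variable {n : ℕ} {V : Type v} [AddCommGroup V] [Module k V]
variable {M N : Type x} [AddCommGroup M] [Module k M] [AddCommGroup N] [Module k N]
variable (f : M →ₗ[k] N)

theorem lTensor_rTensor (e : Module.End k (⨂[k] _ : Fin n, V)) (v : TensorSpace k n V M) :
    f.lTensor _ (e.rTensor M v) = e.rTensor N (f.lTensor _ v) :=
  LinearMap.congr_fun ((LinearMap.lTensor_comp_rTensor (f := e) (g := f)).trans
    (LinearMap.rTensor_comp_lTensor (f := e) (g := f)).symm) v

theorem lTensor_factorFlip (i : ℕ) (v : TensorSpace k n V M) :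
    f.lTensor _ (factorFlip k n V M i v) = factorFlip k n V N i (f.lTensor _ v) := by
  unfold factorFlip
  split_ifs
  · exact lTensor_rTensor f _ v
  · rfl

section

variable (Q : QuasitriangularStructure k U)
variable [Module (DU Q) M] [IsScalarTower k (DU Q) M] [Module (DU Q) N] [IsScalarTower k (DU Q) N]

theorem lTensor_onMHom (f : M →ₗ[DU Q] N) (d : DU Q) (v : TensorSpace k n V M) :
    (f.restrictScalars k).lTensor _ (onMHom Q n V M d v) =
      onMHom Q n V N d ((f.restrictScalars k).lTensor _ v) := by
  induction v using TensorProduct.induction_on with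
  | zero => simp
  | add a b ha hb => simp only [map_add, ha, hb]
  | tmul a m =>
    rw [onMHom_tmul, LinearMap.lTensor_tmul, LinearMap.lTensor_tmul, onMHom_tmul]
    exact congrArg (a ⊗ₜ[k] ·) (f.map_smul d m)

end

variable [Module U V] [IsScalarTower k U V]

theorem lTensor_factorAct (i : ℕ) (x : U) (v : TensorSpace k n V M) :
    f.lTensor _ (factorAct k U n V M i x v) = factorAct k U n V N i x (f.lTensor _ v) := by
  unfold factorAct
  split_ifs
  · exact lTensor_rTensor f _ v
  · simp [Module.algebraMap_end_apply]

variable (k U n V M) in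
/-- The coaction of `F` on the first tensor factor, if there is one. -/
def firstCoact [FiniteDimensional k V] : TensorSpace k n V M →ₗ[k] FT k U (TensorSpace k n V M) :=
  if h : 0 < n then factorCoact k U V M ⟨0, h⟩ else 0

variable (Q : QuasitriangularStructure k U)
variable [Module (DU Q) M] [IsScalarTower k (DU Q) M] [Module (DU Q) N] [IsScalarTower k (DU Q) N]

theorem mem_invariants_iff (w : TensorSpace k n V M) : w ∈ invariants Q n V M ↔
    ∀ x : locFin k U, adjAct (onMHom Q n V M) n (factorAct k U n V M) x w =
      Coalgebra.counit (R := k) (x : U) • w := by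
  rw [← adAct_eq]
  rfl

theorem lTensor_mem_invariants (f : M →ₗ[DU Q] N) {w : TensorSpace k n V M}
    (hw : w ∈ invariants Q n V M) :
    (f.restrictScalars k).lTensor _ w ∈ invariants Q n V N := by
  rw [mem_invariants_iff] at hw ⊢
  intro x
  have h := adjAct_natural (n := n) (φ := onMHom Q n V M) (φ' := onMHom Q n V N)
    (lTensor_onMHom Q f) (lTensor_factorAct (U := U) (f.restrictScalars k)) x w
  rw [← h, hw, map_smul]

variable (n V) in
/-- The map of invariants induced by a homomorphism of `D_U`-modules. -/
def invariantsMap (f : M →ₗ[DU Q] N) : invariants Q n V M →ₗ[k] invariants Q n V N :=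
  ((f.restrictScalars k).lTensor _).restrict fun _ => lTensor_mem_invariants Q f

theorem invariantsMap_id :
    invariantsMap n V Q (LinearMap.id : M →ₗ[DU Q] M) = LinearMap.id :=
  LinearMap.ext fun w => Subtype.ext <| LinearMap.congr_fun (LinearMap.lTensor_id (R := k) _ M) w.1

theorem invariantsMap_comp {L : Type x} [AddCommGroup L] [Module k L] [Module (DU Q) L]
    [IsScalarTower k (DU Q) L] (g : N →ₗ[DU Q] L) (f : M →ₗ[DU Q] N) :
    invariantsMap n V Q (g ∘ₗ f) = invariantsMap n V Q g ∘ₗ invariantsMap n V Q f :=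
  LinearMap.ext fun w => Subtype.ext <| LinearMap.congr_fun
    (LinearMap.lTensor_comp (⨂[k] _ : Fin n, V) (g.restrictScalars k) (f.restrictScalars k)) w.1

variable [FiniteDimensional k V]

variable (n V M) in
theorem isCoactChain_factorAct : IsCoactChain (onMHom Q n V M) n (factorAct k U n V M)
    (factorFlip k n V M) (firstCoact k U n V M) where
  toIsChain := isChain_factorAct Q n V M
  isCoact h := by
    rw [firstCoact, dif_pos h]
    exact isCoact_factorCoact h
  hasCoact i h := hasCoact_factorAct h
  hasCoact_antipode h := hasCoact_factorAct_antipode h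

end ConcreteAction

/-! ### The representation on invariants and the functor. -/

section Functor

variable {k : Type w} [Field k] {U : Type u} [Ring U] [HopfAlgebra k U] (𝓡 : RibbonStructure k U)
variable (n : ℕ) (V : Type v) [AddCommGroup V] [Module k V] [Module U V] [IsScalarTower k U V]
variable [FiniteDimensional k V]
variable (M : Type x) [AddCommGroup M] [Module k M] [Module (DU 𝓡.toQuasitriangularStructure) M]
variable [IsScalarTower k (DU 𝓡.toQuasitriangularStructure) M]

/-- The representation of the elliptic braid group on the invariants. -/
def ellRep : Representation k (EllipticBraidGroup n) (invariants 𝓡.toQuasitriangularStructure n V M) :=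
  (isCoactChain_factorAct n V M 𝓡.toQuasitriangularStructure).ellAction
    (mem_invariants_iff 𝓡.toQuasitriangularStructure)

theorem ellRep_gen (g : EllGen n) (w : invariants 𝓡.toQuasitriangularStructure n V M) :
    (ellRep 𝓡 n V M (EllipticBraidGroup.gen g) w : TensorSpace k n V M) =
      ellOp n (onMHom 𝓡.toQuasitriangularStructure n V M) (factorAct k U n V M)
        (factorFlip k n V M) (firstCoact k U n V M) g w :=
  IsCoactChain.ellAction_gen _ _ g w

theorem ellRep_T (i : Fin (n - 1)) (w : invariants 𝓡.toQuasitriangularStructure n V M) :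
    (ellRep 𝓡 n V M (EllipticBraidGroup.gen (.T i)) w : TensorSpace k n V M) =
      opT 𝓡.toQuasitriangularStructure V M i w := by
  rw [ellRep_gen, opT_eq]
  rfl

theorem ellRep_Y (h : 0 < n) (w : invariants 𝓡.toQuasitriangularStructure n V M) :
    (ellRep 𝓡 n V M (EllipticBraidGroup.gen (.Y ⟨0, h⟩)) w : TensorSpace k n V M) =
      opY1 𝓡.toQuasitriangularStructure V M h w := by
  rw [ellRep_gen, opY1_eq]
  rfl

theorem ellRep_X (h : 0 < n) (w : invariants 𝓡.toQuasitriangularStructure n V M) :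
    (ellRep 𝓡 n V M (EllipticBraidGroup.gen (.X ⟨0, h⟩)) w : TensorSpace k n V M) =
      opX1 𝓡.toQuasitriangularStructure V M h w := by
  have hX : firstCoact k U n V M = factorCoact k U V M ⟨0, h⟩ := dif_pos h
  rw [ellRep_gen, opX1_eq, ← hX]
  rfl

variable {M} {N : Type x} [AddCommGroup N] [Module k N] [Module (DU 𝓡.toQuasitriangularStructure) N]
variable [IsScalarTower k (DU 𝓡.toQuasitriangularStructure) N]

/-- The intertwining map induced by a homomorphism of `D_U`-modules. -/
def ellIntertwining (f : M →ₗ[DU 𝓡.toQuasitriangularStructure] N) :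
    (ellRep 𝓡 n V M).IntertwiningMap (ellRep 𝓡 n V N) where
  toLinearMap := invariantsMap n V 𝓡.toQuasitriangularStructure f
  isIntertwining' g := LinearMap.ext fun w =>
    ellAction_natural (isCoactChain_factorAct n V M _) (isCoactChain_factorAct n V N _)
      (lTensor_onMHom _ f) (lTensor_factorAct (f.restrictScalars k))
      (lTensor_factorFlip (f.restrictScalars k))
      (mem_invariants_iff _) (mem_invariants_iff _)
      (f := invariantsMap n V 𝓡.toQuasitriangularStructure f) (fun _ => rfl) g w

end Functor

section Functor

variable {U : Type u} [Ring U] [HopfAlgebra ℂ U] (𝓡 : RibbonStructure ℂ U)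
variable (n : ℕ) (V : Type v) [AddCommGroup V] [Module ℂ V] [Module U V] [IsScalarTower ℂ U V]
variable [FiniteDimensional ℂ V]

/-- The representation of the elliptic braid group on the invariants, as an object of `Rep`. -/
def ellObj (M : ModuleCat.{x} (DU 𝓡.toQuasitriangularStructure)) :
    Rep.{max v x} ℂ (EllipticBraidGroup n) :=
  Rep.of (X := invariants 𝓡.toQuasitriangularStructure n V M) (ellRep 𝓡 n V M)

/-- The functor `M ↦ (V^{⊗n} ⊗ M)^{inv}`. -/
def ellFunctor : ModuleCat.{x} (DU 𝓡.toQuasitriangularStructure) ⥤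
    Rep.{max v x} ℂ (EllipticBraidGroup n) where
  obj := ellObj 𝓡 n V
  map {M N} f := Rep.ofHom (ellIntertwining 𝓡 n V (M := M) (N := N) f.hom)
  map_id M := Rep.hom_ext <| Representation.IntertwiningMap.ext <|
    invariantsMap_id (n := n) (V := V) (M := M) 𝓡.toQuasitriangularStructure
  map_comp f g := Rep.hom_ext <| Representation.IntertwiningMap.ext <|
    invariantsMap_comp (n := n) (V := V) 𝓡.toQuasitriangularStructure g.hom f.hom

end Functor

end

end QuantumD
open QuantumD

theorem mainTheorem1 {U : Type u} [Ring U] [HopfAlgebra ℂ U] (𝓡 : RibbonStructure ℂ U)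
    (n : ℕ) (V : Type v) [AddCommGroup V] [Module ℂ V] [Module U V] [IsScalarTower ℂ U V]
    [FiniteDimensional ℂ V] :
    ∃ (F : ModuleCat.{x} (DU 𝓡.toQuasitriangularStructure) ⥤
          Rep.{max v x} ℂ (EllipticBraidGroup n))
      (e : ∀ M : ModuleCat.{x} (DU 𝓡.toQuasitriangularStructure),
          F.obj M ≃ₗ[ℂ] invariants 𝓡.toQuasitriangularStructure n V M),
      (∀ (M N : ModuleCat.{x} (DU 𝓡.toQuasitriangularStructure)) (f : M ⟶ N) (z : F.obj M),
        (e N ((F.map f).hom z) : TensorSpace ℂ n V N) =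
          (f.hom.restrictScalars ℂ).lTensor _ (e M z : TensorSpace ℂ n V M)) ∧
      (∀ (M : ModuleCat.{x} (DU 𝓡.toQuasitriangularStructure)) (z : F.obj M),
        (∀ i : Fin (n - 1),
          (e M ((F.obj M).ρ (EllipticBraidGroup.gen (.T i)) z) : TensorSpace ℂ n V M) =
            opT 𝓡.toQuasitriangularStructure V M i (e M z)) ∧
        (∀ h : 0 < n,
          (e M ((F.obj M).ρ (EllipticBraidGroup.gen (.Y ⟨0, h⟩)) z) : TensorSpace ℂ n V M) =
              opY1 𝓡.toQuasitriangularStructure V M h (e M z) ∧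
          (e M ((F.obj M).ρ (EllipticBraidGroup.gen (.X ⟨0, h⟩)) z) : TensorSpace ℂ n V M) =
              opX1 𝓡.toQuasitriangularStructure V M h (e M z))) := by
  -- The functor takes values on the space of invariants itself, so the comparison maps are
  -- identities and the formula on morphisms holds by definition.
  exact ⟨ellFunctor 𝓡 n V, fun M => LinearEquiv.refl ℂ _, fun M N f z => rfl,
    fun M z => ⟨fun i => ellRep_T 𝓡 n V M i z,
      fun h => ⟨ellRep_Y 𝓡 n V M h z, ellRep_X 𝓡 n V M h z⟩⟩⟩
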